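/- **Setting.** Let $a<b$ ($=e_{\min},e_{\max}$) and $q_{\min},q_{\max}$ be real numbers. A *channel* is a jointly measurable family $f(q|e)=f_{Q|E}(q|e)$, $e\in[a,b]$, of probability densities in $q$ that vanish outside $[q_{\min},q_{\max}]$. Write $m(e)$ and $\sigma(e)$ for the mean and the standard deviation of $f(\cdot|e)$, $\sigma_{\max}=\sup_{e\in[a,b]}\sigma(e)$, $h(Q|e)=-\int f(q|e)\log_2 f(q|e)\,dq$, and $\varphi(x|e)=\sigma(e)f(m(e)+\sigma(e)x\,|\,e)$ for the standardised shape. For a probability law $P$ of the input on $[a,b]$ let $f_Q(q)=\int f(q|e)\,P(de)$, $h(Q)=-\int f_Q\log_2 f_Q$, and let $I(P)=\int [h(Q)-h(Q|e)]\,P(de)$ be the mutual information. **Slow-change regime.** Consider a family $(f_i)$ of such channels, on the same ranges, indexed by a set with a filter along which limits are taken (for instance a sequence), with $m_i,\sigma_i$ differentiable on $[a,b]$ (derivatives at $a$ and $b$ being one-sided), such that 1. there is $c>0$ with $m_i'(e)\ge c$ for all $i$ and all $e\in[a,b]$; 2. for some $p>1$ the integrals $\int\varphi_i(x|e)^p\,dx$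 are finite and bounded uniformly in $i$ and $e$; 3. $\sigma_{\max,i}\to0$; 4. change is slow on the scale $\sigma_{\max}$, that is, each of the following tends to $0$: $\sup_e \sigma_{\max,i}\,|\sigma_i'(e)|/\sigma_i(e)$; the largest fractional change $|m_i'(r)-m_i'(e)|/m_i'(e)$ over $e,r\in[a,b]$ with $|r-e|\le\sigma_{\max,i}$; and, for every $K>0$, the largest fractional change $|\varphi_i(x|r)-\varphi_i(x|e)|/\varphi_i(x|e)$ over the same $e,r$ and $|x|\le K$. (A fractional change being at most $\eta$ means that the numerator is at most $\eta$ times the denominator.) **Theorem.** Put $$g_i(e)=\frac1{N_i}\,\frac{m_i'(e)}{2^{h_i(Q|e)}},\qquad N_i=\int_a^b\frac{m_i'(x)}{2^{h_i(Q|x)}}\,dx .$$ Then the capacity-achieving input distribution is asymptotically the one with density $g_i$, that is, asymptotically proportional to $m_i'(e)/2^{h_i(Q|e)}$, in the following sense. (a) For every $i$, $N_i>0$ and $g_i$ is a probability density on $[a,b]$. (b) The density $g_i$ asymptotically achieves the capacity: $\sup_P I_i(P)-I_i(g_i)\to0$, where $P$ ranges over all probability laws on $[a,b]$. (c) Let $P_i$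 be input laws on $[a,b]$ that maximise $I_i$ among the input laws with a density, exactly or up to an error that tends to $0$. Then $\int\psi\,dP_i-\int_a^b\psi(e)\,g_i(e)\,de\to0$ for every continuous $\psi:\mathbb R\to\mathbb R$. (d) If the laws $P_i$ of (c) have measurable densities $\tilde f_{E,i}\ge0$ on $[a,b]$ and these vary slowly (the largest fractional change of $\tilde f_{E,i}$ over distances at most $\sigma_{\max,i}$ tends to $0$), then $\int_a^b|\tilde f_{E,i}(e)-g_i(e)|\,de\to0$. If they have such densities and the differences $\tilde f_{E,i}-g_i$ are equicontinuous on $[a,b]$, then $\tilde f_{E,i}-g_i\to0$ uniformly on $[a,b]$. -/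

import Mathlib

open MeasureTheory Set Filter Topology

noncomputable section

/-! A channel is a function `k : ℝ → ℝ → ℝ`; `k e q` is the conditional density of the output `Q`
at `q`, given that the input `E` equals `e`. Only the values for `e ∈ [a, b]` matter. -/

/-- `k e` is a probability density on `[qmin, qmax]` for every `e ∈ [a, b]`. -/
structure IsChannel (a b qmin qmax : ℝ) (k : ℝ → ℝ → ℝ) : Prop where
  measurable : Measurable (Function.uncurry k)
  nonneg : ∀ e ∈ Icc a b, ∀ q, 0 ≤ k e q
  finite_range : ∀ e ∈ Icc a b, ∀ q, q ∉ Icc qmin qmax → k e q = 0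
  integral_eq_one : ∀ e ∈ Icc a b, ∫ q, k e q = 1

/-- Differential entropy, in bits, of a density. -/
def entropy (p : ℝ → ℝ) : ℝ := -∫ q, p q * Real.logb 2 (p q)

/-- `h(Q|e)`. -/
def condEntropy (k : ℝ → ℝ → ℝ) (e : ℝ) : ℝ := entropy (k e)

/-- The conditional mean `m(e)`. -/
def condMean (k : ℝ → ℝ → ℝ) (e : ℝ) : ℝ := ∫ q, q * k e q

/-- The conditional standard deviation `σ(e)`. -/
def condSd (k : ℝ → ℝ → ℝ) (e : ℝ) : ℝ := √(∫ q, (q - condMean k e) ^ 2 * k e q)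

/-- `σ_max`, the largest conditional standard deviation. -/
def sdMax (a b : ℝ) (k : ℝ → ℝ → ℝ) : ℝ := sSup (condSd k '' Icc a b)

/-- The standardised shape `φ(x|e)`, that is
`k e q = (1 / σ(e)) φ((q - m(e)) / σ(e) | e)`. -/
def shape (k : ℝ → ℝ → ℝ) (e x : ℝ) : ℝ := condSd k e * k e (condMean k e + condSd k e * x)

/-- The derivative `m'(e)`, one-sided at the end points of `[a, b]`. -/
def meanSlope (a b : ℝ) (k : ℝ → ℝ → ℝ) (e : ℝ) : ℝ := derivWithin (condMean k) (Icc a b) e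

/-- The output density `f_Q` for the input law `P`. -/
def outputDensity (k : ℝ → ℝ → ℝ) (P : Measure ℝ) (q : ℝ) : ℝ := ∫ e, k e q ∂P

/-- The mutual information `I(Q;E)` for the input law `P`. -/
def mutualInfo (k : ℝ → ℝ → ℝ) (P : Measure ℝ) : ℝ :=
  ∫ e, (entropy (outputDensity k P) - condEntropy k e) ∂P

/-- All probability laws of an input with values in `[a, b]`. -/
def inputLaws (a b : ℝ) : Set (Measure ℝ) := {P | IsProbabilityMeasure P ∧ P (Icc a b)ᶜ = 0}

/-- The laws of inputs with values in `[a, b]` that have a density. -/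
def densityLaws (a b : ℝ) : Set (Measure ℝ) := {P | P ∈ inputLaws a b ∧ P ≪ volume}

/-- The measure on `[a, b]` with density `p`. -/
def lawOfDensity (a b : ℝ) (p : ℝ → ℝ) : Measure ℝ :=
  (volume.restrict (Icc a b)).withDensity fun e => ENNReal.ofReal (p e)

/-- `m'(e) / 2 ^ h(Q|e)`. -/
def slopeOverEntropy (a b : ℝ) (k : ℝ → ℝ → ℝ) (e : ℝ) : ℝ :=
  meanSlope a b k e / (2 : ℝ) ^ condEntropy k e

/-- The normalising factor `N`. -/
def normFactor (a b : ℝ) (k : ℝ → ℝ → ℝ) : ℝ := ∫ e in a..b, slopeOverEntropy a b k e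

/-- `(1 / N) m'(e) / 2 ^ h(Q|e)`. -/
def slowDensity (a b : ℝ) (k : ℝ → ℝ → ℝ) (e : ℝ) : ℝ :=
  1 / normFactor a b k * slopeOverEntropy a b k e

/-- Along `l`, the fractional change of the functions `u i : [a, b] → ℝ` over distances at most
`d i` tends to zero. -/
def SlowlyVarying {ι : Type*} (l : Filter ι) (a b : ℝ) (d : ι → ℝ) (u : ι → ℝ → ℝ) : Prop :=
  ∀ η : ℝ, 0 < η → ∀ᶠ i in l, ∀ e ∈ Icc a b, ∀ r ∈ Icc a b, |r - e| ≤ d i → |u i r - u i e| ≤ η * u i e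

/-- The slow-change regime, as a property of a family of channels along a filter `l`. -/
structure SlowChange {ι : Type*} (l : Filter ι) (a b qmin qmax : ℝ) (k : ι → ℝ → ℝ → ℝ) :
    Prop where
  isChannel : ∀ i, IsChannel a b qmin qmax (k i)
  differentiable_mean : ∀ i, DifferentiableOn ℝ (condMean (k i)) (Icc a b)
  differentiable_sd : ∀ i, DifferentiableOn ℝ (condSd (k i)) (Icc a b)
  /-- `m' > 0`, uniformly in the family -/
  slope_pos : ∃ c : ℝ, 0 < c ∧ ∀ i, ∀ e ∈ Icc a b, c ≤ meanSlope a b (k i) e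
  /-- a uniform bound for some `L^p` norm, `p > 1`, of the standardised shapes -/
  shape_bound : ∃ p : ℝ, 1 < p ∧ ∃ B : ℝ, ∀ i, ∀ e ∈ Icc a b,
    Integrable (fun x => shape (k i) e x ^ p) ∧ ∫ x, shape (k i) e x ^ p ≤ B
  sdMax_tendsto : Tendsto (fun i => sdMax a b (k i)) l (𝓝 0)
  /-- `m'` changes slowly in comparison to `σ_max` -/
  slope_slow : SlowlyVarying l a b (fun i => sdMax a b (k i)) (fun i => meanSlope a b (k i))
  /-- `σ_max d(ln σ)/de ≪ 1` -/
  sd_slow : ∀ η : ℝ, 0 < η → ∀ᶠ i in l, ∀ e ∈ Icc a b,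
    sdMax a b (k i) * |derivWithin (condSd (k i)) (Icc a b) e| ≤ η * condSd (k i) e
  /-- the fractional change of `φ(x|e)`, when `e` changes by at most `σ_max`, is small, uniformly
  for `x` in bounded sets -/
  shape_slow : ∀ K : ℝ, 0 < K → ∀ η : ℝ, 0 < η → ∀ᶠ i in l, ∀ e ∈ Icc a b, ∀ r ∈ Icc a b,
    |r - e| ≤ sdMax a b (k i) → ∀ x, |x| ≤ K →
      |shape (k i) r x - shape (k i) e x| ≤ η * shape (k i) e x

/-- The input laws `P i` maximise the mutual information among the laws in `S`, up to an error
that tends to zero along `l`. Exact maximisers have this property. -/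
def AsympMaximises {ι : Type*} (l : Filter ι) (k : ι → ℝ → ℝ → ℝ) (S : Set (Measure ℝ))
    (P : ι → Measure ℝ) : Prop :=
  ∀ ε : ℝ, 0 < ε → ∀ᶠ i in l, ∀ R ∈ S, mutualInfo (k i) R ≤ mutualInfo (k i) (P i) + ε

end

/-!
Over the width of a conditional density the channel looks like `q = m(e) + noise` with fixed noise,
so the output density that corresponds to the input density `g = m' / (N 2 ^ h(Q|e))` is, near
`m(e)`, close to `1 / (N 2 ^ h(Q|e))`. The proof works in nats, and establishes that the capacity is
`log N + o(1)`.

*Upper bound and stability.* Let `R` be the function `2 ^ (-h(Q|e)) / N` of `q = m(e)`, continued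
beyond the range of `m` by exponential tails (`refDensity`). The tails have small mass, as `N` is
much larger than `σ_max / 2 ^ h(Q|e)` at the end points (`SlowChange.refTail_le`). The cross entropy
of every conditional density against `R` is at most `h(Q|e) + log N + o(1)`, because the conditional
entropy hardly changes over many standard deviations
(`RegularChannel.neg_integral_log_refDensity_le`, based on `StdShape.entropy_le_add`). So
`I(P) + D(f_Q ‖ R) ≤ log N + o(1)` for every input law `P`. This bounds the capacity, and for
near-optimal `P` it makes `f_Q` close to `R` in `L¹`, by a Hellinger form of Pinsker's inequality
(`abs_sub_le_of_gibbs`).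

*Lower bound.* For every conditional density `V(e|q)` one has
`I(g) ≥ ∫∫ g(e) f(q|e) log (V(e|q) / g(e))`. With `V(e|q)` close to `m'(e) f(q|e)` this is
`log N - o(1)`. Replacing the shape at `e` by the shape at `m⁻¹(q)` turns the integral of `V` over
`e` into the integral of a single shape, up to a factor close to `1`, and a Cauchy density of
small weight takes care of the tails (`RegularChannel.natInfo_slowDensity_ge`).

*Convergence.* Since `m' ≥ c`, the estimate `m⁻¹(q)` of the input is off by `O(σ_max)` on average,
so averages of slowly varying test functions with respect to `P` are determined by `f_Q`
(`RegularChannel.abs_integral_sub_le`). This gives weak convergence. For slowly varying densities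
the sign of the difference from `g` can be smoothed over many standard deviations without changing
its averages by much, and then it is such a test function; for equicontinuous differences one tests
with a bump function.
-/

/-! ### Pointwise inequalities for the logarithm -/

/-- The pointwise form of Gibbs' inequality. -/
theorem negMulLog_le_gibbs {t s : ℝ} (ht : 0 ≤ t) (hs : 0 < s) :
    Real.negMulLog t ≤ -(t * Real.log s) + s - t := by
  rcases ht.eq_or_lt with rfl | ht
  · simp [hs.le]
  · have h := Real.log_le_sub_one_of_pos (div_pos hs ht)
    rw [Real.log_div hs.ne' ht.ne'] at h
    have h2 := mul_le_mul_of_nonneg_left h ht.le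
    have h3 : t * (s / t - 1) = s - t := by field_simp
    rw [h3] at h2
    simp only [Real.negMulLog]
    linarith

/-- A weighted form of `log t ≤ 2 / (p - 1) * t ^ ((p - 1) / 2)`; a large `K` makes the first
moment negligible on sets where `t` is large, and the `p`-th moment negligible elsewhere. -/
theorem mul_posLog_le {t p K : ℝ} (ht : 0 ≤ t) (hp : 1 < p) (hK : 0 < K) :
    t * Real.posLog t ≤ (K * t + t ^ p / K) / (p - 1) := by
  rcases ht.eq_or_lt with rfl | ht
  · simp [Real.zero_rpow (by linarith : p ≠ 0)]
  have hp' : 0 < p - 1 := by linarith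
  set y := t ^ ((p - 1) / 2) with hy
  have hy0 : 0 < y := Real.rpow_pos_of_pos ht _
  have h1 : Real.log t ≤ y / ((p - 1) / 2) := Real.log_le_rpow_div ht.le (by linarith)
  have h2 : Real.posLog t ≤ y / ((p - 1) / 2) := by
    rw [Real.posLog_apply]; exact max_le (by positivity) h1
  have h3 : t ^ p = t * (y * y) := by
    rw [hy, ← Real.rpow_add ht, ← Real.rpow_one_add' ht.le (by linarith)]
    congr 1; ring
  rw [h3]
  have h4 : y ≤ (K + y * y / K) / 2 := by
    have : 0 ≤ (K - y) ^ 2 / (2 * K) := by positivity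
    have e : (K - y) ^ 2 / (2 * K) = (K + y * y / K) / 2 - y := by field_simp; ring
    linarith
  calc t * Real.posLog t ≤ t * (y / ((p - 1) / 2)) := by gcongr
    _ ≤ t * (((K + y * y / K) / 2) / ((p - 1) / 2)) := by gcongr
    _ = _ := by field_simp

theorem log_one_add_sq_le (x : ℝ) : Real.log (1 + x ^ 2) ≤ 2 * |x| := by
  have h1 : 1 + x ^ 2 ≤ (1 + |x|) ^ 2 := by
    have := abs_nonneg x
    nlinarith [sq_abs x]
  have h2 : Real.log (1 + |x|) ≤ |x| := by
    have := Real.log_le_sub_one_of_pos (show 0 < 1 + |x| by positivity)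
    linarith
  calc Real.log (1 + x ^ 2) ≤ Real.log ((1 + |x|) ^ 2) :=
        Real.log_le_log (by positivity) h1
    _ = 2 * Real.log (1 + |x|) := by rw [Real.log_pow]; norm_num
    _ ≤ _ := by linarith

theorem abs_negMulLog_le_one_add {t p : ℝ} (ht : 0 ≤ t) (hp : 1 < p) :
    |Real.negMulLog t| ≤ (t + t ^ p) / (p - 1) + 1 := by
  have h0 : 0 ≤ (t + t ^ p) / (p - 1) :=
    div_nonneg (add_nonneg ht (Real.rpow_nonneg ht _)) (by linarith)
  rcases le_total t 1 with h | h
  · rw [abs_of_nonneg (Real.negMulLog_nonneg ht h)]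
    have := negMulLog_le_gibbs ht one_pos
    simp at this
    linarith
  · have h1 := mul_posLog_le ht hp one_pos
    rw [Real.posLog_eq_log (by rwa [abs_of_nonneg ht])] at h1
    have h2 : Real.negMulLog t ≤ 0 := by
      simp only [Real.negMulLog]
      have := mul_nonneg ht (Real.log_nonneg h)
      linarith
    rw [abs_of_nonpos h2]
    simp only [Real.negMulLog] at *
    simp at h1
    linarith

/-! ### Entropy of standardised densities -/

/-- Densities with second moment `1` and with the `p`-th moment of the density bounded by `B`. That
the mean of a standardised density is `0` plays no role. -/
structure StdShape (p B : ℝ) (φ : ℝ → ℝ) : Prop where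
  measurable : Measurable φ
  nonneg : ∀ x, 0 ≤ φ x
  integrable : Integrable φ
  integral_eq_one : ∫ x, φ x = 1
  sq_integrable : Integrable fun x => x ^ 2 * φ x
  sq_integral : ∫ x, x ^ 2 * φ x = 1
  rpow_integrable : Integrable fun x => φ x ^ p
  rpow_le : ∫ x, φ x ^ p ≤ B

/-- A bound for the entropies and the entropy tails of all functions in `StdShape p B`. -/
noncomputable def shapeConst (p B : ℝ) : ℝ := (1 + B) / (p - 1) + 2 + Real.pi

/-- The part of the entropy integral, and of the first absolute moment, outside `[-K, K]`. -/
noncomputable def tailCost (K : ℝ) (φ : ℝ → ℝ) (x : ℝ) : ℝ :=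
  if K < |x| then φ x * (Real.posLog (φ x) + 1 + |x|) else 0

theorem tailCost_nonneg {K : ℝ} {φ : ℝ → ℝ} (h : ∀ x, 0 ≤ φ x) (x : ℝ) : 0 ≤ tailCost K φ x := by
  unfold tailCost
  split_ifs
  · have := h x
    have := Real.posLog_nonneg (x := φ x)
    positivity
  · exact le_rfl

theorem tailCost_le {K p : ℝ} {φ : ℝ → ℝ} (h : ∀ x, 0 ≤ φ x) (hp : 1 < p) (hK : 1 ≤ K) (x : ℝ) :
    tailCost K φ x ≤
      ((2 + 1 / (p - 1)) * (x ^ 2 * φ x) + 1 / (p - 1) * φ x ^ p) / K := by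
  have hp' : 0 < p - 1 := by linarith
  have hx := h x
  have hxp : 0 ≤ φ x ^ p := Real.rpow_nonneg hx _
  unfold tailCost
  split_ifs with hc
  · have h1 := mul_posLog_le hx hp (by linarith : 0 < K)
    have hsq : x ^ 2 = |x| ^ 2 := (sq_abs x).symm
    have h2 : 1 ≤ x ^ 2 / K := by rw [le_div_iff₀ (by linarith), hsq]; nlinarith
    have h3 : |x| ≤ x ^ 2 / K := by rw [le_div_iff₀ (by linarith), hsq]; nlinarith
    have h4 : K ≤ x ^ 2 / K := by rw [le_div_iff₀ (by linarith), hsq]; nlinarith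
    have h5 : (K * φ x + φ x ^ p / K) / (p - 1) ≤ (x ^ 2 / K * φ x + φ x ^ p / K) / (p - 1) := by
      gcongr
    calc φ x * (Real.posLog (φ x) + 1 + |x|)
        = φ x * Real.posLog (φ x) + φ x * 1 + φ x * |x| := by ring
      _ ≤ (x ^ 2 / K * φ x + φ x ^ p / K) / (p - 1) + φ x * (x ^ 2 / K) + φ x * (x ^ 2 / K) := by
          gcongr
          exact h1.trans h5
      _ = _ := by field_simp; ring
  · positivity

theorem measurable_tailCost {K : ℝ} {φ : ℝ → ℝ} (h : Measurable φ) : Measurable (tailCost K φ) := by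
  unfold tailCost
  refine Measurable.ite (measurableSet_lt measurable_const measurable_norm) ?_ measurable_const
  have := Real.continuous_posLog.measurable.comp h
  have h2 : Measurable fun x : ℝ => |x| := measurable_norm
  exact h.mul ((this.add_const 1).add h2)

namespace StdShape

variable {p B K : ℝ} {φ φ' : ℝ → ℝ}

theorem bound_nonneg (h : StdShape p B φ) : 0 ≤ B :=
  (integral_nonneg fun x => Real.rpow_nonneg (h.nonneg x) p).trans h.rpow_le

theorem shapeConst_pos (h : StdShape p B φ) (hp : 1 < p) : 0 < shapeConst p B := by
  have := h.bound_nonneg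
  have := Real.pi_pos
  have : 0 < p - 1 := by linarith
  unfold shapeConst
  positivity

theorem abs_negMulLog_le (h : StdShape p B φ) (hp : 1 < p) (x : ℝ) :
    |Real.negMulLog (φ x)| ≤
      (φ x + φ x ^ p) / (p - 1) + (φ x + x ^ 2 * φ x) + (1 + x ^ 2)⁻¹ := by
  have ht := h.nonneg x
  have h0 : 0 ≤ (φ x + φ x ^ p) / (p - 1) :=
    div_nonneg (add_nonneg ht (Real.rpow_nonneg ht _)) (by linarith)
  have h00 : 0 ≤ x ^ 2 * φ x := by positivity
  have hw : 0 < (1 + x ^ 2)⁻¹ := by positivity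
  rcases le_total (φ x) 1 with h1 | h1
  · rw [abs_of_nonneg (Real.negMulLog_nonneg ht h1)]
    have h2 := negMulLog_le_gibbs ht hw
    rw [Real.log_inv] at h2
    have h3 : φ x * Real.log (1 + x ^ 2) ≤ φ x * (x ^ 2) := by
      gcongr
      have := Real.log_le_sub_one_of_pos (show 0 < 1 + x ^ 2 by positivity)
      linarith
    linarith
  · have h2 := mul_posLog_le ht hp one_pos
    rw [Real.posLog_eq_log (by rwa [abs_of_nonneg ht])] at h2
    have h3 : Real.negMulLog (φ x) ≤ 0 := by
      simp only [Real.negMulLog]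
      have := mul_nonneg ht (Real.log_nonneg h1)
      linarith
    rw [abs_of_nonpos h3]
    simp only [Real.negMulLog] at *
    simp at h2
    linarith

theorem integrable_negMulLog (h : StdShape p B φ) (hp : 1 < p) :
    Integrable fun x => Real.negMulLog (φ x) := by
  have hb : Integrable fun x =>
      (φ x + φ x ^ p) / (p - 1) + (φ x + x ^ 2 * φ x) + (1 + x ^ 2)⁻¹ :=
    (((h.integrable.add h.rpow_integrable).div_const _).add
      (h.integrable.add h.sq_integrable)).add integrable_inv_one_add_sq
  refine hb.mono' (Real.continuous_negMulLog.measurable.comp h.measurable).aestronglyMeasurable ?_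
  exact Eventually.of_forall fun x => h.abs_negMulLog_le hp x

theorem integral_abs_negMulLog_le (h : StdShape p B φ) (hp : 1 < p) :
    ∫ x, |Real.negMulLog (φ x)| ≤ shapeConst p B := by
  have i1 := (h.integrable.add h.rpow_integrable).div_const (p - 1)
  have i2 := h.integrable.add h.sq_integrable
  have i3 := integrable_inv_one_add_sq
  calc ∫ x, |Real.negMulLog (φ x)|
      ≤ ∫ x, ((φ x + φ x ^ p) / (p - 1) + (φ x + x ^ 2 * φ x) + (1 + x ^ 2)⁻¹) :=
        integral_mono (h.integrable_negMulLog hp).abs ((i1.add i2).add i3)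
          fun x => h.abs_negMulLog_le hp x
    _ = (1 + ∫ x, φ x ^ p) / (p - 1) + 2 + Real.pi := by
        have e1 := integral_add (i1.add i2) i3
        have e2 := integral_add i1 i2
        have e3 := integral_add h.integrable h.sq_integrable
        have e4 := integral_add h.integrable h.rpow_integrable
        simp only [Pi.add_apply] at e1 e2 e3 e4
        rw [e1, e2, e3, integral_div, e4, integral_univ_inv_one_add_sq, h.integral_eq_one,
          h.sq_integral]
        ring
    _ ≤ shapeConst p B := by
        have : 0 < p - 1 := by linarith
        unfold shapeConst
        gcongr
        exact h.rpow_le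

theorem abs_integral_negMulLog_le (h : StdShape p B φ) (hp : 1 < p) :
    |∫ x, Real.negMulLog (φ x)| ≤ shapeConst p B :=
  (abs_integral_le_integral_abs).trans (h.integral_abs_negMulLog_le hp)

theorem integrable_tailCost (h : StdShape p B φ) (hp : 1 < p) (hK : 1 ≤ K) :
    Integrable (tailCost K φ) := by
  have i1 := ((h.sq_integrable.const_mul (2 + 1 / (p - 1))).add
    (h.rpow_integrable.const_mul (1 / (p - 1)))).div_const K
  refine i1.mono' (measurable_tailCost h.measurable).aestronglyMeasurable
    (Eventually.of_forall fun x => ?_)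
  rw [Real.norm_eq_abs, abs_of_nonneg (tailCost_nonneg h.nonneg x)]
  exact tailCost_le h.nonneg hp hK x

theorem integral_tailCost_le (h : StdShape p B φ) (hp : 1 < p) (hK : 1 ≤ K) :
    ∫ x, tailCost K φ x ≤ shapeConst p B / K := by
  have i1 := h.sq_integrable.const_mul (2 + 1 / (p - 1))
  have i2 := h.rpow_integrable.const_mul (1 / (p - 1))
  have hp' : 0 < p - 1 := by linarith
  calc ∫ x, tailCost K φ x
      ≤ ∫ x, ((2 + 1 / (p - 1)) * (x ^ 2 * φ x) + 1 / (p - 1) * φ x ^ p) / K :=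
        integral_mono (h.integrable_tailCost hp hK) ((i1.add i2).div_const K)
          fun x => tailCost_le h.nonneg hp hK x
    _ = ((2 + 1 / (p - 1)) + 1 / (p - 1) * ∫ x, φ x ^ p) / K := by
        rw [integral_div, integral_add i1 i2, integral_const_mul, integral_const_mul,
          h.sq_integral, mul_one]
    _ ≤ ((2 + 1 / (p - 1)) + 1 / (p - 1) * B) / K := by
        gcongr
        exact h.rpow_le
    _ ≤ shapeConst p B / K := by
        gcongr
        unfold shapeConst
        have := Real.pi_pos
        have e : (1 + B) / (p - 1) = 1 / (p - 1) + 1 / (p - 1) * B := by field_simp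
        rw [e]; linarith

theorem integrable_abs_mul (h : StdShape p B φ) : Integrable fun x => |x| * φ x := by
  refine (h.integrable.add h.sq_integrable).mono'
    (measurable_norm.mul h.measurable).aestronglyMeasurable (Eventually.of_forall fun x => ?_)
  have := h.nonneg x
  have hx := sq_abs x
  simp only [Real.norm_eq_abs, Pi.add_apply, abs_mul, abs_abs, abs_of_nonneg this]
  nlinarith [sq_nonneg (|x| - 1), abs_nonneg x]

theorem integral_abs_mul_le_one (h : StdShape p B φ) : ∫ x, |x| * φ x ≤ 1 := by
  have i1 := h.integrable.const_mul (1 / 2)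
  have i2 := h.sq_integrable.const_mul (1 / 2)
  have e2 : ∫ x, |x| * φ x ≤ ∫ x, (1 / 2 * φ x + 1 / 2 * (x ^ 2 * φ x)) := by
    refine integral_mono h.integrable_abs_mul (i1.add i2) fun x => ?_
    have := h.nonneg x
    have hx := sq_abs x
    simp only
    nlinarith [sq_nonneg (|x| - 1), abs_nonneg x]
  rw [integral_add i1 i2, integral_const_mul, integral_const_mul, h.integral_eq_one,
    h.sq_integral] at e2
  linarith

/-- The entropy is upper semicontinuous under small fractional changes on a bounded set: by Gibbs'
inequality the entropy of `φ'` is at most its cross entropy against `φ x + δ / (1 + x ^ 2)`, where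
the second term takes care of the tails. -/
theorem entropy_le_add (h : StdShape p B φ) (h' : StdShape p B φ') (hp : 1 < p) {η δ : ℝ}
    (hη : 0 ≤ η) (hδ : 0 < δ) (hδ1 : δ ≤ 1) (hK : 1 ≤ K)
    (hc : ∀ x, |x| ≤ K → |φ' x - φ x| ≤ η * φ x) :
    ∫ x, Real.negMulLog (φ' x) ≤ (∫ x, Real.negMulLog (φ x)) + η * shapeConst p B +
      (3 - Real.log δ) * (shapeConst p B / K) + δ * Real.pi := by
  have hlδ : Real.log δ ≤ 0 := Real.log_nonpos hδ.le hδ1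
  have key : ∀ x, Real.negMulLog (φ' x) ≤ Real.negMulLog (φ x) + η * |Real.negMulLog (φ x)| +
      tailCost K φ x + (2 - Real.log δ) * tailCost K φ' x + (φ x + δ * (1 + x ^ 2)⁻¹ - φ' x) := by
    intro x
    have hφ := h.nonneg x
    have hφ' := h'.nonneg x
    have hw : 0 < δ * (1 + x ^ 2)⁻¹ := by positivity
    have hs : 0 < φ x + δ * (1 + x ^ 2)⁻¹ := by linarith
    have h1 := negMulLog_le_gibbs hφ' hs
    have ha : Real.negMulLog (φ x) = -(φ x * Real.log (φ x)) := by simp [Real.negMulLog]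
    by_cases hx : K < |x|
    · have h2 : Real.log δ - 2 * |x| ≤ Real.log (φ x + δ * (1 + x ^ 2)⁻¹) := by
        calc Real.log δ - 2 * |x| ≤ Real.log δ - Real.log (1 + x ^ 2) := by
              have := log_one_add_sq_le x; linarith
          _ = Real.log (δ * (1 + x ^ 2)⁻¹) := by
              rw [Real.log_mul hδ.ne' (by positivity), Real.log_inv]; ring
          _ ≤ _ := Real.log_le_log hw (by linarith)
      have h3 := mul_le_mul_of_nonneg_left h2 hφ'
      have h4 : φ x * Real.log (φ x) ≤ φ x * Real.posLog (φ x) := by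
        gcongr; rw [Real.posLog_apply]; exact le_max_right _ _
      have p1 := Real.posLog_nonneg (x := φ x)
      have p2 := Real.posLog_nonneg (x := φ' x)
      have h5 : 0 ≤ η * |Real.negMulLog (φ x)| := by positivity
      have h6 : φ x * Real.posLog (φ x) ≤ tailCost K φ x := by
        simp only [tailCost, hx, if_true]
        gcongr
        have := abs_nonneg x
        linarith
      have h7 : φ' x * (2 * |x| - Real.log δ) ≤ (2 - Real.log δ) * tailCost K φ' x := by
        simp only [tailCost, hx, if_true]
        rw [show (2 - Real.log δ) * (φ' x * (Real.posLog (φ' x) + 1 + |x|)) =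
          φ' x * ((2 - Real.log δ) * (Real.posLog (φ' x) + 1 + |x|)) by ring]
        gcongr
        have := abs_nonneg x
        nlinarith [mul_nonneg (by linarith : 0 ≤ -Real.log δ) this,
          mul_nonneg (by linarith : 0 ≤ 2 - Real.log δ) p2]
      nlinarith
    · have hx' : |x| ≤ K := not_lt.1 hx
      have hcx := hc x hx'
      simp only [tailCost, hx, if_false, mul_zero, add_zero]
      rcases hφ.eq_or_lt with h0 | h0
      · rw [← h0] at hcx
        simp at hcx
        rw [hcx, ← h0]
        simp [hw.le]
      · have h2 : Real.log (φ x) ≤ Real.log (φ x + δ * (1 + x ^ 2)⁻¹) :=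
          Real.log_le_log h0 (by linarith)
        have h3 := mul_le_mul_of_nonneg_left h2 hφ'
        have h4 : -((φ' x - φ x) * Real.log (φ x)) ≤ η * φ x * |Real.log (φ x)| := by
          calc -((φ' x - φ x) * Real.log (φ x)) ≤ |(φ' x - φ x) * Real.log (φ x)| := neg_le_abs _
            _ = |φ' x - φ x| * |Real.log (φ x)| := abs_mul _ _
            _ ≤ _ := by gcongr
        have h5 : |Real.negMulLog (φ x)| = φ x * |Real.log (φ x)| := by
          rw [ha, abs_neg, abs_mul, abs_of_nonneg hφ]
        rw [h5, ha]
        nlinarith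
  have i0 := h.integrable_negMulLog hp
  have i1 := i0.add (i0.abs.const_mul η)
  have i2 := i1.add (h.integrable_tailCost hp hK)
  have i3 := i2.add ((h'.integrable_tailCost hp hK).const_mul (2 - Real.log δ))
  have i4 := (h.integrable.add (integrable_inv_one_add_sq.const_mul δ))
  have i5 := i4.sub h'.integrable
  have hm := integral_mono (h'.integrable_negMulLog hp) (i3.add i5) key
  refine hm.trans ?_
  have e1 := integral_add i3 i5
  have e2 := integral_add i2 ((h'.integrable_tailCost hp hK).const_mul (2 - Real.log δ))
  have e3 := integral_add i1 (h.integrable_tailCost hp hK)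
  have e4 := integral_add i0 (i0.abs.const_mul η)
  have e5 := integral_sub i4 h'.integrable
  have e6 := integral_add h.integrable (integrable_inv_one_add_sq.const_mul δ)
  simp only [Pi.add_apply, Pi.sub_apply] at e1 e2 e3 e4 e5 e6 ⊢
  rw [e1, e2, e3, e4, e5, e6, integral_const_mul, integral_const_mul, integral_const_mul,
    integral_univ_inv_one_add_sq, h.integral_eq_one, h'.integral_eq_one]
  have b1 := h.integral_abs_negMulLog_le hp
  have b2 := h.integral_tailCost_le hp hK
  have b3 := mul_le_mul_of_nonneg_left (h'.integral_tailCost_le hp hK)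
    (by linarith : 0 ≤ 2 - Real.log δ)
  have b4 := mul_le_mul_of_nonneg_left b1 hη
  linarith

end StdShape

/-! ### A single channel -/

/-- Differential entropy in nats. -/
noncomputable def natEntropy (p : ℝ → ℝ) : ℝ := ∫ q, Real.negMulLog (p q)

theorem entropy_eq_natEntropy_div (p : ℝ → ℝ) : entropy p = natEntropy p / Real.log 2 := by
  unfold entropy natEntropy Real.logb Real.negMulLog
  rw [← integral_neg, ← integral_div]
  congr 1; ext q; ring

theorem two_rpow_condEntropy (k : ℝ → ℝ → ℝ) (e : ℝ) :
    (2 : ℝ) ^ condEntropy k e = Real.exp (natEntropy (k e)) := by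
  rw [condEntropy, entropy_eq_natEntropy_div, Real.rpow_def_of_pos two_pos,
    mul_div_cancel₀ _ (Real.log_pos one_lt_two).ne']

/-- A member of a family in the slow-change regime, apart from the smallness conditions. Here `c`
bounds `m'` from below, and `B` bounds the integrals of the `p`-th powers of the shapes. -/
structure RegularChannel (a b qmin qmax c p B : ℝ) (k : ℝ → ℝ → ℝ) : Prop where
  lt : a < b
  isChannel : IsChannel a b qmin qmax k
  diff_mean : DifferentiableOn ℝ (condMean k) (Icc a b)
  diff_sd : DifferentiableOn ℝ (condSd k) (Icc a b)
  c_pos : 0 < c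
  slope : ∀ e ∈ Icc a b, c ≤ meanSlope a b k e
  one_lt : 1 < p
  shape_bound : ∀ e ∈ Icc a b,
    Integrable (fun x => shape k e x ^ p) ∧ ∫ x, shape k e x ^ p ≤ B

namespace RegularChannel

variable {a b qmin qmax c p B : ℝ} {k : ℝ → ℝ → ℝ}

theorem measurable_apply (h : RegularChannel a b qmin qmax c p B k) (e : ℝ) : Measurable (k e) :=
  h.isChannel.measurable.of_uncurry_left

theorem integrable (h : RegularChannel a b qmin qmax c p B k) {e : ℝ} (he : e ∈ Icc a b) :
    Integrable (k e) :=
  integrable_of_integral_eq_one (h.isChannel.integral_eq_one e he)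

theorem integrable_mul (h : RegularChannel a b qmin qmax c p B k) {e : ℝ} (he : e ∈ Icc a b)
    {F : ℝ → ℝ} (hF : Measurable F) {C : ℝ} (hC : ∀ q ∈ Icc qmin qmax, |F q| ≤ C) :
    Integrable fun q => F q * k e q := by
  refine ((h.integrable he).const_mul C).mono' (hF.mul (h.measurable_apply e)).aestronglyMeasurable
    (Eventually.of_forall fun q => ?_)
  have h0 := h.isChannel.nonneg e he q
  rw [Real.norm_eq_abs, abs_mul, abs_of_nonneg h0]
  by_cases hq : q ∈ Icc qmin qmax
  · exact mul_le_mul_of_nonneg_right (hC q hq) h0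
  · simp [h.isChannel.finite_range e he q hq]

theorem integrable_continuous_mul (h : RegularChannel a b qmin qmax c p B k) {e : ℝ}
    (he : e ∈ Icc a b) {F : ℝ → ℝ} (hF : Continuous F) : Integrable fun q => F q * k e q := by
  obtain ⟨C, hC⟩ := isCompact_Icc.exists_bound_of_continuousOn (s := Icc qmin qmax) hF.continuousOn
  exact h.integrable_mul he hF.measurable hC

theorem sd_pos (h : RegularChannel a b qmin qmax c p B k) {e : ℝ} (he : e ∈ Icc a b) :
    0 < condSd k e := by
  unfold condSd
  apply Real.sqrt_pos_of_pos
  have hnn : ∀ q, 0 ≤ (q - condMean k e) ^ 2 * k e q := fun q =>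
    mul_nonneg (sq_nonneg _) (h.isChannel.nonneg e he q)
  refine lt_of_le_of_ne (integral_nonneg hnn) fun h0 => ?_
  have hi : Integrable fun q => (q - condMean k e) ^ 2 * k e q :=
    h.integrable_continuous_mul he (by fun_prop)
  have h1 := (integral_eq_zero_iff_of_nonneg hnn hi).1 h0.symm
  have h2 : ∀ᵐ q : ℝ, q ≠ condMean k e := by
    simp [ae_iff]
  have h3 : k e =ᵐ[volume] 0 := by
    filter_upwards [h1, h2] with q hq hq2
    have : q - condMean k e ≠ 0 := sub_ne_zero.2 hq2
    simpa [this] using hq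
  have h4 := h.isChannel.integral_eq_one e he
  rw [integral_congr_ae h3] at h4
  simp at h4

theorem sq_sd (h : RegularChannel a b qmin qmax c p B k) {e : ℝ} (he : e ∈ Icc a b) :
    condSd k e ^ 2 = ∫ q, (q - condMean k e) ^ 2 * k e q :=
  Real.sq_sqrt (integral_nonneg fun q => mul_nonneg (sq_nonneg _) (h.isChannel.nonneg e he q))

/-- The affine substitution `q = m(e) + σ(e) x`. -/
theorem integral_subst (h : RegularChannel a b qmin qmax c p B k) {e : ℝ} (he : e ∈ Icc a b)
    (G : ℝ → ℝ) :
    ∫ q, G q = ∫ x, condSd k e * G (condMean k e + condSd k e * x) := by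
  have hs := h.sd_pos he
  rw [integral_const_mul, Measure.integral_comp_mul_left (fun y => G (condMean k e + y)),
    integral_add_left_eq_self (μ := volume) G, abs_of_pos (inv_pos.2 hs), smul_eq_mul,
    mul_inv_cancel_left₀ hs.ne']

theorem integrable_subst (h : RegularChannel a b qmin qmax c p B k) {e : ℝ} (he : e ∈ Icc a b)
    (G : ℝ → ℝ) :
    Integrable G ↔ Integrable fun x => condSd k e * G (condMean k e + condSd k e * x) := by
  have hs := h.sd_pos he
  rw [integrable_const_mul_iff (IsUnit.mk0 _ hs.ne'),
    integrable_comp_mul_left_iff (fun y => G (condMean k e + y)) hs.ne']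
  exact ⟨fun hG => hG.comp_add_left _, fun hG => by simpa using hG.comp_add_left (-condMean k e)⟩

theorem measurable_shape (h : RegularChannel a b qmin qmax c p B k) (e : ℝ) :
    Measurable (shape k e) :=
  ((h.measurable_apply e).comp (by fun_prop)).const_mul _

theorem shape_nonneg (h : RegularChannel a b qmin qmax c p B k) {e : ℝ} (he : e ∈ Icc a b)
    (x : ℝ) : 0 ≤ shape k e x :=
  mul_nonneg (h.sd_pos he).le (h.isChannel.nonneg e he _)

theorem apply_eq_shape (h : RegularChannel a b qmin qmax c p B k) {e : ℝ} (he : e ∈ Icc a b)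
    (q : ℝ) : k e q = shape k e ((q - condMean k e) / condSd k e) / condSd k e := by
  have hs := (h.sd_pos he).ne'
  unfold shape
  rw [mul_div_cancel₀ _ hs, mul_div_cancel_left₀ _ hs]
  congr 1; ring

/-- Averages against the channel in terms of the standardised variable. -/
theorem integral_mul_eq (h : RegularChannel a b qmin qmax c p B k) {e : ℝ} (he : e ∈ Icc a b)
    (F : ℝ → ℝ) :
    ∫ q, F ((q - condMean k e) / condSd k e) * k e q = ∫ x, F x * shape k e x := by
  rw [h.integral_subst he]
  congr 1; ext x
  have hs := (h.sd_pos he).ne'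
  rw [add_sub_cancel_left, mul_div_cancel_left₀ _ hs]
  unfold shape; ring

theorem integrable_mul_iff (h : RegularChannel a b qmin qmax c p B k) {e : ℝ} (he : e ∈ Icc a b)
    (F : ℝ → ℝ) :
    Integrable (fun q => F ((q - condMean k e) / condSd k e) * k e q) ↔
      Integrable fun x => F x * shape k e x := by
  rw [h.integrable_subst he]
  have hs := (h.sd_pos he).ne'
  have : (fun x => condSd k e * (F ((condMean k e + condSd k e * x - condMean k e) / condSd k e) *
      k e (condMean k e + condSd k e * x))) = fun x => F x * shape k e x := by
    ext x
    rw [add_sub_cancel_left, mul_div_cancel_left₀ _ hs]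
    unfold shape; ring
  rw [this]

theorem stdShape (h : RegularChannel a b qmin qmax c p B k) {e : ℝ} (he : e ∈ Icc a b) :
    StdShape p B (shape k e) := by
  have hs := h.sd_pos he
  have e2 : (fun q => ((q - condMean k e) / condSd k e) ^ 2 * k e q) =
      fun q => (q - condMean k e) ^ 2 * k e q / condSd k e ^ 2 := by
    ext q; rw [div_pow]; ring
  refine ⟨h.measurable_shape e, h.shape_nonneg he, ?_, ?_, ?_, ?_, (h.shape_bound e he).1,
    (h.shape_bound e he).2⟩
  · have := (h.integrable_mul_iff he fun _ => 1).1 (by simpa using h.integrable he)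
    simpa using this
  · have := h.integral_mul_eq he fun _ => 1
    simp only [one_mul] at this
    rw [← this, h.isChannel.integral_eq_one e he]
  · refine (h.integrable_mul_iff he fun x => x ^ 2).1 ?_
    rw [e2]
    exact (h.integrable_continuous_mul he (F := fun q => (q - condMean k e) ^ 2)
      (by fun_prop)).div_const _
  · rw [← h.integral_mul_eq he fun x => x ^ 2, e2, integral_div, ← h.sq_sd he]
    exact div_self (by positivity)

theorem mul_negMulLog_eq (h : RegularChannel a b qmin qmax c p B k) {e : ℝ} (he : e ∈ Icc a b)
    (x : ℝ) : condSd k e * Real.negMulLog (k e (condMean k e + condSd k e * x)) =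
      Real.negMulLog (shape k e x) + Real.log (condSd k e) * shape k e x := by
  have hs := h.sd_pos he
  have : k e (condMean k e + condSd k e * x) = (condSd k e)⁻¹ * shape k e x := by
    unfold shape; rw [inv_mul_cancel_left₀ hs.ne']
  rw [this, Real.negMulLog_mul]
  simp only [Real.negMulLog, Real.log_inv]
  field_simp
  ring

theorem integrable_negMulLog (h : RegularChannel a b qmin qmax c p B k) {e : ℝ}
    (he : e ∈ Icc a b) : Integrable fun q => Real.negMulLog (k e q) := by
  rw [h.integrable_subst he]
  simp_rw [h.mul_negMulLog_eq he]
  exact ((h.stdShape he).integrable_negMulLog h.one_lt).add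
    ((h.stdShape he).integrable.const_mul _)

theorem natEntropy_eq (h : RegularChannel a b qmin qmax c p B k) {e : ℝ} (he : e ∈ Icc a b) :
    natEntropy (k e) = Real.log (condSd k e) + natEntropy (shape k e) := by
  unfold natEntropy
  rw [h.integral_subst he]
  simp_rw [h.mul_negMulLog_eq he]
  rw [integral_add ((h.stdShape he).integrable_negMulLog h.one_lt)
    ((h.stdShape he).integrable.const_mul _), integral_const_mul, (h.stdShape he).integral_eq_one]
  ring

theorem left_mem (h : RegularChannel a b qmin qmax c p B k) : a ∈ Icc a b := left_mem_Icc.2 h.lt.le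

theorem right_mem (h : RegularChannel a b qmin qmax c p B k) : b ∈ Icc a b :=
  right_mem_Icc.2 h.lt.le

theorem sd_le (h : RegularChannel a b qmin qmax c p B k) {e : ℝ} (he : e ∈ Icc a b) :
    condSd k e ≤ sdMax a b k :=
  le_csSup (isCompact_Icc.image_of_continuousOn h.diff_sd.continuousOn).bddAbove
    (mem_image_of_mem _ he)

theorem sdMax_pos (h : RegularChannel a b qmin qmax c p B k) : 0 < sdMax a b k :=
  (h.sd_pos h.left_mem).trans_le (h.sd_le h.left_mem)

theorem exists_le_sd (h : RegularChannel a b qmin qmax c p B k) :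
    ∃ s, 0 < s ∧ ∀ e ∈ Icc a b, s ≤ condSd k e := by
  obtain ⟨e, he, hm⟩ := isCompact_Icc.exists_isMinOn ⟨a, h.left_mem⟩ h.diff_sd.continuousOn
  exact ⟨_, h.sd_pos he, fun r hr => hm hr⟩

theorem abs_log_sd_sub_le (h : RegularChannel a b qmin qmax c p B k) {η : ℝ}
    (hη : ∀ e ∈ Icc a b, sdMax a b k * |derivWithin (condSd k) (Icc a b) e| ≤ η * condSd k e)
    {e r : ℝ} (he : e ∈ Icc a b) (hr : r ∈ Icc a b) :
    |Real.log (condSd k r) - Real.log (condSd k e)| ≤ η / sdMax a b k * |r - e| := by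
  have := Convex.norm_image_sub_le_of_norm_hasDerivWithin_le (s := Icc a b)
    (f := fun e => Real.log (condSd k e))
    (f' := fun e => derivWithin (condSd k) (Icc a b) e / condSd k e)
    (C := η / sdMax a b k) (fun x hx => ?_) (fun x hx => ?_) (convex_Icc a b) he hr
  · simpa using this
  · exact ((h.diff_sd x hx).hasDerivWithinAt).log (h.sd_pos hx).ne'
  · have hs := h.sd_pos hx
    rw [Real.norm_eq_abs, abs_div, abs_of_pos hs, div_le_div_iff₀ hs h.sdMax_pos]
    have := hη x hx
    linarith

theorem hasDerivWithinAt_mean (h : RegularChannel a b qmin qmax c p B k) {e : ℝ}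
    (he : e ∈ Icc a b) : HasDerivWithinAt (condMean k) (meanSlope a b k e) (Icc a b) e :=
  (h.diff_mean e he).hasDerivWithinAt

theorem mean_sub_ge (h : RegularChannel a b qmin qmax c p B k) {e r : ℝ} (he : e ∈ Icc a b)
    (hr : r ∈ Icc a b) (her : e ≤ r) : c * (r - e) ≤ condMean k r - condMean k e := by
  refine (convex_Icc a b).mul_sub_le_image_sub_of_le_deriv h.diff_mean.continuousOn
    (h.diff_mean.mono interior_subset) (fun x hx => ?_) e he r hr her
  have h1 := h.slope x (interior_subset hx)
  rwa [meanSlope, derivWithin_of_mem_nhds (mem_interior_iff_mem_nhds.1 hx)] at h1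

theorem abs_mean_sub_ge (h : RegularChannel a b qmin qmax c p B k) {e r : ℝ} (he : e ∈ Icc a b)
    (hr : r ∈ Icc a b) : c * |r - e| ≤ |condMean k r - condMean k e| := by
  rcases le_total e r with h1 | h1
  · rw [abs_of_nonneg (by linarith)]
    exact (h.mean_sub_ge he hr h1).trans (le_abs_self _)
  · rw [abs_sub_comm, abs_sub_comm (condMean k r), abs_of_nonneg (by linarith)]
    exact (h.mean_sub_ge hr he h1).trans (le_abs_self _)

theorem strictMonoOn_mean (h : RegularChannel a b qmin qmax c p B k) :
    StrictMonoOn (condMean k) (Icc a b) := by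
  intro e he r hr her
  have := h.mean_sub_ge he hr her.le
  have := mul_pos h.c_pos (sub_pos.2 her)
  linarith

theorem image_mean (h : RegularChannel a b qmin qmax c p B k) :
    condMean k '' Icc a b = Icc (condMean k a) (condMean k b) := by
  refine Subset.antisymm ?_ (intermediate_value_Icc h.lt.le h.diff_mean.continuousOn)
  rintro _ ⟨e, he, rfl⟩
  exact ⟨h.strictMonoOn_mean.monotoneOn h.left_mem he he.1,
    h.strictMonoOn_mean.monotoneOn he h.right_mem he.2⟩

end RegularChannel

/-- The estimate of the input from the output: the point of `[a, b]` whose conditional mean is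
closest to `q`. -/
noncomputable def inputEstimate (a b : ℝ) (k : ℝ → ℝ → ℝ) (q : ℝ) : ℝ :=
  Function.invFunOn (condMean k) (Icc a b) (max (condMean k a) (min q (condMean k b)))

namespace RegularChannel

variable {a b qmin qmax c p B : ℝ} {k : ℝ → ℝ → ℝ}

theorem clamp_mem (h : RegularChannel a b qmin qmax c p B k) (q : ℝ) :
    max (condMean k a) (min q (condMean k b)) ∈ condMean k '' Icc a b := by
  rw [h.image_mean]
  exact ⟨le_max_left _ _, max_le (h.strictMonoOn_mean.monotoneOn h.left_mem h.right_mem h.lt.le)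
    (min_le_right _ _)⟩

theorem estimate_mem (h : RegularChannel a b qmin qmax c p B k) (q : ℝ) :
    inputEstimate a b k q ∈ Icc a b :=
  Function.invFunOn_mem (h.clamp_mem q)

theorem mean_estimate (h : RegularChannel a b qmin qmax c p B k) (q : ℝ) :
    condMean k (inputEstimate a b k q) = max (condMean k a) (min q (condMean k b)) :=
  Function.invFunOn_eq (h.clamp_mem q)

theorem estimate_mean (h : RegularChannel a b qmin qmax c p B k) {e : ℝ} (he : e ∈ Icc a b) :
    inputEstimate a b k (condMean k e) = e := by
  apply h.strictMonoOn_mean.injOn (h.estimate_mem _) he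
  rw [h.mean_estimate]
  have : condMean k e ∈ Icc (condMean k a) (condMean k b) := h.image_mean ▸ mem_image_of_mem _ he
  rw [min_eq_left this.2, max_eq_right this.1]

theorem monotone_estimate (h : RegularChannel a b qmin qmax c p B k) :
    Monotone (inputEstimate a b k) := by
  intro q q' hq
  rw [← h.strictMonoOn_mean.le_iff_le (h.estimate_mem _) (h.estimate_mem _), h.mean_estimate,
    h.mean_estimate]
  gcongr

theorem measurable_estimate (h : RegularChannel a b qmin qmax c p B k) :
    Measurable (inputEstimate a b k) := h.monotone_estimate.measurable

theorem abs_mean_estimate_sub_le (h : RegularChannel a b qmin qmax c p B k) {e : ℝ}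
    (he : e ∈ Icc a b) (q : ℝ) :
    |condMean k (inputEstimate a b k q) - condMean k e| ≤ |q - condMean k e| := by
  have h1 : condMean k e ∈ Icc (condMean k a) (condMean k b) := h.image_mean ▸ mem_image_of_mem _ he
  have h2 : max (condMean k a) (min (condMean k e) (condMean k b)) = condMean k e := by
    rw [min_eq_left h1.2, max_eq_right h1.1]
  rw [h.mean_estimate]
  nth_rw 1 [← h2]
  calc |max (condMean k a) (min q (condMean k b)) -
      max (condMean k a) (min (condMean k e) (condMean k b))|
      ≤ |min q (condMean k b) - min (condMean k e) (condMean k b)| := by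
        rw [max_comm (condMean k a), max_comm (condMean k a)]
        exact abs_max_sub_max_le_abs _ _ _
    _ ≤ |q - condMean k e| := by
        have := abs_min_sub_min_le_max q (condMean k b) (condMean k e) (condMean k b)
        simpa using this

theorem abs_estimate_sub_le (h : RegularChannel a b qmin qmax c p B k) {e : ℝ}
    (he : e ∈ Icc a b) (q : ℝ) : |inputEstimate a b k q - e| ≤ |q - condMean k e| / c := by
  rw [le_div_iff₀ h.c_pos, mul_comm]
  exact (h.abs_mean_sub_ge he (h.estimate_mem q)).trans (h.abs_mean_estimate_sub_le he q)

theorem abs_sub_mean_estimate_le (h : RegularChannel a b qmin qmax c p B k) {e : ℝ}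
    (he : e ∈ Icc a b) (q : ℝ) :
    |q - condMean k (inputEstimate a b k q)| ≤ |q - condMean k e| := by
  have h1 : condMean k e ∈ Icc (condMean k a) (condMean k b) := h.image_mean ▸ mem_image_of_mem _ he
  rw [h.mean_estimate]
  rcases le_total q (condMean k a) with h2 | h2
  · rw [max_eq_left ((min_le_left _ _).trans h2), abs_sub_comm, abs_sub_comm q,
      abs_of_nonneg (by linarith), abs_of_nonneg (by linarith [h1.1])]
    linarith [h1.1]
  · rcases le_total q (condMean k b) with h3 | h3
    · rw [min_eq_left h3, max_eq_right h2]; simp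
    · rw [min_eq_right h3, max_eq_right (h1.1.trans h1.2), abs_of_nonneg (by linarith),
        abs_of_nonneg (by linarith [h1.2])]
      linarith [h1.2]

/-- The first absolute moment around the mean is at most the standard deviation. -/
theorem integral_abs_sub_mean_le (h : RegularChannel a b qmin qmax c p B k) {e : ℝ}
    (he : e ∈ Icc a b) : ∫ q, |q - condMean k e| * k e q ≤ condSd k e := by
  have hs := h.sd_pos he
  have h0 := h.stdShape he
  have e1 : ∫ q, |q - condMean k e| * k e q = condSd k e * ∫ x, |x| * shape k e x := by
    rw [← h.integral_mul_eq he fun x => |x|, ← integral_const_mul]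
    congr 1; ext q
    rw [abs_div, abs_of_pos hs]; field_simp
  rw [e1]
  nlinarith [h0.integral_abs_mul_le_one]

theorem measurable_natEntropy (h : RegularChannel a b qmin qmax c p B k) :
    Measurable fun e => natEntropy (k e) := by
  have : Measurable (Function.uncurry fun e q => Real.negMulLog (k e q)) :=
    Real.continuous_negMulLog.measurable.comp h.isChannel.measurable
  exact (this.stronglyMeasurable.integral_prod_right (ν := volume)).measurable

theorem abs_natEntropy_sub_le (h : RegularChannel a b qmin qmax c p B k) {e r : ℝ}
    (he : e ∈ Icc a b) (hr : r ∈ Icc a b) :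
    |natEntropy (k r) - natEntropy (k e)| ≤
      |Real.log (condSd k r) - Real.log (condSd k e)| + 2 * shapeConst p B := by
  rw [h.natEntropy_eq he, h.natEntropy_eq hr]
  have h1 := (h.stdShape he).abs_integral_negMulLog_le h.one_lt
  have h2 := (h.stdShape hr).abs_integral_negMulLog_le h.one_lt
  change |natEntropy (shape k e)| ≤ _ at h1
  change |natEntropy (shape k r)| ≤ _ at h2
  have h3 := abs_add_le (Real.log (condSd k r) - Real.log (condSd k e))
    (natEntropy (shape k r) - natEntropy (shape k e))
  have h4 := abs_sub (natEntropy (shape k r)) (natEntropy (shape k e))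
  rw [add_sub_add_comm]
  linarith

theorem exists_abs_natEntropy_le (h : RegularChannel a b qmin qmax c p B k) :
    ∃ C, ∀ e ∈ Icc a b, |natEntropy (k e)| ≤ C := by
  obtain ⟨s, hs, hle⟩ := h.exists_le_sd
  refine ⟨|Real.log s| + |Real.log (sdMax a b k)| + shapeConst p B, fun e he => ?_⟩
  rw [h.natEntropy_eq he]
  have h1 := (h.stdShape he).abs_integral_negMulLog_le h.one_lt
  change |natEntropy (shape k e)| ≤ _ at h1
  have h2 := Real.log_le_log hs (hle e he)
  have h3 := Real.log_le_log (h.sd_pos he) (h.sd_le he)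
  have h4 := abs_add_le (Real.log (condSd k e)) (natEntropy (shape k e))
  have h5 : |Real.log (condSd k e)| ≤ |Real.log s| + |Real.log (sdMax a b k)| :=
    abs_le.2 ⟨by linarith [neg_abs_le (Real.log s), abs_nonneg (Real.log (sdMax a b k))],
      by linarith [le_abs_self (Real.log (sdMax a b k)), abs_nonneg (Real.log s)]⟩
  linarith

/-- The bound depends on the channel through the smallest standard deviation; it only serves to
make the entropies of the output densities finite. -/
theorem exists_integral_rpow_le (h : RegularChannel a b qmin qmax c p B k) :
    ∃ C, ∀ e ∈ Icc a b, Integrable (fun q => k e q ^ p) ∧ ∫ q, k e q ^ p ≤ C := by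
  obtain ⟨s, hs, hle⟩ := h.exists_le_sd
  have hp : 0 < p - 1 := by linarith [h.one_lt]
  refine ⟨(s ^ (p - 1))⁻¹ * B, fun e he => ?_⟩
  have hse := h.sd_pos he
  have hB := (h.stdShape he).bound_nonneg
  have key : ∀ x, condSd k e * k e (condMean k e + condSd k e * x) ^ p =
      (condSd k e ^ (p - 1))⁻¹ * shape k e x ^ p := by
    intro x
    unfold shape
    rw [Real.mul_rpow hse.le (h.isChannel.nonneg e he _)]
    have : condSd k e ^ p = condSd k e ^ (p - 1) * condSd k e := by
      rw [← Real.rpow_add_one' hse.le (by linarith)]; congr 1; ring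
    have : condSd k e ^ (p - 1) ≠ 0 := (Real.rpow_pos_of_pos hse _).ne'
    rw [‹condSd k e ^ p = _›]
    field_simp
  constructor
  · rw [h.integrable_subst he]
    simp_rw [key]
    exact (h.shape_bound e he).1.const_mul _
  · rw [h.integral_subst he]
    simp_rw [key]
    rw [integral_const_mul]
    have h1 : s ^ (p - 1) ≤ condSd k e ^ (p - 1) := Real.rpow_le_rpow hs.le (hle e he) hp.le
    have h2 : 0 < s ^ (p - 1) := Real.rpow_pos_of_pos hs _
    calc (condSd k e ^ (p - 1))⁻¹ * ∫ x, shape k e x ^ p ≤ (condSd k e ^ (p - 1))⁻¹ * B := by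
          gcongr
          exact (h.shape_bound e he).2
      _ ≤ _ := by gcongr

end RegularChannel

/-! ### Output densities and mutual information -/

/-- Mutual information in nats. -/
noncomputable def natInfo (k : ℝ → ℝ → ℝ) (P : Measure ℝ) : ℝ :=
  natEntropy (outputDensity k P) - ∫ e, natEntropy (k e) ∂P

theorem ae_mem_of_mem_inputLaws {a b : ℝ} {P : Measure ℝ} (hP : P ∈ inputLaws a b) :
    ∀ᵐ e ∂P, e ∈ Icc a b := by
  rw [ae_iff]; exact hP.2

theorem integrable_of_bounded_on {a b : ℝ} {P : Measure ℝ} (hP : P ∈ inputLaws a b) {F : ℝ → ℝ}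
    (hF : AEStronglyMeasurable F P) {C : ℝ} (hC : ∀ e ∈ Icc a b, |F e| ≤ C) : Integrable F P := by
  have := hP.1
  refine (integrable_const C).mono' hF ?_
  filter_upwards [ae_mem_of_mem_inputLaws hP] with e he using hC e he

theorem integrable_uncurry_of_bounded {a b : ℝ} {P : Measure ℝ} (hP : P ∈ inputLaws a b)
    {F : ℝ → ℝ → ℝ} (hF : Measurable (Function.uncurry F)) {C : ℝ}
    (hC : ∀ e ∈ Icc a b, Integrable (F e) ∧ ∫ q, |F e q| ≤ C) :
    Integrable (Function.uncurry F) (P.prod volume) := by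
  have := hP.1
  have hm := ae_mem_of_mem_inputLaws hP
  rw [integrable_prod_iff hF.aestronglyMeasurable]
  refine ⟨by filter_upwards [hm] with e he using (hC e he).1, ?_⟩
  refine integrable_of_bounded_on hP (C := C) ?_ fun e he => ?_
  · exact (hF.norm.stronglyMeasurable.integral_prod_right (ν := volume)).aestronglyMeasurable
  · rw [abs_of_nonneg (integral_nonneg fun q => norm_nonneg _)]
    exact (hC e he).2

namespace RegularChannel

variable {a b qmin qmax c p B : ℝ} {k : ℝ → ℝ → ℝ} {P : Measure ℝ}

theorem integrable_uncurry (h : RegularChannel a b qmin qmax c p B k) (hP : P ∈ inputLaws a b) :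
    Integrable (Function.uncurry k) (P.prod volume) := by
  refine integrable_uncurry_of_bounded hP h.isChannel.measurable (C := 1) fun e he =>
    ⟨h.integrable he, ?_⟩
  simp_rw [fun q => abs_of_nonneg (h.isChannel.nonneg e he q)]
  exact (h.isChannel.integral_eq_one e he).le

theorem integrable_uncurry_mul (h : RegularChannel a b qmin qmax c p B k)
    (hP : P ∈ inputLaws a b) {G : ℝ → ℝ} (hG : Measurable G) {C : ℝ}
    (hC : ∀ q ∈ Icc qmin qmax, |G q| ≤ C) :
    Integrable (Function.uncurry fun e q => G q * k e q) (P.prod volume) := by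
  refine integrable_uncurry_of_bounded hP ((hG.comp measurable_snd).mul h.isChannel.measurable)
    (C := C) fun e he => ⟨h.integrable_mul he hG hC, ?_⟩
  calc ∫ q, |G q * k e q| ≤ ∫ q, C * k e q := by
        refine integral_mono (h.integrable_mul he hG hC).abs ((h.integrable he).const_mul C)
          fun q => ?_
        have h0 := h.isChannel.nonneg e he q
        simp only [abs_mul, abs_of_nonneg h0]
        by_cases hq : q ∈ Icc qmin qmax
        · exact mul_le_mul_of_nonneg_right (hC q hq) h0
        · simp [h.isChannel.finite_range e he q hq]
    _ = C := by rw [integral_const_mul, h.isChannel.integral_eq_one e he, mul_one]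

theorem measurable_output (h : RegularChannel a b qmin qmax c p B k) (hP : P ∈ inputLaws a b) :
    Measurable (outputDensity k P) := by
  have := hP.1
  exact (h.isChannel.measurable.stronglyMeasurable.integral_prod_left (μ := P)).measurable

theorem output_nonneg (h : RegularChannel a b qmin qmax c p B k) (hP : P ∈ inputLaws a b) (q : ℝ) :
    0 ≤ outputDensity k P q :=
  integral_nonneg_of_ae (by
    filter_upwards [ae_mem_of_mem_inputLaws hP] with e he using h.isChannel.nonneg e he q)

theorem output_eq_zero (h : RegularChannel a b qmin qmax c p B k) (hP : P ∈ inputLaws a b) {q : ℝ}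
    (hq : q ∉ Icc qmin qmax) : outputDensity k P q = 0 :=
  integral_eq_zero_of_ae (by
    filter_upwards [ae_mem_of_mem_inputLaws hP] with e he using
      h.isChannel.finite_range e he q hq)

theorem integrable_output (h : RegularChannel a b qmin qmax c p B k) (hP : P ∈ inputLaws a b) :
    Integrable (outputDensity k P) := by
  have := hP.1
  exact (h.integrable_uncurry hP).integral_prod_right

theorem integral_mul_output (h : RegularChannel a b qmin qmax c p B k) (hP : P ∈ inputLaws a b)
    {G : ℝ → ℝ} (hG : Measurable G) {C : ℝ} (hC : ∀ q ∈ Icc qmin qmax, |G q| ≤ C) :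
    ∫ q, G q * outputDensity k P q = ∫ e, (∫ q, G q * k e q) ∂P := by
  have := hP.1
  rw [integral_integral_swap (h.integrable_uncurry_mul hP hG hC)]
  simp_rw [integral_const_mul]
  rfl

theorem integrable_mul_output (h : RegularChannel a b qmin qmax c p B k) (hP : P ∈ inputLaws a b)
    {G : ℝ → ℝ} (hG : Measurable G) {C : ℝ} (hC : ∀ q ∈ Icc qmin qmax, |G q| ≤ C) :
    Integrable fun q => G q * outputDensity k P q := by
  have := hP.1
  have h1 := (h.integrable_uncurry_mul hP hG hC).integral_prod_right
  simp only [Function.uncurry, integral_const_mul] at h1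
  exact h1

theorem integral_output (h : RegularChannel a b qmin qmax c p B k) (hP : P ∈ inputLaws a b) :
    ∫ q, outputDensity k P q = 1 := by
  have := hP.1
  have h1 := h.integral_mul_output hP (G := fun _ => 1) measurable_const (C := 1) (by simp)
  simp only [one_mul] at h1
  rw [h1, integral_congr_ae (g := fun _ => (1 : ℝ))]
  · simp
  · filter_upwards [ae_mem_of_mem_inputLaws hP] with e he using h.isChannel.integral_eq_one e he

theorem integrable_uncurry_rpow (h : RegularChannel a b qmin qmax c p B k)
    (hP : P ∈ inputLaws a b) :
    Integrable (Function.uncurry fun e q => k e q ^ p) (P.prod volume) := by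
  obtain ⟨C, hC⟩ := h.exists_integral_rpow_le
  refine integrable_uncurry_of_bounded hP (h.isChannel.measurable.pow_const p) (C := C)
    fun e he => ⟨(hC e he).1, ?_⟩
  simp_rw [fun q => abs_of_nonneg (Real.rpow_nonneg (h.isChannel.nonneg e he q) p)]
  exact (hC e he).2

/-- Jensen's inequality bounds the `p`-th moment of an output density. -/
theorem integrable_output_rpow (h : RegularChannel a b qmin qmax c p B k)
    (hP : P ∈ inputLaws a b) : Integrable fun q => outputDensity k P q ^ p := by
  have := hP.1
  refine (h.integrable_uncurry_rpow hP).integral_prod_right.mono'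
    ((h.measurable_output hP).pow_const p).aestronglyMeasurable ?_
  filter_upwards [(h.integrable_uncurry_rpow hP).prod_left_ae,
    (h.integrable_uncurry hP).prod_left_ae] with q hq1 hq2
  rw [Real.norm_eq_abs, abs_of_nonneg (Real.rpow_nonneg (h.output_nonneg hP q) _)]
  refine (convexOn_rpow h.one_lt.le).map_integral_le (f := fun e => k e q)
    (Real.continuous_rpow_const (by linarith [h.one_lt])).continuousOn
    isClosed_Ici ?_ hq2 hq1
  filter_upwards [ae_mem_of_mem_inputLaws hP] with e he using h.isChannel.nonneg e he q

theorem integrable_negMulLog_output (h : RegularChannel a b qmin qmax c p B k)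
    (hP : P ∈ inputLaws a b) : Integrable fun q => Real.negMulLog (outputDensity k P q) := by
  have i1 : Integrable fun q => (outputDensity k P q + outputDensity k P q ^ p) / (p - 1) +
      (Icc qmin qmax).indicator (fun _ => (1 : ℝ)) q :=
    (((h.integrable_output hP).add (h.integrable_output_rpow hP)).div_const _).add
      ((integrable_indicator_iff measurableSet_Icc).2 (integrableOn_const (by simp) (by simp)))
  refine i1.mono' (Real.continuous_negMulLog.measurable.comp
    (h.measurable_output hP)).aestronglyMeasurable (Eventually.of_forall fun q => ?_)
  by_cases hq : q ∈ Icc qmin qmax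
  · rw [indicator_of_mem hq]
    exact abs_negMulLog_le_one_add (h.output_nonneg hP q) h.one_lt
  · have hp : p ≠ 0 := by linarith [h.one_lt]
    simp [h.output_eq_zero hP hq, hq, Real.zero_rpow hp]

theorem integrable_natEntropy (h : RegularChannel a b qmin qmax c p B k) (hP : P ∈ inputLaws a b) :
    Integrable (fun e => natEntropy (k e)) P := by
  obtain ⟨C, hC⟩ := h.exists_abs_natEntropy_le
  exact integrable_of_bounded_on hP h.measurable_natEntropy.aestronglyMeasurable hC

theorem mutualInfo_eq (h : RegularChannel a b qmin qmax c p B k) (hP : P ∈ inputLaws a b) :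
    mutualInfo k P = natInfo k P / Real.log 2 := by
  have := hP.1
  unfold mutualInfo natInfo condEntropy
  simp_rw [entropy_eq_natEntropy_div, ← sub_div]
  rw [integral_div, integral_sub (integrable_const _) (h.integrable_natEntropy hP)]
  simp

end RegularChannel

/-! ### The candidate density -/

theorem integral_exp_neg_mul_abs_sub {β : ℝ} (hβ : 0 < β) (y : ℝ) :
    ∫ q : ℝ, Real.exp (-β * |q - y|) = 2 / β := by
  rw [integral_sub_right_eq_self (μ := volume) (fun q : ℝ => Real.exp (-β * |q|)) y,
    integral_comp_abs (f := fun t => Real.exp (-β * t)), integral_exp_mul_Ioi (by linarith)]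
  simp
  ring

theorem integrable_exp_neg_mul_abs_sub {β : ℝ} (hβ : 0 < β) (y : ℝ) :
    Integrable fun q : ℝ => Real.exp (-β * |q - y|) := by
  by_contra hc
  have h1 := integral_exp_neg_mul_abs_sub hβ y
  rw [integral_undef hc] at h1
  have : 0 < 2 / β := by positivity
  linarith

namespace RegularChannel

variable {a b qmin qmax c p B : ℝ} {k : ℝ → ℝ → ℝ}

theorem slope_pos (h : RegularChannel a b qmin qmax c p B k) {e : ℝ} (he : e ∈ Icc a b) :
    0 < meanSlope a b k e := h.c_pos.trans_le (h.slope e he)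

theorem aemeasurable_slope : AEMeasurable (meanSlope a b k) (volume.restrict (Icc a b)) := by
  refine (measurable_deriv (condMean k)).aemeasurable.congr ?_
  rw [← restrict_Ioo_eq_restrict_Icc]
  filter_upwards [ae_restrict_mem measurableSet_Ioo] with e he
  rw [meanSlope, derivWithin_of_mem_nhds (Icc_mem_nhds he.1 he.2)]

/-- The change of variables `q = m(e)`. -/
theorem integrableOn_slope_mul (h : RegularChannel a b qmin qmax c p B k) {F : ℝ → ℝ}
    (hF : Measurable F) {C : ℝ} (hC : ∀ e ∈ Icc a b, |F e| ≤ C) :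
    IntegrableOn (fun e => meanSlope a b k e * F e) (Icc a b) := by
  have h1 := (integrableOn_image_iff_integrableOn_abs_deriv_smul measurableSet_Icc
    (fun e he => h.hasDerivWithinAt_mean he) h.strictMonoOn_mean.injOn
    (fun q => F (inputEstimate a b k q))).1 ?_
  · refine h1.congr_fun (fun e he => ?_) measurableSet_Icc
    simp only [h.estimate_mean he, abs_of_pos (h.slope_pos he), smul_eq_mul]
  · rw [h.image_mean]
    refine Measure.integrableOn_of_bounded (M := C) (by simp)
      (hF.comp h.measurable_estimate).aestronglyMeasurable ?_
    exact Eventually.of_forall fun q => hC _ (h.estimate_mem q)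

theorem integral_slope_mul (h : RegularChannel a b qmin qmax c p B k) (F : ℝ → ℝ) :
    ∫ q in Icc (condMean k a) (condMean k b), F (inputEstimate a b k q) =
      ∫ e in Icc a b, meanSlope a b k e * F e := by
  rw [← h.image_mean, integral_image_eq_integral_abs_deriv_smul measurableSet_Icc
    (fun e he => h.hasDerivWithinAt_mean he) h.strictMonoOn_mean.injOn]
  refine setIntegral_congr_fun measurableSet_Icc fun e he => ?_
  simp only [h.estimate_mean he, abs_of_pos (h.slope_pos he), smul_eq_mul]

theorem slopeOverEntropy_eq (e : ℝ) :
    slopeOverEntropy a b k e = meanSlope a b k e * Real.exp (-natEntropy (k e)) := by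
  rw [slopeOverEntropy, two_rpow_condEntropy, Real.exp_neg, div_eq_mul_inv]

theorem integrableOn_slopeOverEntropy_mul (h : RegularChannel a b qmin qmax c p B k) {F : ℝ → ℝ}
    (hF : Measurable F) {C : ℝ} (hC : ∀ e ∈ Icc a b, |F e| ≤ C) :
    IntegrableOn (fun e => F e * slopeOverEntropy a b k e) (Icc a b) := by
  obtain ⟨D, hD⟩ := h.exists_abs_natEntropy_le
  have h1 := h.integrableOn_slope_mul (F := fun e => F e * Real.exp (-natEntropy (k e)))
    (hF.mul (Real.measurable_exp.comp h.measurable_natEntropy.neg)) (C := C * Real.exp D)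
    fun e he => by
      rw [abs_mul, Real.abs_exp]
      have := hC e he
      have h2 := neg_abs_le (natEntropy (k e))
      have h3 := hD e he
      gcongr
      · exact (abs_nonneg _).trans this
      · linarith
  refine h1.congr_fun (fun e _ => ?_) measurableSet_Icc
  simp only [slopeOverEntropy_eq]; ring

theorem integrableOn_slopeOverEntropy (h : RegularChannel a b qmin qmax c p B k) :
    IntegrableOn (slopeOverEntropy a b k) (Icc a b) := by
  simpa using h.integrableOn_slopeOverEntropy_mul (F := fun _ => 1) measurable_const (C := 1)
    (by simp)

theorem slopeOverEntropy_pos (h : RegularChannel a b qmin qmax c p B k) {e : ℝ}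
    (he : e ∈ Icc a b) : 0 < slopeOverEntropy a b k e := by
  rw [slopeOverEntropy_eq]
  exact mul_pos (h.slope_pos he) (Real.exp_pos _)

theorem intervalIntegral_eq (h : RegularChannel a b qmin qmax c p B k) (F : ℝ → ℝ) :
    ∫ e in a..b, F e = ∫ e in Icc a b, F e := by
  rw [intervalIntegral.integral_of_le h.lt.le, integral_Icc_eq_integral_Ioc]

theorem normFactor_eq (h : RegularChannel a b qmin qmax c p B k) :
    normFactor a b k = ∫ e in Icc a b, slopeOverEntropy a b k e := h.intervalIntegral_eq _

/-- A subinterval of `[a, b]` on which the conditional entropy is not much larger than at `e₀`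
contributes to the normalising factor. -/
theorem le_normFactor (h : RegularChannel a b qmin qmax c p B k) {e₀ u v Λ : ℝ}
    (huv : u ≤ v) (hau : a ≤ u) (hvb : v ≤ b)
    (hΛ : ∀ e ∈ Icc u v, natEntropy (k e) ≤ natEntropy (k e₀) + Λ) :
    c * Real.exp (-natEntropy (k e₀) - Λ) * (v - u) ≤ normFactor a b k := by
  have hsub : Icc u v ⊆ Icc a b := Icc_subset_Icc hau hvb
  calc c * Real.exp (-natEntropy (k e₀) - Λ) * (v - u)
      = ∫ e in Icc u v, c * Real.exp (-natEntropy (k e₀) - Λ) := by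
        rw [setIntegral_const]
        simp [huv]
        ring
    _ ≤ ∫ e in Icc u v, slopeOverEntropy a b k e := by
        refine setIntegral_mono_on (integrableOn_const (by simp))
          (h.integrableOn_slopeOverEntropy.mono_set hsub) measurableSet_Icc fun e he => ?_
        rw [slopeOverEntropy_eq]
        have h1 := h.slope e (hsub he)
        have h2 := hΛ e he
        have h3 := h.c_pos
        have h4 : -natEntropy (k e₀) - Λ ≤ -natEntropy (k e) := by linarith
        have h5 := (h.slope_pos (hsub he)).le
        gcongr
    _ ≤ ∫ e in Icc a b, slopeOverEntropy a b k e := by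
        refine setIntegral_mono_set h.integrableOn_slopeOverEntropy ?_ hsub.eventuallyLE
        filter_upwards [ae_restrict_mem measurableSet_Icc] with e he using
          (h.slopeOverEntropy_pos he).le
    _ = _ := h.normFactor_eq.symm

theorem normFactor_pos (h : RegularChannel a b qmin qmax c p B k) : 0 < normFactor a b k := by
  obtain ⟨D, hD⟩ := h.exists_abs_natEntropy_le
  refine lt_of_lt_of_le ?_ (h.le_normFactor (e₀ := a) (Λ := 2 * D) h.lt.le le_rfl le_rfl
    fun e he => ?_)
  · have := h.c_pos
    have := sub_pos.2 h.lt
    positivity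
  · have h1 := abs_le.1 (hD e he)
    have h2 := abs_le.1 (hD a h.left_mem)
    linarith

theorem slowDensity_eq (e : ℝ) : slowDensity a b k e = slopeOverEntropy a b k e / normFactor a b k := by
  rw [slowDensity]; ring

theorem slowDensity_pos (h : RegularChannel a b qmin qmax c p B k) {e : ℝ}
    (he : e ∈ Icc a b) : 0 < slowDensity a b k e := by
  rw [slowDensity_eq]
  exact div_pos (h.slopeOverEntropy_pos he) h.normFactor_pos

theorem integrableOn_slowDensity_mul (h : RegularChannel a b qmin qmax c p B k) {F : ℝ → ℝ}
    (hF : Measurable F) {C : ℝ} (hC : ∀ e ∈ Icc a b, |F e| ≤ C) :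
    IntegrableOn (fun e => F e * slowDensity a b k e) (Icc a b) := by
  simp_rw [slowDensity_eq, ← mul_div_assoc]
  exact (h.integrableOn_slopeOverEntropy_mul hF hC).div_const _

theorem integrableOn_slowDensity (h : RegularChannel a b qmin qmax c p B k) :
    IntegrableOn (slowDensity a b k) (Icc a b) := by
  simpa using h.integrableOn_slowDensity_mul (F := fun _ => 1) measurable_const (C := 1) (by simp)

theorem integral_slowDensity (h : RegularChannel a b qmin qmax c p B k) :
    ∫ e in Icc a b, slowDensity a b k e = 1 := by
  simp_rw [slowDensity_eq]
  rw [integral_div, ← h.normFactor_eq, div_self h.normFactor_pos.ne']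

end RegularChannel

theorem lawOfDensity_mem {a b : ℝ} {g : ℝ → ℝ} (hi : IntegrableOn g (Icc a b))
    (h0 : ∀ e ∈ Icc a b, 0 ≤ g e) (h1 : ∫ e in Icc a b, g e = 1) :
    lawOfDensity a b g ∈ densityLaws a b := by
  have hac : lawOfDensity a b g ≪ volume.restrict (Icc a b) := withDensity_absolutelyContinuous _ _
  refine ⟨⟨⟨?_⟩, hac ?_⟩, hac.trans Measure.absolutelyContinuous_restrict⟩
  · rw [lawOfDensity, withDensity_apply _ MeasurableSet.univ, Measure.restrict_univ,
      ← ofReal_integral_eq_lintegral_ofReal hi, h1, ENNReal.ofReal_one]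
    filter_upwards [ae_restrict_mem measurableSet_Icc] with e he using h0 e he
  · rw [Measure.restrict_apply measurableSet_Icc.compl]; simp

theorem integral_lawOfDensity {a b : ℝ} {g : ℝ → ℝ} (hg : AEMeasurable g (volume.restrict (Icc a b)))
    (h0 : ∀ e ∈ Icc a b, 0 ≤ g e) (F : ℝ → ℝ) :
    ∫ e, F e ∂(lawOfDensity a b g) = ∫ e in Icc a b, F e * g e := by
  rw [lawOfDensity, integral_withDensity_eq_integral_toReal_smul₀ hg.ennreal_ofReal
    (Eventually.of_forall fun _ => ENNReal.ofReal_lt_top)]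
  refine setIntegral_congr_fun measurableSet_Icc fun e he => ?_
  simp only [ENNReal.toReal_ofReal (h0 e he), smul_eq_mul, mul_comm]

/-! ### A reference density for the output -/

/-- The image under `m` of the candidate density, continued beyond the range of `m` by slowly
decaying exponential tails. It is not normalised. -/
noncomputable def refDensity (a b τ : ℝ) (k : ℝ → ℝ → ℝ) (q : ℝ) : ℝ :=
  Real.exp (-natEntropy (k (inputEstimate a b k q)) -
    τ / sdMax a b k * |q - condMean k (inputEstimate a b k q)|) / normFactor a b k

/-- The mass of the reference density outside the range of `m`. -/
noncomputable def refTail (a b τ : ℝ) (k : ℝ → ℝ → ℝ) : ℝ :=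
  ∫ q in (Icc (condMean k a) (condMean k b))ᶜ, refDensity a b τ k q

/-- The square of the difference of the square roots is at most the integrand of the relative
entropy. -/
theorem abs_sub_le_of_gibbs {t s θ : ℝ} (ht : 0 ≤ t) (hs : 0 < s) (hθ : 0 < θ) :
    |t - s| ≤ (-Real.negMulLog t - t * Real.log s - t + s) / (2 * θ) + θ * (t + s) := by
  have key : (√t - √s) ^ 2 ≤ -Real.negMulLog t - t * Real.log s - t + s := by
    rcases ht.eq_or_lt with rfl | ht
    · simp [Real.sq_sqrt hs.le]
    have hu := Real.sqrt_pos.2 ht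
    have hv := Real.sqrt_pos.2 hs
    have e1 : t = √t ^ 2 := (Real.sq_sqrt ht.le).symm
    have e2 : s = √s ^ 2 := (Real.sq_sqrt hs.le).symm
    set u := √t
    set v := √s
    rw [e1, e2]
    have h1 := Real.log_le_sub_one_of_pos (div_pos hv hu)
    rw [Real.log_div hv.ne' hu.ne'] at h1
    have h2 := mul_le_mul_of_nonneg_left h1 (sq_nonneg u)
    have h3 : u ^ 2 * (v / u - 1) = u * v - u ^ 2 := by field_simp
    rw [h3] at h2
    simp only [Real.negMulLog, Real.log_pow]
    push_cast
    nlinarith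
  have e1 : t = √t ^ 2 := (Real.sq_sqrt ht).symm
  have e2 : s = √s ^ 2 := (Real.sq_sqrt hs.le).symm
  have hu := Real.sqrt_nonneg t
  have hv := Real.sqrt_nonneg s
  have h1 : |t - s| = |√t - √s| * (√t + √s) := by
    nth_rw 1 [e1, e2]
    rw [sq_sub_sq, abs_mul, abs_of_nonneg (add_nonneg hu hv)]; ring
  have h2 : |√t - √s| * (√t + √s) ≤ (√t - √s) ^ 2 / (2 * θ) + θ * (t + s) := by
    have h3 : (√t + √s) ^ 2 ≤ 2 * (t + s) := by nlinarith [sq_nonneg (√t - √s)]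
    have h4 : 0 ≤ (|√t - √s| - θ * (√t + √s)) ^ 2 / (2 * θ) := by positivity
    have h5 : (|√t - √s| - θ * (√t + √s)) ^ 2 / (2 * θ) =
        (√t - √s) ^ 2 / (2 * θ) - |√t - √s| * (√t + √s) + θ / 2 * (√t + √s) ^ 2 := by
      rw [sub_sq, sq_abs]; field_simp
    nlinarith
  rw [h1]
  refine h2.trans ?_
  gcongr

namespace RegularChannel

variable {a b qmin qmax c p B τ : ℝ} {k : ℝ → ℝ → ℝ} {P : Measure ℝ}

theorem refDensity_pos (h : RegularChannel a b qmin qmax c p B k) (q : ℝ) :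
    0 < refDensity a b τ k q := div_pos (Real.exp_pos _) h.normFactor_pos

theorem measurable_mean_estimate (h : RegularChannel a b qmin qmax c p B k) :
    Measurable fun q => condMean k (inputEstimate a b k q) := by
  simp_rw [h.mean_estimate]
  fun_prop

theorem measurable_refDensity (h : RegularChannel a b qmin qmax c p B k) :
    Measurable (refDensity a b τ k) := by
  have h1 := h.measurable_natEntropy.comp h.measurable_estimate
  have h2 := h.measurable_mean_estimate
  have h3 : Measurable fun q => |q - condMean k (inputEstimate a b k q)| :=
    (measurable_id.sub h2).norm
  exact (Real.measurable_exp.comp (h1.neg.sub (h3.const_mul _))).div_const _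

theorem log_refDensity (h : RegularChannel a b qmin qmax c p B k) (q : ℝ) :
    Real.log (refDensity a b τ k q) = -natEntropy (k (inputEstimate a b k q)) -
      τ / sdMax a b k * |q - condMean k (inputEstimate a b k q)| -
      Real.log (normFactor a b k) := by
  rw [refDensity, Real.log_div (Real.exp_ne_zero _) h.normFactor_pos.ne', Real.log_exp]

theorem refDensity_of_mem (h : RegularChannel a b qmin qmax c p B k) {q : ℝ}
    (hq : q ∈ Icc (condMean k a) (condMean k b)) :
    refDensity a b τ k q =
      Real.exp (-natEntropy (k (inputEstimate a b k q))) / normFactor a b k := by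
  rw [refDensity, h.mean_estimate, min_eq_left hq.2, max_eq_right hq.1]
  simp

theorem refDensity_le_of_notMem (h : RegularChannel a b qmin qmax c p B k) {q : ℝ}
    (hq : q ∉ Icc (condMean k a) (condMean k b)) :
    refDensity a b τ k q ≤
      Real.exp (-natEntropy (k a)) / normFactor a b k *
        Real.exp (-(τ / sdMax a b k) * |q - condMean k a|) +
      Real.exp (-natEntropy (k b)) / normFactor a b k *
        Real.exp (-(τ / sdMax a b k) * |q - condMean k b|) := by
  have hN := h.normFactor_pos
  have hab := h.strictMonoOn_mean h.left_mem h.right_mem h.lt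
  rw [mem_Icc, not_and_or, not_le, not_le] at hq
  rcases hq with hq | hq
  · have e1 : inputEstimate a b k q = a := by
      apply h.strictMonoOn_mean.injOn (h.estimate_mem _) h.left_mem
      rw [h.mean_estimate, min_eq_left (by linarith), max_eq_left hq.le]
    rw [refDensity, e1, sub_eq_add_neg, ← neg_mul, Real.exp_add, mul_div_right_comm]
    have : 0 ≤ Real.exp (-natEntropy (k b)) / normFactor a b k *
        Real.exp (-(τ / sdMax a b k) * |q - condMean k b|) := by positivity
    linarith
  · have e1 : inputEstimate a b k q = b := by
      apply h.strictMonoOn_mean.injOn (h.estimate_mem _) h.right_mem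
      rw [h.mean_estimate, min_eq_right hq.le, max_eq_right hab.le]
    rw [refDensity, e1, sub_eq_add_neg, ← neg_mul, Real.exp_add, mul_div_right_comm]
    have : 0 ≤ Real.exp (-natEntropy (k a)) / normFactor a b k *
        Real.exp (-(τ / sdMax a b k) * |q - condMean k a|) := by positivity
    linarith

theorem integrableOn_refDensity_compl (h : RegularChannel a b qmin qmax c p B k) (hτ : 0 < τ) :
    IntegrableOn (refDensity a b τ k) (Icc (condMean k a) (condMean k b))ᶜ ∧
    refTail a b τ k ≤ (Real.exp (-natEntropy (k a)) + Real.exp (-natEntropy (k b))) /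
      normFactor a b k * (2 * sdMax a b k / τ) := by
  have hβ : 0 < τ / sdMax a b k := div_pos hτ h.sdMax_pos
  have i1 := (integrable_exp_neg_mul_abs_sub hβ (condMean k a)).const_mul
    (Real.exp (-natEntropy (k a)) / normFactor a b k)
  have i2 := (integrable_exp_neg_mul_abs_sub hβ (condMean k b)).const_mul
    (Real.exp (-natEntropy (k b)) / normFactor a b k)
  have i3 : IntegrableOn (refDensity a b τ k) (Icc (condMean k a) (condMean k b))ᶜ := by
    refine (i1.add i2).integrableOn.mono' h.measurable_refDensity.aestronglyMeasurable ?_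
    filter_upwards [ae_restrict_mem measurableSet_Icc.compl] with q hq
    rw [Real.norm_eq_abs, abs_of_pos (h.refDensity_pos q)]
    exact h.refDensity_le_of_notMem hq
  refine ⟨i3, ?_⟩
  have hN := h.normFactor_pos
  calc refTail a b τ k ≤ ∫ q in (Icc (condMean k a) (condMean k b))ᶜ, _ :=
        setIntegral_mono_on i3 (i1.add i2).integrableOn measurableSet_Icc.compl
          fun q hq => h.refDensity_le_of_notMem hq
    _ ≤ ∫ q, _ := setIntegral_le_integral (i1.add i2) (Eventually.of_forall fun q => by
        simp only [Pi.zero_apply, Pi.add_apply]; positivity)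
    _ = _ := by
        have hs := h.sdMax_pos.ne'
        have e := integral_add i1 i2
        simp only [Pi.add_apply] at e ⊢
        rw [e, integral_const_mul, integral_const_mul, integral_exp_neg_mul_abs_sub hβ,
          integral_exp_neg_mul_abs_sub hβ]
        field_simp

theorem refTail_nonneg (h : RegularChannel a b qmin qmax c p B k) : 0 ≤ refTail a b τ k :=
  integral_nonneg fun q => (h.refDensity_pos q).le

/-- On the range of `m` the reference density is the image of the candidate density. -/
theorem integral_mul_refDensity_on (h : RegularChannel a b qmin qmax c p B k) {F : ℝ → ℝ}
    (hF : Measurable F) {C : ℝ} (hC : ∀ e ∈ Icc a b, |F e| ≤ C) :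
    IntegrableOn (fun q => F (inputEstimate a b k q) * refDensity a b τ k q)
      (Icc (condMean k a) (condMean k b)) ∧
    ∫ q in Icc (condMean k a) (condMean k b), F (inputEstimate a b k q) * refDensity a b τ k q =
      ∫ e in Icc a b, F e * slowDensity a b k e := by
  obtain ⟨D, hD⟩ := h.exists_abs_natEntropy_le
  have hN := h.normFactor_pos
  constructor
  · refine Measure.integrableOn_of_bounded (M := C * (Real.exp D / normFactor a b k)) (by simp)
      ((hF.comp h.measurable_estimate).mul h.measurable_refDensity).aestronglyMeasurable ?_
    filter_upwards [ae_restrict_mem measurableSet_Icc] with q hq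
    rw [Real.norm_eq_abs, abs_mul, abs_of_pos (h.refDensity_pos q), h.refDensity_of_mem hq]
    have h1 := hC _ (h.estimate_mem q)
    have h2 := neg_abs_le (natEntropy (k (inputEstimate a b k q)))
    have h3 := hD _ (h.estimate_mem q)
    have h4 := (abs_nonneg _).trans h1
    gcongr
    linarith
  · have e1 : ∫ q in Icc (condMean k a) (condMean k b),
        F (inputEstimate a b k q) * refDensity a b τ k q =
        ∫ q in Icc (condMean k a) (condMean k b), (fun e => F e *
          (Real.exp (-natEntropy (k e)) / normFactor a b k)) (inputEstimate a b k q) := by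
      refine setIntegral_congr_fun measurableSet_Icc fun q hq => ?_
      simp only [h.refDensity_of_mem hq]
    rw [e1, h.integral_slope_mul fun e => F e * (Real.exp (-natEntropy (k e)) / normFactor a b k)]
    refine setIntegral_congr_fun measurableSet_Icc fun e _ => ?_
    simp only [slowDensity_eq, slopeOverEntropy_eq]; ring

theorem integrable_mul_refDensity (h : RegularChannel a b qmin qmax c p B k) (hτ : 0 < τ)
    {F : ℝ → ℝ} (hF : Measurable F) {C : ℝ} (hC : ∀ e ∈ Icc a b, |F e| ≤ C) :
    Integrable (fun q => F (inputEstimate a b k q) * refDensity a b τ k q) := by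
  rw [← integrableOn_univ, ← union_compl_self (Icc (condMean k a) (condMean k b))]
  refine (h.integral_mul_refDensity_on hF hC).1.union ?_
  refine ((h.integrableOn_refDensity_compl hτ).1.const_mul C).mono'
    ((hF.comp h.measurable_estimate).mul h.measurable_refDensity).aestronglyMeasurable
    (Eventually.of_forall fun q => ?_)
  rw [Real.norm_eq_abs, abs_mul, abs_of_pos (h.refDensity_pos q)]
  exact mul_le_mul_of_nonneg_right (hC _ (h.estimate_mem q)) (h.refDensity_pos q).le

theorem integrable_refDensity (h : RegularChannel a b qmin qmax c p B k) (hτ : 0 < τ) :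
    Integrable (refDensity a b τ k) := by
  simpa using h.integrable_mul_refDensity hτ (F := fun _ => 1) measurable_const (C := 1) (by simp)

theorem abs_integral_mul_refDensity_sub_le (h : RegularChannel a b qmin qmax c p B k) (hτ : 0 < τ)
    {F : ℝ → ℝ} (hF : Measurable F) {C : ℝ} (hC : ∀ e ∈ Icc a b, |F e| ≤ C) :
    |(∫ q, F (inputEstimate a b k q) * refDensity a b τ k q) -
      ∫ e in Icc a b, F e * slowDensity a b k e| ≤ C * refTail a b τ k := by
  rw [← integral_add_compl (measurableSet_Icc (a := condMean k a) (b := condMean k b))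
    (h.integrable_mul_refDensity hτ hF hC), (h.integral_mul_refDensity_on hF hC).2,
    add_sub_cancel_left, refTail, ← integral_const_mul]
  refine abs_integral_le_integral_abs.trans ?_
  refine integral_mono (h.integrable_mul_refDensity hτ hF hC).abs.integrableOn
    ((h.integrableOn_refDensity_compl hτ).1.const_mul C) fun q => ?_
  simp only [abs_mul, abs_of_pos (h.refDensity_pos q)]
  exact mul_le_mul_of_nonneg_right (hC _ (h.estimate_mem q)) (h.refDensity_pos q).le

theorem integral_refDensity (h : RegularChannel a b qmin qmax c p B k) (hτ : 0 < τ) :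
    ∫ q, refDensity a b τ k q = 1 + refTail a b τ k := by
  have h1 := (h.integral_mul_refDensity_on (τ := τ) (F := fun _ => 1) measurable_const (C := 1)
    (by simp)).2
  simp only [one_mul] at h1
  rw [h.integral_slowDensity] at h1
  rw [← integral_add_compl (measurableSet_Icc (a := condMean k a) (b := condMean k b))
    (h.integrable_refDensity hτ), h1, refTail]

theorem exists_abs_log_refDensity_le (h : RegularChannel a b qmin qmax c p B k) (hτ : 0 < τ) :
    ∃ C, ∀ q ∈ Icc qmin qmax, |Real.log (refDensity a b τ k q)| ≤ C := by
  obtain ⟨D, hD⟩ := h.exists_abs_natEntropy_le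
  obtain ⟨E, hE⟩ := isCompact_Icc.exists_bound_of_continuousOn (s := Icc qmin qmax)
    (f := fun q => q - condMean k a) (by fun_prop)
  have hβ : 0 < τ / sdMax a b k := div_pos hτ h.sdMax_pos
  refine ⟨D + τ / sdMax a b k * E + |Real.log (normFactor a b k)|, fun q hq => ?_⟩
  have h1 := hD _ (h.estimate_mem q)
  have h2 := (h.abs_sub_mean_estimate_le h.left_mem q).trans (hE q hq)
  rw [h.log_refDensity]
  have h3 := mul_le_mul_of_nonneg_left h2 hβ.le
  have h4 : 0 ≤ τ / sdMax a b k * |q - condMean k (inputEstimate a b k q)| := by positivity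
  have h5 := abs_le.1 h1
  have h6 := abs_le.1 (le_refl |Real.log (normFactor a b k)|)
  rw [abs_le]
  constructor <;> linarith

/-! ### Upper bound for the mutual information -/

theorem measurable_log_refDensity (h : RegularChannel a b qmin qmax c p B k) :
    Measurable fun q => Real.log (refDensity a b τ k q) :=
  Real.measurable_log.comp h.measurable_refDensity

/-- If every conditional density has cross entropy at most `log N + h(Q|e) + ε` against the
reference density, then the relative entropy of an output density is at most the amount by which
the mutual information falls short of `log N`, up to small errors. -/
theorem integral_gibbs_le (h : RegularChannel a b qmin qmax c p B k) (hτ : 0 < τ)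
    (hP : P ∈ inputLaws a b) {ε : ℝ}
    (hε : ∀ e ∈ Icc a b, -∫ q, Real.log (refDensity a b τ k q) * k e q ≤
      Real.log (normFactor a b k) + natEntropy (k e) + ε) :
    Integrable (fun q => -Real.negMulLog (outputDensity k P q) -
      outputDensity k P q * Real.log (refDensity a b τ k q) - outputDensity k P q +
        refDensity a b τ k q) ∧
    ∫ q, (-Real.negMulLog (outputDensity k P q) -
      outputDensity k P q * Real.log (refDensity a b τ k q) - outputDensity k P q +
        refDensity a b τ k q) ≤
      Real.log (normFactor a b k) + ε + refTail a b τ k - natInfo k P := by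
  have := hP.1
  obtain ⟨C, hC⟩ := h.exists_abs_log_refDensity_le hτ
  have i1 := (h.integrable_negMulLog_output hP).neg
  have i2 := h.integrable_mul_output hP h.measurable_log_refDensity hC
  simp_rw [mul_comm (Real.log _)] at i2
  have i3 := h.integrable_output hP
  have i4 := h.integrable_refDensity hτ
  refine ⟨((i1.sub i2).sub i3).add i4, ?_⟩
  have e1 := integral_add ((i1.sub i2).sub i3) i4
  have e2 := integral_sub (i1.sub i2) i3
  have e3 := integral_sub i1 i2
  simp only [Pi.sub_apply, Pi.neg_apply] at e1 e2 e3
  rw [e1, e2, e3, integral_neg, h.integral_output hP, h.integral_refDensity hτ]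
  have e4 := h.integral_mul_output hP h.measurable_log_refDensity hC
  simp_rw [mul_comm (Real.log _) (outputDensity k P _)] at e4
  rw [e4]
  have i5 : Integrable (fun e => ∫ q, Real.log (refDensity a b τ k q) * k e q) P :=
    (h.integrable_uncurry_mul hP h.measurable_log_refDensity hC).integral_prod_left
  have i6 := (h.integrable_natEntropy hP)
  have h2 : -∫ e, (∫ q, Real.log (refDensity a b τ k q) * k e q) ∂P ≤
      Real.log (normFactor a b k) + (∫ e, natEntropy (k e) ∂P) + ε := by
    rw [← integral_neg]
    calc ∫ e, (-∫ q, Real.log (refDensity a b τ k q) * k e q) ∂P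
        ≤ ∫ e, (Real.log (normFactor a b k) + natEntropy (k e) + ε) ∂P := by
          refine integral_mono_ae i5.neg (((integrable_const _).add i6).add (integrable_const _)) ?_
          filter_upwards [ae_mem_of_mem_inputLaws hP] with e he using hε e he
      _ = _ := by
          have e5 := integral_add ((integrable_const (Real.log (normFactor a b k))).add i6)
            (integrable_const ε)
          have e6 := integral_add (integrable_const (Real.log (normFactor a b k))) i6
          simp only [Pi.add_apply] at e5 e6
          rw [e5, e6]
          simp
  unfold natInfo natEntropy
  unfold natEntropy at h2
  linarith

theorem natInfo_le (h : RegularChannel a b qmin qmax c p B k) (hτ : 0 < τ)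
    (hP : P ∈ inputLaws a b) {ε : ℝ}
    (hε : ∀ e ∈ Icc a b, -∫ q, Real.log (refDensity a b τ k q) * k e q ≤
      Real.log (normFactor a b k) + natEntropy (k e) + ε) :
    natInfo k P ≤ Real.log (normFactor a b k) + ε + refTail a b τ k := by
  have h1 := (h.integral_gibbs_le hτ hP hε).2
  have h2 : 0 ≤ ∫ q, (-Real.negMulLog (outputDensity k P q) -
      outputDensity k P q * Real.log (refDensity a b τ k q) - outputDensity k P q +
        refDensity a b τ k q) := integral_nonneg fun q => by
    have := negMulLog_le_gibbs (h.output_nonneg hP q) (h.refDensity_pos (τ := τ) q)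
    simp only [Pi.zero_apply]
    linarith
  linarith

theorem integral_abs_output_sub_le (h : RegularChannel a b qmin qmax c p B k) (hτ : 0 < τ)
    (hP : P ∈ inputLaws a b) {ε θ : ℝ} (hθ : 0 < θ)
    (hε : ∀ e ∈ Icc a b, -∫ q, Real.log (refDensity a b τ k q) * k e q ≤
      Real.log (normFactor a b k) + natEntropy (k e) + ε) :
    ∫ q, |outputDensity k P q - refDensity a b τ k q| ≤
      (Real.log (normFactor a b k) + ε + refTail a b τ k - natInfo k P) / (2 * θ) +
        θ * (2 + refTail a b τ k) := by
  obtain ⟨i1, h1⟩ := h.integral_gibbs_le hτ hP hε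
  have i3 := h.integrable_output hP
  have i4 := h.integrable_refDensity hτ
  have h2 := integral_mono (i3.sub i4).abs ((i1.div_const (2 * θ)).add ((i3.add i4).const_mul θ))
    fun q => abs_sub_le_of_gibbs (h.output_nonneg hP q) (h.refDensity_pos (τ := τ) q) hθ
  refine h2.trans ?_
  have e1 := integral_add (i1.div_const (2 * θ)) ((i3.add i4).const_mul θ)
  have e2 := integral_add i3 i4
  simp only [Pi.add_apply] at e1 e2 ⊢
  rw [e1, integral_div, integral_const_mul, e2, h.integral_output hP, h.integral_refDensity hτ]
  have : 1 + (1 + refTail a b τ k) = 2 + refTail a b τ k := by ring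
  rw [this]
  gcongr

/-- Averages of a function that hardly changes over the width of the conditional densities can be
computed from the output, so they are determined by the output density. -/
theorem abs_integral_sub_le (h : RegularChannel a b qmin qmax c p B k) (hτ : 0 < τ)
    (hP : P ∈ inputLaws a b) {F : ℝ → ℝ} (hF : Measurable F) {C α β : ℝ}
    (hβ : 0 ≤ β) (hC : ∀ e ∈ Icc a b, |F e| ≤ C)
    (hL : ∀ e ∈ Icc a b, ∀ r ∈ Icc a b, |F r - F e| ≤ α + β * |r - e|) :
    |∫ e, F e ∂P - ∫ e in Icc a b, F e * slowDensity a b k e| ≤ α + β * (sdMax a b k / c) +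
      C * ((∫ q, |outputDensity k P q - refDensity a b τ k q|) + refTail a b τ k) := by
  have := hP.1
  have hc := h.c_pos
  have hG : Measurable fun q => F (inputEstimate a b k q) := hF.comp h.measurable_estimate
  have hGC : ∀ q ∈ Icc qmin qmax, |F (inputEstimate a b k q)| ≤ C :=
    fun q _ => hC _ (h.estimate_mem q)
  have hFi : Integrable F P := integrable_of_bounded_on hP hF.aestronglyMeasurable hC
  have i5 : Integrable (fun e => ∫ q, F (inputEstimate a b k q) * k e q) P :=
    (h.integrable_uncurry_mul hP hG hGC).integral_prod_left
  have s1 : |∫ e, F e ∂P - ∫ q, F (inputEstimate a b k q) * outputDensity k P q| ≤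
      α + β * (sdMax a b k / c) := by
    rw [h.integral_mul_output hP hG hGC, ← integral_sub hFi i5, ← Real.norm_eq_abs]
    refine (norm_integral_le_of_norm_le_const (C := α + β * (sdMax a b k / c)) ?_).trans (by simp)
    filter_upwards [ae_mem_of_mem_inputLaws hP] with e he
    have i6 := h.integrable_mul he hG hGC
    have i7 := (h.integrable he).const_mul (F e)
    have e1 : F e = ∫ q, F e * k e q := by
      rw [integral_const_mul, h.isChannel.integral_eq_one e he, mul_one]
    have i8 : Integrable fun q => |q - condMean k e| * k e q :=
      h.integrable_continuous_mul he (F := fun q => |q - condMean k e|) (by fun_prop)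
    rw [Real.norm_eq_abs, e1, ← integral_sub i7 i6]
    calc |∫ q, (F e * k e q - F (inputEstimate a b k q) * k e q)|
        ≤ ∫ q, |F e * k e q - F (inputEstimate a b k q) * k e q| := abs_integral_le_integral_abs
      _ ≤ ∫ q, (α * k e q + β / c * (|q - condMean k e| * k e q)) := by
          refine integral_mono (i7.sub i6).abs (((h.integrable he).const_mul α).add
            (i8.const_mul _)) fun q => ?_
          have h0 := h.isChannel.nonneg e he q
          have h1 := hL _ he _ (h.estimate_mem q)
          have h2 := h.abs_estimate_sub_le he q
          simp only
          rw [← sub_mul, abs_mul, abs_of_nonneg h0, abs_sub_comm]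
          calc |F (inputEstimate a b k q) - F e| * k e q
              ≤ (α + β * (|q - condMean k e| / c)) * k e q := by
                gcongr
                exact h1.trans (by gcongr)
            _ = _ := by ring
      _ = α + β / c * ∫ q, |q - condMean k e| * k e q := by
          rw [integral_add ((h.integrable he).const_mul α) (i8.const_mul _), integral_const_mul,
            integral_const_mul, h.isChannel.integral_eq_one e he, mul_one]
      _ ≤ α + β / c * sdMax a b k := by
          gcongr
          exact (h.integral_abs_sub_mean_le he).trans (h.sd_le he)
      _ = _ := by ring
  have i9 := h.integrable_mul_output hP hG hGC
  have i10 := h.integrable_mul_refDensity hτ hF hC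
  have i3 := h.integrable_output hP
  have i4 := h.integrable_refDensity hτ
  have s2 : |(∫ q, F (inputEstimate a b k q) * outputDensity k P q) -
      ∫ q, F (inputEstimate a b k q) * refDensity a b τ k q| ≤
      C * ∫ q, |outputDensity k P q - refDensity a b τ k q| := by
    rw [← integral_sub i9 i10, ← integral_const_mul]
    refine abs_integral_le_integral_abs.trans (integral_mono (i9.sub i10).abs
      ((i3.sub i4).abs.const_mul C) fun q => ?_)
    simp only
    rw [← mul_sub, abs_mul]
    exact mul_le_mul_of_nonneg_right (hC _ (h.estimate_mem q)) (abs_nonneg _)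
  have s3 := h.abs_integral_mul_refDensity_sub_le hτ hF hC
  have t1 := abs_sub_le (∫ e, F e ∂P) (∫ q, F (inputEstimate a b k q) * outputDensity k P q)
    (∫ e in Icc a b, F e * slowDensity a b k e)
  have t2 := abs_sub_le (∫ q, F (inputEstimate a b k q) * outputDensity k P q)
    (∫ q, F (inputEstimate a b k q) * refDensity a b τ k q)
    (∫ e in Icc a b, F e * slowDensity a b k e)
  linarith

/-- The cross entropy bound: the conditional entropy at the input estimated from the output is
close to the conditional entropy at the true input, unless the output is far from its mean. -/
theorem neg_integral_log_refDensity_le (h : RegularChannel a b qmin qmax c p B k) (hτ : 0 < τ)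
    {η K ε n : ℝ} (hη : 0 ≤ η) (hK : 0 < K) (hε : 0 ≤ ε) (hn : K / c ≤ n)
    (hsd : ∀ e ∈ Icc a b, sdMax a b k * |derivWithin (condSd k) (Icc a b) e| ≤ η * condSd k e)
    (hent : ∀ e ∈ Icc a b, ∀ r ∈ Icc a b, |r - e| ≤ n * sdMax a b k →
      |natEntropy (k r) - natEntropy (k e)| ≤ ε) {e : ℝ} (he : e ∈ Icc a b) :
    -∫ q, Real.log (refDensity a b τ k q) * k e q ≤ Real.log (normFactor a b k) +
      natEntropy (k e) + (ε + η / c + 2 * shapeConst p B / K ^ 2 + τ) := by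
  have hc := h.c_pos
  have hs := h.sd_pos he
  have hm := h.sdMax_pos
  have h0 := h.stdShape he
  have hC := h0.shapeConst_pos h.one_lt
  obtain ⟨C, hC'⟩ := h.exists_abs_log_refDensity_le hτ
  set A := Real.log (normFactor a b k) + natEntropy (k e) + ε with hA
  set D := 2 * shapeConst p B / K ^ 2 with hD
  have key : ∀ q, -(Real.log (refDensity a b τ k q)) ≤
      (fun x => A + (η / c + τ) * |x| + D * x ^ 2) ((q - condMean k e) / condSd k e) := by
    intro q
    set x := (q - condMean k e) / condSd k e with hx
    have hqx : |q - condMean k e| = condSd k e * |x| := by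
      rw [hx, abs_div, abs_of_pos hs]; field_simp
    have hle : |q - condMean k e| ≤ sdMax a b k * |x| := by
      rw [hqx]; exact mul_le_mul_of_nonneg_right (h.sd_le he) (abs_nonneg _)
    have h1 : τ / sdMax a b k * |q - condMean k (inputEstimate a b k q)| ≤ τ * |x| := by
      calc τ / sdMax a b k * |q - condMean k (inputEstimate a b k q)|
          ≤ τ / sdMax a b k * (sdMax a b k * |x|) := by
            gcongr
            exact (h.abs_sub_mean_estimate_le he q).trans hle
        _ = _ := by field_simp
    have h2 : |inputEstimate a b k q - e| ≤ sdMax a b k * |x| / c :=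
      (h.abs_estimate_sub_le he q).trans (by gcongr)
    have h3 : natEntropy (k (inputEstimate a b k q)) - natEntropy (k e) ≤
        ε + η / c * |x| + D * x ^ 2 := by
      refine (le_abs_self _).trans ?_
      have hp1 : 0 ≤ η / c * |x| := by positivity
      have hp2 : 0 ≤ D * x ^ 2 := by positivity
      by_cases hxK : |x| ≤ K
      · have h4 := hent e he _ (h.estimate_mem q) (h2.trans (by
          calc sdMax a b k * |x| / c ≤ sdMax a b k * K / c := by gcongr
            _ = K / c * sdMax a b k := by ring
            _ ≤ n * sdMax a b k := by gcongr))
        linarith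
      · have h5 := h.abs_natEntropy_sub_le he (h.estimate_mem q)
        have h6 := h.abs_log_sd_sub_le hsd he (h.estimate_mem q)
        have h7 : η / sdMax a b k * |inputEstimate a b k q - e| ≤ η / c * |x| := by
          calc η / sdMax a b k * |inputEstimate a b k q - e|
              ≤ η / sdMax a b k * (sdMax a b k * |x| / c) := by gcongr
            _ = _ := by field_simp
        have h8 : 2 * shapeConst p B ≤ D * x ^ 2 := by
          rw [hD, div_mul_eq_mul_div, le_div_iff₀ (by positivity)]
          have : K ^ 2 ≤ x ^ 2 := by
            rw [← sq_abs x]; exact pow_le_pow_left₀ hK.le (not_le.1 hxK).le 2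
          gcongr
        linarith
    rw [h.log_refDensity]
    simp only
    linarith
  have i1 := (h0.integrable.const_mul A).add (h0.integrable_abs_mul.const_mul (η / c + τ))
  have i2 := i1.add (h0.sq_integrable.const_mul D)
  have i3 : Integrable fun x => (A + (η / c + τ) * |x| + D * x ^ 2) * shape k e x := by
    refine i2.congr (Eventually.of_forall fun x => ?_)
    simp only [Pi.add_apply]; ring
  rw [← integral_neg]
  calc ∫ q, -(Real.log (refDensity a b τ k q) * k e q)
      ≤ ∫ q, (fun x => A + (η / c + τ) * |x| + D * x ^ 2) ((q - condMean k e) / condSd k e) *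
          k e q := by
        refine integral_mono (h.integrable_mul he h.measurable_log_refDensity hC').neg
          ((h.integrable_mul_iff he _).2 i3) fun q => ?_
        simp only
        rw [← neg_mul]
        exact mul_le_mul_of_nonneg_right (key q) (h.isChannel.nonneg e he q)
    _ = ∫ x, (A + (η / c + τ) * |x| + D * x ^ 2) * shape k e x :=
        h.integral_mul_eq he fun x => A + (η / c + τ) * |x| + D * x ^ 2
    _ = A + (η / c + τ) * (∫ x, |x| * shape k e x) + D := by
        have e1 := integral_add i1 (h0.sq_integrable.const_mul D)
        have e2 := integral_add (h0.integrable.const_mul A)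
          (h0.integrable_abs_mul.const_mul (η / c + τ))
        simp only [Pi.add_apply] at e1 e2
        rw [integral_const_mul, h0.sq_integral, e2, integral_const_mul, integral_const_mul,
          h0.integral_eq_one] at e1
        rw [mul_one, mul_one] at e1
        rw [← e1]
        congr 1; ext x; ring
    _ ≤ A + (η / c + τ) * 1 + D := by
        gcongr
        exact h0.integral_abs_mul_le_one
    _ = _ := by rw [hA]; ring

end RegularChannel

/-! ### Lower bound for the mutual information of the candidate density -/

theorem lintegral_abs_deriv_mul_le {S : Set ℝ} {f f' : ℝ → ℝ} (hS : MeasurableSet S)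
    (hf' : ∀ x ∈ S, HasDerivWithinAt f (f' x) S x) (hf : InjOn f S) (G : ℝ → ENNReal) :
    ∫⁻ x in S, ENNReal.ofReal |f' x| * G (f x) ≤ ∫⁻ x, G x := by
  rw [← lintegral_image_eq_lintegral_abs_deriv_mul hS hf' hf]
  exact setLIntegral_le_lintegral _ _

namespace RegularChannel

variable {a b qmin qmax c p B : ℝ} {k : ℝ → ℝ → ℝ} {P : Measure ℝ}

/-- Any conditional density `V` of the input given the output bounds the mutual information from
below by the mean of `log (V / g)`, with `g` the density of the input. Here
`V = g * k * exp A`, and the integral of `V` need only be at most `1`. -/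
theorem le_natEntropy_output (h : RegularChannel a b qmin qmax c p B k) (hP : P ∈ inputLaws a b)
    {A : ℝ → ℝ → ℝ} (hA : Measurable (Function.uncurry A))
    (hi : Integrable (Function.uncurry fun e q => k e q * A e q) (P.prod volume))
    (hle : ∀ q, ∫⁻ e, ENNReal.ofReal (k e q * Real.exp (A e q)) ∂P ≤ 1) :
    ∫ e, (∫ q, k e q * A e q) ∂P ≤ natEntropy (outputDensity k P) := by
  have := hP.1
  rw [integral_integral_swap hi]
  refine integral_mono_ae hi.integral_prod_right (h.integrable_negMulLog_output hP) ?_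
  filter_upwards [hi.prod_left_ae, (h.integrable_uncurry hP).prod_left_ae] with q hq1 hq2
  simp only [Function.uncurry] at hq1 hq2
  have hm := ae_mem_of_mem_inputLaws hP
  have hk : ∀ᵐ e ∂P, 0 ≤ k e q := by
    filter_upwards [hm] with e he using h.isChannel.nonneg e he q
  have hf : outputDensity k P q = ∫ e, k e q ∂P := rfl
  rcases (h.output_nonneg hP q).eq_or_lt with h0 | h0
  · rw [← h0, Real.negMulLog_zero]
    refine (integral_eq_zero_of_ae ?_).le
    have := (integral_eq_zero_iff_of_nonneg_ae hk hq2).1 (by rw [← hf, ← h0])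
    filter_upwards [this] with e he
    simp only [Pi.zero_apply] at he ⊢
    rw [he, zero_mul]
  · have hmeas : Measurable fun e => k e q * Real.exp (A e q) :=
      h.isChannel.measurable.of_uncurry_right.mul
        (Real.measurable_exp.comp hA.of_uncurry_right)
    have hnn : 0 ≤ᵐ[P] fun e => k e q * Real.exp (A e q) := by
      filter_upwards [hk] with e he using mul_nonneg he (Real.exp_pos _).le
    have hi2 : Integrable (fun e => k e q * Real.exp (A e q)) P :=
      ⟨hmeas.aestronglyMeasurable, (hasFiniteIntegral_iff_ofReal hnn).2
        ((hle q).trans_lt ENNReal.one_lt_top)⟩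
    have hone : ∫ e, k e q * Real.exp (A e q) ∂P ≤ 1 := by
      rw [integral_eq_lintegral_of_nonneg_ae hnn hmeas.aestronglyMeasurable]
      exact ENNReal.toReal_mono ENNReal.one_ne_top (hle q)
    have i1 := hq2.const_mul (-Real.log (outputDensity k P q) - 1)
    have i2 := hi2.const_mul (outputDensity k P q)
    calc ∫ e, k e q * A e q ∂P
        ≤ ∫ e, ((-Real.log (outputDensity k P q) - 1) * k e q +
            outputDensity k P q * (k e q * Real.exp (A e q))) ∂P := by
          refine integral_mono_ae hq1 (i1.add i2) ?_
          filter_upwards [hk] with e he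
          have h1 := Real.add_one_le_exp (A e q + Real.log (outputDensity k P q))
          rw [Real.exp_add, Real.exp_log h0] at h1
          have h2 := mul_le_mul_of_nonneg_left h1 he
          nlinarith
      _ = (-Real.log (outputDensity k P q) - 1) * outputDensity k P q +
            outputDensity k P q * ∫ e, k e q * Real.exp (A e q) ∂P := by
          rw [integral_add i1 i2, integral_const_mul, integral_const_mul, ← hf]
      _ ≤ (-Real.log (outputDensity k P q) - 1) * outputDensity k P q +
            outputDensity k P q * 1 := by gcongr
      _ = Real.negMulLog (outputDensity k P q) := by simp only [Real.negMulLog]; ring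

theorem measurable_mean (h : RegularChannel a b qmin qmax c p B k) : Measurable (condMean k) := by
  have : Measurable (Function.uncurry fun e q => q * k e q) :=
    measurable_snd.mul h.isChannel.measurable
  exact (this.stronglyMeasurable.integral_prod_right (ν := volume)).measurable

theorem measurable_sd (h : RegularChannel a b qmin qmax c p B k) : Measurable (condSd k) := by
  have : Measurable (Function.uncurry fun e q => (q - condMean k e) ^ 2 * k e q) :=
    ((measurable_snd.sub (h.measurable_mean.comp measurable_fst)).pow_const 2).mul
      h.isChannel.measurable
  exact (this.stronglyMeasurable.integral_prod_right (ν := volume)).measurable.sqrt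

/-- The posterior density built from the shape at the estimated input, on the set of inputs whose
mean is within `K * σ_max` of the output. -/
theorem lintegral_slope_mul_shape_le (h : RegularChannel a b qmin qmax c p B k) {η K : ℝ}
    (hK : 0 ≤ K) (hKη : K * η < c)
    (hsd : ∀ e ∈ Icc a b, sdMax a b k * |derivWithin (condSd k) (Icc a b) e| ≤ η * condSd k e)
    (q : ℝ) {r : ℝ} (hr : r ∈ Icc a b) :
    ∫⁻ e in Icc a b, ENNReal.ofReal (meanSlope a b k e *
      (if |q - condMean k e| ≤ K * sdMax a b k then
        (condSd k e)⁻¹ * shape k r ((q - condMean k e) / condSd k e) else 0)) ≤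
    ENNReal.ofReal (1 / (1 - K * η / c)) := by
  have hc := h.c_pos
  have hm := h.sdMax_pos
  have hρ : 0 < 1 - K * η / c := by
    rw [sub_pos, div_lt_one hc]; exact hKη
  set S : Set ℝ := Icc a b ∩ {e | |q - condMean k e| ≤ K * sdMax a b k} with hS
  have hSc : OrdConnected S := by
    refine ⟨fun x hx y hy z hz => ?_⟩
    have hz' : z ∈ Icc a b := ⟨hx.1.1.trans hz.1, hz.2.trans hy.1.2⟩
    refine ⟨hz', ?_⟩
    have h1 := h.strictMonoOn_mean.monotoneOn hx.1 hz' hz.1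
    have h2 := h.strictMonoOn_mean.monotoneOn hz' hy.1 hz.2
    have h3 := abs_le.1 (show |q - condMean k x| ≤ K * sdMax a b k from hx.2)
    have h4 := abs_le.1 (show |q - condMean k y| ≤ K * sdMax a b k from hy.2)
    change |q - condMean k z| ≤ K * sdMax a b k
    exact abs_le.2 ⟨by linarith [h4.1], by linarith [h3.2]⟩
  have hSm : MeasurableSet S := hSc.measurableSet
  set f : ℝ → ℝ := fun e => (q - condMean k e) / condSd k e with hf
  set f' : ℝ → ℝ := fun e => (-meanSlope a b k e * condSd k e -
    (q - condMean k e) * derivWithin (condSd k) (Icc a b) e) / condSd k e ^ 2 with hf'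
  have hd : ∀ e ∈ S, HasDerivWithinAt f (f' e) S e := by
    intro e he
    have h1 := ((h.hasDerivWithinAt_mean he.1).const_sub q).mono
      (inter_subset_left : S ⊆ Icc a b)
    have h2 := ((h.diff_sd e he.1).hasDerivWithinAt).mono (inter_subset_left : S ⊆ Icc a b)
    exact h1.div h2 (h.sd_pos he.1).ne'
  have hbd : ∀ e ∈ S, meanSlope a b k e * (condSd k e)⁻¹ * (1 - K * η / c) ≤ -f' e := by
    intro e he
    have hs := h.sd_pos he.1
    have h1 : |(q - condMean k e) * derivWithin (condSd k) (Icc a b) e| ≤ K * η * condSd k e := by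
      rw [abs_mul]
      calc |q - condMean k e| * |derivWithin (condSd k) (Icc a b) e|
          ≤ K * sdMax a b k * |derivWithin (condSd k) (Icc a b) e| := by
            gcongr; exact he.2
        _ = K * (sdMax a b k * |derivWithin (condSd k) (Icc a b) e|) := by ring
        _ ≤ K * (η * condSd k e) := mul_le_mul_of_nonneg_left (hsd e he.1) hK
        _ = _ := by ring
    have hη : 0 ≤ η := by
      have := (mul_nonneg hm.le (abs_nonneg _)).trans (hsd e he.1)
      exact nonneg_of_mul_nonneg_left this hs
    have h2 : K * η ≤ meanSlope a b k e * (K * η / c) := by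
      have h3 := h.slope e he.1
      calc K * η = c * (K * η / c) := by field_simp
        _ ≤ _ := by gcongr
    have h4 : -f' e = (meanSlope a b k e * condSd k e +
        (q - condMean k e) * derivWithin (condSd k) (Icc a b) e) / condSd k e ^ 2 := by
      rw [hf']; ring
    rw [h4, le_div_iff₀ (by positivity)]
    have h5 : meanSlope a b k e * (condSd k e)⁻¹ * (1 - K * η / c) * condSd k e ^ 2 =
        meanSlope a b k e * condSd k e - meanSlope a b k e * (K * η / c) * condSd k e := by
      field_simp
    rw [h5]
    have h6 := (abs_le.1 h1).1
    have h7 := mul_le_mul_of_nonneg_right h2 hs.le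
    linarith
  -- `σ` may vary, but on `S` it does not vary enough to spoil the monotonicity of `f`
  have hpos : ∀ e ∈ S, 0 < meanSlope a b k e * (condSd k e)⁻¹ := fun e he =>
    mul_pos (h.slope_pos he.1) (inv_pos.2 (h.sd_pos he.1))
  have hinj : InjOn f S := by
    refine (strictAntiOn_of_deriv_neg hSc.convex (fun e he => (hd e he).continuousWithinAt)
      fun e he => ?_).injOn
    have hmem := interior_subset he
    rw [((hd e hmem).hasDerivAt (mem_interior_iff_mem_nhds.1 he)).deriv]
    have := mul_pos (hpos e hmem) hρ
    linarith [hbd e hmem]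
  have h0 := h.stdShape hr
  calc ∫⁻ e in Icc a b, ENNReal.ofReal (meanSlope a b k e *
      (if |q - condMean k e| ≤ K * sdMax a b k then
        (condSd k e)⁻¹ * shape k r ((q - condMean k e) / condSd k e) else 0))
      ≤ ∫⁻ e in Icc a b, S.indicator (fun e => ENNReal.ofReal (1 / (1 - K * η / c)) *
          (ENNReal.ofReal |f' e| * ENNReal.ofReal (shape k r (f e)))) e := by
        refine setLIntegral_mono_ae' measurableSet_Icc (Eventually.of_forall fun e he => ?_)
        by_cases hc' : |q - condMean k e| ≤ K * sdMax a b k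
        · have heS : e ∈ S := ⟨he, hc'⟩
          rw [indicator_of_mem heS, if_pos hc', ← ENNReal.ofReal_mul (abs_nonneg _),
            ← ENNReal.ofReal_mul (by positivity)]
          apply ENNReal.ofReal_le_ofReal
          rw [← mul_assoc, ← mul_assoc]
          refine mul_le_mul_of_nonneg_right ?_ (h0.nonneg _)
          rw [one_div, ← div_eq_inv_mul, le_div_iff₀ hρ]
          exact (hbd e heS).trans (neg_le_abs _)
        · simp [hc']
    _ = ENNReal.ofReal (1 / (1 - K * η / c)) *
          ∫⁻ e in S, ENNReal.ofReal |f' e| * ENNReal.ofReal (shape k r (f e)) := by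
        rw [setLIntegral_indicator hSm, inter_eq_left.2 (inter_subset_left : S ⊆ Icc a b),
          lintegral_const_mul' _ _ ENNReal.ofReal_ne_top]
    _ ≤ ENNReal.ofReal (1 / (1 - K * η / c)) * ∫⁻ x, ENNReal.ofReal (shape k r x) := by
        exact mul_le_mul' le_rfl
          (lintegral_abs_deriv_mul_le hSm hd hinj fun x => ENNReal.ofReal (shape k r x))
    _ = _ := by
        rw [← ofReal_integral_eq_lintegral_ofReal h0.integrable
          (Eventually.of_forall h0.nonneg), h0.integral_eq_one, ENNReal.ofReal_one, mul_one]

theorem lintegral_slope_mul_cauchy_le (h : RegularChannel a b qmin qmax c p B k) {s : ℝ}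
    (hs : 0 < s) (q : ℝ) :
    ∫⁻ e in Icc a b, ENNReal.ofReal (meanSlope a b k e *
      (s⁻¹ * (1 + ((q - condMean k e) / s) ^ 2)⁻¹)) ≤ ENNReal.ofReal Real.pi := by
  have h1 := lintegral_abs_deriv_mul_le (f := fun e => (q - condMean k e) / s)
    (f' := fun e => -meanSlope a b k e / s) measurableSet_Icc
    (fun e he => ((h.hasDerivWithinAt_mean he).const_sub q).div_const s)
    (fun x hx y hy hxy => h.strictMonoOn_mean.injOn hx hy (by
      have h2 := (div_left_inj' hs.ne').1 hxy
      linarith)) fun x => ENNReal.ofReal (1 + x ^ 2)⁻¹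
  rw [← ofReal_integral_eq_lintegral_ofReal integrable_inv_one_add_sq
    (Eventually.of_forall fun x => by positivity), integral_univ_inv_one_add_sq] at h1
  refine (setLIntegral_mono_ae' measurableSet_Icc (Eventually.of_forall fun e he => ?_)).trans h1
  rw [← ENNReal.ofReal_mul (abs_nonneg _)]
  apply ENNReal.ofReal_le_ofReal
  rw [abs_div, abs_neg, abs_of_pos (h.slope_pos he), abs_of_pos hs]
  exact le_of_eq (by ring)

end RegularChannel

/-- The loss in the exponent of the posterior density used for the lower bound: it is paid for
replacing the shape at the true input by the shape at the estimated input, and, in the tails, by a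
Cauchy density of weight `δ`. -/
noncomputable def posteriorLoss (η δ K : ℝ) (k : ℝ → ℝ → ℝ) (e q : ℝ) : ℝ :=
  η + if K < |(q - condMean k e) / condSd k e| then
    Real.posLog (condSd k e * k e q) - Real.log δ + 3 * |(q - condMean k e) / condSd k e| else 0

namespace RegularChannel

variable {a b qmin qmax c p B : ℝ} {k : ℝ → ℝ → ℝ}

theorem measurable_posteriorLoss (h : RegularChannel a b qmin qmax c p B k) (η δ K : ℝ) :
    Measurable (Function.uncurry (posteriorLoss η δ K k)) := by
  have hm : Measurable fun z : ℝ × ℝ => condMean k z.1 := h.measurable_mean.comp measurable_fst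
  have hs : Measurable fun z : ℝ × ℝ => condSd k z.1 := h.measurable_sd.comp measurable_fst
  have hk := h.isChannel.measurable
  have hx : Measurable fun z : ℝ × ℝ => |(z.2 - condMean k z.1) / condSd k z.1| :=
    ((measurable_snd.sub hm).div hs).norm
  have hl : Measurable fun z : ℝ × ℝ => Real.posLog (condSd k z.1 * k z.1 z.2) :=
    Real.continuous_posLog.measurable.comp (hs.mul hk)
  exact (Measurable.ite (measurableSet_lt measurable_const hx)
    ((hl.sub_const _).add (hx.const_mul 3)) measurable_const).const_add η

/-- For `|x| ≤ K`, `x` the standardised output, the shapes at the true and at the estimated input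
are comparable. For `|x| > K` only `|log (σ(r) / σ(e))| ≤ |x|` is known, `r` being the estimated
input, and the Cauchy density of width `σ(r)` decays so slowly that this suffices. -/
theorem mul_exp_neg_posteriorLoss_le (h : RegularChannel a b qmin qmax c p B k) {η δ K n : ℝ}
    (hη : 0 ≤ η) (hηc : η ≤ c) (hδ : 0 < δ) (hn : K / c ≤ n)
    (hsd : ∀ e ∈ Icc a b, sdMax a b k * |derivWithin (condSd k) (Icc a b) e| ≤ η * condSd k e)
    (hsh : ∀ e ∈ Icc a b, ∀ r ∈ Icc a b, |r - e| ≤ n * sdMax a b k → ∀ x, |x| ≤ K →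
      |shape k r x - shape k e x| ≤ η * shape k e x) {e : ℝ} (he : e ∈ Icc a b) (q : ℝ) :
    k e q * Real.exp (-posteriorLoss η δ K k e q) ≤
      (if |q - condMean k e| ≤ K * sdMax a b k then
        (condSd k e)⁻¹ * shape k (inputEstimate a b k q) ((q - condMean k e) / condSd k e) else 0) +
      δ * ((condSd k (inputEstimate a b k q))⁻¹ *
        (1 + ((q - condMean k e) / condSd k (inputEstimate a b k q)) ^ 2)⁻¹) := by
  have hc := h.c_pos
  have hm := h.sdMax_pos
  have hs := h.sd_pos he
  have hr := h.estimate_mem q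
  have hsr := h.sd_pos hr
  set r := inputEstimate a b k q with hrdef
  set x := (q - condMean k e) / condSd k e with hx
  have hqx : |q - condMean k e| = condSd k e * |x| := by
    rw [hx, abs_div, abs_of_pos hs]; field_simp
  have hle : |q - condMean k e| ≤ sdMax a b k * |x| := by
    rw [hqx]; exact mul_le_mul_of_nonneg_right (h.sd_le he) (abs_nonneg _)
  have hkφ : k e q = shape k e x / condSd k e := h.apply_eq_shape he q
  have hφ := h.shape_nonneg he x
  have hφr := h.shape_nonneg hr x
  have h2 : |r - e| ≤ sdMax a b k * |x| / c := (h.abs_estimate_sub_le he q).trans (by gcongr)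
  have hV2 : 0 ≤ δ * ((condSd k r)⁻¹ * (1 + ((q - condMean k e) / condSd k r) ^ 2)⁻¹) := by
    positivity
  by_cases hxK : K < |x|
  · have hV1 : 0 ≤ (if |q - condMean k e| ≤ K * sdMax a b k then
        (condSd k e)⁻¹ * shape k r x else 0) := by
      split_ifs <;> positivity
    have hlog := h.abs_log_sd_sub_le hsd he hr
    have hlog2 : |Real.log (condSd k r) - Real.log (condSd k e)| ≤ |x| := by
      refine hlog.trans ?_
      calc η / sdMax a b k * |r - e| ≤ η / sdMax a b k * (sdMax a b k * |x| / c) := by gcongr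
        _ = η / c * |x| := by field_simp
        _ ≤ 1 * |x| := by gcongr; exact (div_le_one hc).2 hηc
        _ = |x| := one_mul _
    have t1 : condSd k r / condSd k e ≤ Real.exp |x| := by
      rw [← Real.log_le_iff_le_exp (by positivity), Real.log_div hsr.ne' hs.ne']
      exact (le_abs_self _).trans hlog2
    have t2 : condSd k e / condSd k r ≤ Real.exp |x| := by
      rw [← Real.log_le_iff_le_exp (by positivity), Real.log_div hs.ne' hsr.ne']
      have := (neg_le_abs _).trans hlog2
      linarith
    have t3 : 1 + x ^ 2 ≤ Real.exp (2 * |x|) := by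
      rw [← Real.log_le_iff_le_exp (by positivity)]; exact log_one_add_sq_le x
    have t4 : condSd k r / condSd k e * (1 + ((q - condMean k e) / condSd k r) ^ 2) ≤
        Real.exp (3 * |x|) := by
      have e1 : condSd k r / condSd k e * (1 + ((q - condMean k e) / condSd k r) ^ 2) =
          condSd k r / condSd k e + x ^ 2 * (condSd k e / condSd k r) := by
        rw [hx]; field_simp
      rw [e1]
      calc condSd k r / condSd k e + x ^ 2 * (condSd k e / condSd k r)
          ≤ Real.exp |x| + x ^ 2 * Real.exp |x| := by gcongr
        _ = Real.exp |x| * (1 + x ^ 2) := by ring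
        _ ≤ Real.exp |x| * Real.exp (2 * |x|) := by gcongr
        _ = Real.exp (3 * |x|) := by rw [← Real.exp_add]; congr 1; ring
    have t5 : shape k e x * Real.exp (-Real.posLog (shape k e x)) ≤ 1 := by
      rw [Real.exp_neg, Real.posLog_eq_log_max_one hφ, Real.exp_log (by positivity),
        ← div_eq_mul_inv, div_le_one (by positivity)]
      exact le_max_right _ _
    have e2 : condSd k e * k e q = shape k e x := by rw [hkφ]; field_simp
    have hloss : posteriorLoss η δ K k e q =
        η + (Real.posLog (shape k e x) - Real.log δ + 3 * |x|) := by
      rw [posteriorLoss, if_pos hxK, e2]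
    have e3 : Real.exp (-posteriorLoss η δ K k e q) = Real.exp (-η) *
        (Real.exp (-Real.posLog (shape k e x)) * δ * Real.exp (-(3 * |x|))) := by
      rw [hloss, show -(η + (Real.posLog (shape k e x) - Real.log δ + 3 * |x|)) =
        -η + (-Real.posLog (shape k e x) + Real.log δ + -(3 * |x|)) by ring, Real.exp_add,
        Real.exp_add, Real.exp_add, Real.exp_log hδ]
    have t6 : Real.exp (-η) ≤ 1 := Real.exp_le_one_iff.2 (by linarith)
    refine le_add_of_nonneg_of_le hV1 ?_
    rw [e3, hkφ]
    calc shape k e x / condSd k e * (Real.exp (-η) *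
        (Real.exp (-Real.posLog (shape k e x)) * δ * Real.exp (-(3 * |x|))))
        = (shape k e x * Real.exp (-Real.posLog (shape k e x))) * Real.exp (-η) *
          (δ * (Real.exp (-(3 * |x|)) / condSd k e)) := by ring
      _ ≤ 1 * 1 * (δ * (Real.exp (-(3 * |x|)) / condSd k e)) := by gcongr
      _ ≤ δ * ((condSd k r)⁻¹ * (1 + ((q - condMean k e) / condSd k r) ^ 2)⁻¹) := by
          rw [one_mul, one_mul]
          gcongr
          rw [← mul_inv, Real.exp_neg, inv_eq_one_div, div_div, one_div,
            inv_le_inv₀ (by positivity) (by positivity)]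
          have := mul_le_mul_of_nonneg_right t4 hs.le
          refine le_trans (le_of_eq ?_) this
          field_simp
  · have hxK' : |x| ≤ K := not_lt.1 hxK
    have hcond : |q - condMean k e| ≤ K * sdMax a b k := by
      refine hle.trans ?_
      rw [mul_comm]
      gcongr
    have h3 : |e - r| ≤ n * sdMax a b k := by
      rw [abs_sub_comm]
      calc |r - e| ≤ sdMax a b k * |x| / c := h2
        _ ≤ sdMax a b k * K / c := by gcongr
        _ = K / c * sdMax a b k := by ring
        _ ≤ n * sdMax a b k := by gcongr
    have h4 := (abs_le.1 (hsh r hr e he h3 x hxK')).2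
    have h5 : posteriorLoss η δ K k e q = η := by rw [posteriorLoss, if_neg hxK, add_zero]
    rw [if_pos hcond, h5, hkφ]
    have h6 : (1 + η) * Real.exp (-η) ≤ 1 := by
      rw [Real.exp_neg, ← div_eq_mul_inv, div_le_one (Real.exp_pos _)]
      linarith [Real.add_one_le_exp η]
    refine le_add_of_le_of_nonneg ?_ hV2
    calc shape k e x / condSd k e * Real.exp (-η)
        ≤ ((1 + η) * shape k r x) / condSd k e * Real.exp (-η) := by
          gcongr; linarith
      _ = ((1 + η) * Real.exp (-η)) * ((condSd k e)⁻¹ * shape k r x) := by ring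
      _ ≤ 1 * ((condSd k e)⁻¹ * shape k r x) := by gcongr
      _ = _ := one_mul _

theorem integrable_mul_posteriorLoss (h : RegularChannel a b qmin qmax c p B k) {η δ K : ℝ}
    (hη : 0 ≤ η) (hδ : 0 < δ) (hδ1 : δ ≤ 1) (hK : 1 ≤ K) {e : ℝ} (he : e ∈ Icc a b) :
    (∀ q, 0 ≤ posteriorLoss η δ K k e q) ∧
    Integrable (fun q => k e q * posteriorLoss η δ K k e q) ∧
    ∫ q, k e q * posteriorLoss η δ K k e q ≤
      η + (3 - Real.log δ) * (shapeConst p B / K) := by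
  have h0 := h.stdShape he
  have hs := h.sd_pos he
  have hlδ : Real.log δ ≤ 0 := Real.log_nonpos hδ.le hδ1
  have hnn : ∀ q, 0 ≤ posteriorLoss η δ K k e q := by
    intro q
    unfold posteriorLoss
    have h1 := Real.posLog_nonneg (x := condSd k e * k e q)
    have h2 := abs_nonneg ((q - condMean k e) / condSd k e)
    split_ifs <;> linarith
  set T : ℝ → ℝ := fun x => (3 - Real.log δ) *
    (if K < |x| then Real.posLog (shape k e x) + 1 + |x| else 0) with hT
  have hTφ : ∀ x, T x * shape k e x = (3 - Real.log δ) * tailCost K (shape k e) x := by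
    intro x
    simp only [hT, tailCost]
    split_ifs <;> ring
  have hle : ∀ q, k e q * posteriorLoss η δ K k e q ≤
      η * k e q + T ((q - condMean k e) / condSd k e) * k e q := by
    intro q
    have hk := h.isChannel.nonneg e he q
    have e2 : condSd k e * k e q = shape k e ((q - condMean k e) / condSd k e) := by
      rw [h.apply_eq_shape he q]; field_simp
    rw [← add_mul, mul_comm]
    refine mul_le_mul_of_nonneg_right ?_ hk
    unfold posteriorLoss
    rw [e2]
    set x := (q - condMean k e) / condSd k e
    have h1 := Real.posLog_nonneg (x := shape k e x)
    have h2 := abs_nonneg x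
    simp only [hT]
    split_ifs
    · nlinarith [mul_nonneg (by linarith : 0 ≤ 2 - Real.log δ) h1,
        mul_nonneg (by linarith : 0 ≤ -Real.log δ) h2]
    · simp
  have i1 : Integrable fun q => T ((q - condMean k e) / condSd k e) * k e q := by
    rw [h.integrable_mul_iff he T]
    simp_rw [hTφ]
    exact (h0.integrable_tailCost h.one_lt hK).const_mul _
  have i2 := ((h.integrable he).const_mul η).add i1
  have i3 : Integrable fun q => k e q * posteriorLoss η δ K k e q := by
    refine i2.mono' ((h.measurable_apply e).mul
      (h.measurable_posteriorLoss η δ K).of_uncurry_left).aestronglyMeasurable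
      (Eventually.of_forall fun q => ?_)
    rw [Real.norm_eq_abs, abs_of_nonneg (mul_nonneg (h.isChannel.nonneg e he q) (hnn q))]
    exact hle q
  refine ⟨hnn, i3, (integral_mono i3 i2 hle).trans ?_⟩
  have e1 := integral_add ((h.integrable he).const_mul η) i1
  simp only [Pi.add_apply] at e1 ⊢
  rw [e1, integral_const_mul, h.isChannel.integral_eq_one e he, h.integral_mul_eq he T]
  simp_rw [hTφ]
  rw [integral_const_mul, mul_one]
  have := h0.integral_tailCost_le h.one_lt hK
  gcongr
  linarith

theorem slowDensity_law_mem (h : RegularChannel a b qmin qmax c p B k) :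
    lawOfDensity a b (slowDensity a b k) ∈ densityLaws a b :=
  lawOfDensity_mem h.integrableOn_slowDensity (fun _ he => (h.slowDensity_pos he).le)
    h.integral_slowDensity

/-- The candidate density transmits almost `log N`. The posterior density that shows this is
`m'(e) / σ(e)` times the shape at the estimated input, evaluated at the standardised output, plus a
small multiple of `m'(e)` times a Cauchy density; as a function of the input both are densities up
to a factor close to `1`, by a change of variables. -/
theorem natInfo_slowDensity_ge (h : RegularChannel a b qmin qmax c p B k) {η δ K n : ℝ}
    (hη : 0 ≤ η) (hηc : η ≤ c) (hδ : 0 < δ) (hδ1 : δ ≤ 1) (hK : 1 ≤ K) (hKη : K * η < c)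
    (hn : K / c ≤ n)
    (hsd : ∀ e ∈ Icc a b, sdMax a b k * |derivWithin (condSd k) (Icc a b) e| ≤ η * condSd k e)
    (hsh : ∀ e ∈ Icc a b, ∀ r ∈ Icc a b, |r - e| ≤ n * sdMax a b k → ∀ x, |x| ≤ K →
      |shape k r x - shape k e x| ≤ η * shape k e x) :
    Real.log (normFactor a b k) - Real.log (1 / (1 - K * η / c) + δ * Real.pi) -
      (η + (3 - Real.log δ) * (shapeConst p B / K)) ≤
        natInfo k (lawOfDensity a b (slowDensity a b k)) := by
  set P := lawOfDensity a b (slowDensity a b k) with hPdef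
  have hP : P ∈ inputLaws a b := h.slowDensity_law_mem.1
  have := hP.1
  have hc := h.c_pos
  have hN := h.normFactor_pos
  have hρ : 0 < 1 - K * η / c := by rw [sub_pos, div_lt_one hc]; exact hKη
  set Z := 1 / (1 - K * η / c) + δ * Real.pi with hZ
  have hpi := Real.pi_pos
  have hZ0 : 0 < Z := by positivity
  set A : ℝ → ℝ → ℝ := fun e q => (Real.log (normFactor a b k) + natEntropy (k e) - Real.log Z) -
    posteriorLoss η δ K k e q with hA
  have hAm : Measurable (Function.uncurry A) :=
    (((h.measurable_natEntropy.comp measurable_fst).const_add _).sub_const _).sub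
      (h.measurable_posteriorLoss η δ K)
  have hkA : ∀ e q, k e q * A e q =
      (Real.log (normFactor a b k) + natEntropy (k e) - Real.log Z) * k e q -
        k e q * posteriorLoss η δ K k e q := fun e q => by simp only [hA]; ring
  obtain ⟨D, hD⟩ := h.exists_abs_natEntropy_le
  set M := |Real.log (normFactor a b k)| + D + |Real.log Z| +
    (η + (3 - Real.log δ) * (shapeConst p B / K)) with hM
  have hi : Integrable (Function.uncurry fun e q => k e q * A e q) (P.prod volume) := by
    refine integrable_uncurry_of_bounded hP (h.isChannel.measurable.mul hAm) (C := M)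
      fun e he => ?_
    obtain ⟨hnn, i1, hle⟩ := h.integrable_mul_posteriorLoss hη hδ hδ1 hK he
    have i2 := (h.integrable he).const_mul
      (Real.log (normFactor a b k) + natEntropy (k e) - Real.log Z)
    have i3 : Integrable fun q => k e q * A e q := by
      simp_rw [hkA]; exact i2.sub i1
    refine ⟨i3, ?_⟩
    have i4 := (h.integrable he).const_mul (|Real.log (normFactor a b k)| + D + |Real.log Z|)
    calc ∫ q, |k e q * A e q| ≤ ∫ q, ((|Real.log (normFactor a b k)| + D + |Real.log Z|) * k e q +
          k e q * posteriorLoss η δ K k e q) := by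
          refine integral_mono i3.abs (i4.add i1) fun q => ?_
          have hk := h.isChannel.nonneg e he q
          simp only
          rw [hkA]
          refine (abs_sub _ _).trans ?_
          rw [abs_of_nonneg (mul_nonneg hk (hnn q)), abs_mul, abs_of_nonneg hk]
          gcongr
          refine (abs_sub _ _).trans ?_
          gcongr
          exact (abs_add_le _ _).trans (by gcongr; exact hD e he)
      _ ≤ M := by
          have e1 := integral_add i4 i1
          rw [e1, integral_const_mul, h.isChannel.integral_eq_one e he, hM]
          linarith
  have hga : AEMeasurable (slowDensity a b k) (volume.restrict (Icc a b)) :=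
    h.integrableOn_slowDensity.aestronglyMeasurable.aemeasurable
  have hle : ∀ q, ∫⁻ e, ENNReal.ofReal (k e q * Real.exp (A e q)) ∂P ≤ 1 := by
    intro q
    have hr := h.estimate_mem q
    have hmeas : Measurable fun e => ENNReal.ofReal (k e q * Real.exp (A e q)) :=
      (h.isChannel.measurable.of_uncurry_right.mul
        (Real.measurable_exp.comp hAm.of_uncurry_right)).ennreal_ofReal
    rw [hPdef, lawOfDensity, lintegral_withDensity_eq_lintegral_mul₀ hga.ennreal_ofReal
      hmeas.aemeasurable]
    set V1 : ℝ → ℝ := fun e => meanSlope a b k e *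
      (if |q - condMean k e| ≤ K * sdMax a b k then
        (condSd k e)⁻¹ * shape k (inputEstimate a b k q) ((q - condMean k e) / condSd k e) else 0)
      with hV1
    set V2 : ℝ → ℝ := fun e => meanSlope a b k e *
      ((condSd k (inputEstimate a b k q))⁻¹ *
        (1 + ((q - condMean k e) / condSd k (inputEstimate a b k q)) ^ 2)⁻¹) with hV2
    have b1 : ∫⁻ e in Icc a b, ENNReal.ofReal (V1 e) ≤ ENNReal.ofReal (1 / (1 - K * η / c)) :=
      h.lintegral_slope_mul_shape_le (by linarith) hKη hsd q hr
    have b2 : ∫⁻ e in Icc a b, ENNReal.ofReal (V2 e) ≤ ENNReal.ofReal Real.pi :=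
      h.lintegral_slope_mul_cauchy_le (h.sd_pos hr) q
    have hV2m : AEMeasurable (fun e => ENNReal.ofReal (V2 e)) (volume.restrict (Icc a b)) := by
      refine (aemeasurable_slope.mul ?_).ennreal_ofReal
      have := h.measurable_mean
      exact Measurable.aemeasurable (by fun_prop)
    calc ∫⁻ e in Icc a b, ((fun e => ENNReal.ofReal (slowDensity a b k e)) *
          fun e => ENNReal.ofReal (k e q * Real.exp (A e q))) e
        ≤ ∫⁻ e in Icc a b, ENNReal.ofReal Z⁻¹ *
            (ENNReal.ofReal (V1 e) + ENNReal.ofReal δ * ENNReal.ofReal (V2 e)) := by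
          refine setLIntegral_mono_ae' measurableSet_Icc (Eventually.of_forall fun e he => ?_)
          have hg := (h.slowDensity_pos he).le
          have hs := h.slope_pos he
          have hse := h.sd_pos he
          have hsr := h.sd_pos hr
          have hv1 : 0 ≤ V1 e := by
            have := h.shape_nonneg hr ((q - condMean k e) / condSd k e)
            simp only [hV1]
            split_ifs <;> positivity
          have hv2 : 0 ≤ V2 e := by simp only [hV2]; positivity
          simp only [Pi.mul_apply]
          rw [← ENNReal.ofReal_mul hg, ← ENNReal.ofReal_mul hδ.le,
            ← ENNReal.ofReal_add hv1 (by positivity), ← ENNReal.ofReal_mul (by positivity)]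
          apply ENNReal.ofReal_le_ofReal
          have h1 := h.mul_exp_neg_posteriorLoss_le hη hηc hδ hn hsd hsh he q
          have h2 := mul_le_mul_of_nonneg_left h1 hs.le
          have e1 : Real.exp (A e q) = normFactor a b k * Real.exp (natEntropy (k e)) * Z⁻¹ *
              Real.exp (-posteriorLoss η δ K k e q) := by
            simp only [hA]
            rw [sub_eq_add_neg, Real.exp_add, Real.exp_sub, Real.exp_add, Real.exp_log hN,
              Real.exp_log hZ0, div_eq_mul_inv]
          have e2 : slowDensity a b k e * (k e q * Real.exp (A e q)) = Z⁻¹ *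
              (meanSlope a b k e * (k e q * Real.exp (-posteriorLoss η δ K k e q))) := by
            rw [e1, slowDensity_eq, slopeOverEntropy_eq, Real.exp_neg (natEntropy (k e))]
            have := Real.exp_ne_zero (natEntropy (k e))
            field_simp
          rw [e2]
          refine mul_le_mul_of_nonneg_left (h2.trans (le_of_eq ?_)) (by positivity)
          simp only [hV1, hV2]; ring
      _ = ENNReal.ofReal Z⁻¹ * ((∫⁻ e in Icc a b, ENNReal.ofReal (V1 e)) +
            ENNReal.ofReal δ * ∫⁻ e in Icc a b, ENNReal.ofReal (V2 e)) := by
          rw [lintegral_const_mul' _ _ ENNReal.ofReal_ne_top,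
            lintegral_add_right' _ (hV2m.const_mul _),
            lintegral_const_mul' _ _ ENNReal.ofReal_ne_top]
      _ ≤ ENNReal.ofReal Z⁻¹ * (ENNReal.ofReal (1 / (1 - K * η / c)) +
            ENNReal.ofReal δ * ENNReal.ofReal Real.pi) := by gcongr
      _ = 1 := by
          rw [← ENNReal.ofReal_mul hδ.le, ← ENNReal.ofReal_add (by positivity) (by positivity),
            ← ENNReal.ofReal_mul (by positivity), ← hZ, inv_mul_cancel₀ hZ0.ne', ENNReal.ofReal_one]
  have hmain := h.le_natEntropy_output hP hAm hi hle
  have hlow : Real.log (normFactor a b k) - Real.log Z -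
      (η + (3 - Real.log δ) * (shapeConst p B / K)) + ∫ e, natEntropy (k e) ∂P ≤
      ∫ e, (∫ q, k e q * A e q) ∂P := by
    have i0 := h.integrable_natEntropy hP
    calc _ = ∫ e, ((Real.log (normFactor a b k) - Real.log Z -
          (η + (3 - Real.log δ) * (shapeConst p B / K))) + natEntropy (k e)) ∂P := by
          rw [integral_add (integrable_const _) i0]; simp
      _ ≤ _ := by
          refine integral_mono_ae ((integrable_const _).add i0) hi.integral_prod_left ?_
          filter_upwards [ae_mem_of_mem_inputLaws hP] with e he
          obtain ⟨hnn, i1, hle⟩ := h.integrable_mul_posteriorLoss hη hδ hδ1 hK he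
          simp only [hkA]
          rw [integral_sub ((h.integrable he).const_mul _) i1, integral_const_mul,
            h.isChannel.integral_eq_one e he]
          linarith
  unfold natInfo
  linarith

end RegularChannel

/-! ### Slow change over several standard deviations -/

/-- Small fractional changes over distances at most `d` add up to small ones over `n * d`. For
`r = e` the hypothesis says that `u` is nonnegative. -/
theorem abs_sub_le_of_steps {a b d η : ℝ} {u : ℝ → ℝ} (hd : 0 ≤ d) (hη : 0 < η)
    (h : ∀ e ∈ Icc a b, ∀ r ∈ Icc a b, |r - e| ≤ d → |u r - u e| ≤ η * u e) (n : ℕ) :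
    ∀ e ∈ Icc a b, ∀ r ∈ Icc a b, |r - e| ≤ n * d → |u r - u e| ≤ ((1 + η) ^ n - 1) * u e := by
  have hu : ∀ e ∈ Icc a b, 0 ≤ u e := fun e he => by
    have := h e he e he (by simpa using hd)
    simp only [sub_self, abs_zero] at this
    exact nonneg_of_mul_nonneg_right this hη
  induction n with
  | zero =>
    intro e he r hr hre
    have : r = e := by
      simp only [Nat.cast_zero, zero_mul] at hre
      exact sub_eq_zero.1 (abs_nonpos_iff.1 hre)
    simp [this]
  | succ n ih =>
    intro e he r hr hre
    have hn : (0 : ℝ) < n + 1 := by positivity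
    push_cast at hre
    set t : ℝ := n / (n + 1) with ht
    have ht0 : 0 ≤ t := by positivity
    have ht1 : 1 - t = 1 / (n + 1) := by rw [ht]; field_simp; ring
    have ht2 : 0 ≤ 1 - t := by rw [ht1]; positivity
    have hm : (1 - t) * e + t * r ∈ Icc a b :=
      (convex_Icc a b) he hr ht2 ht0 (by ring)
    have h1 : |((1 - t) * e + t * r) - e| ≤ n * d := by
      rw [show (1 - t) * e + t * r - e = t * (r - e) by ring, abs_mul, abs_of_nonneg ht0]
      calc t * |r - e| ≤ t * ((n + 1) * d) := by gcongr
        _ = n * d := by rw [ht]; field_simp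
    have h2 : |r - ((1 - t) * e + t * r)| ≤ d := by
      rw [show r - ((1 - t) * e + t * r) = (1 - t) * (r - e) by ring, abs_mul, abs_of_nonneg ht2,
        ht1]
      calc 1 / ((n : ℝ) + 1) * |r - e| ≤ 1 / (n + 1) * ((n + 1) * d) := by gcongr
        _ = d := by field_simp
    have h3 := ih e he _ hm h1
    have h4 := h _ hm r hr h2
    have h5 := abs_sub_le (u r) (u ((1 - t) * e + t * r)) (u e)
    have h6 := (abs_le.1 h3).2
    have h7 : η * u ((1 - t) * e + t * r) ≤ η * ((1 + η) ^ n * u e) := by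
      gcongr; linarith
    rw [pow_succ]
    linarith

theorem exists_pow_sub_one_le (n : ℕ) {η : ℝ} (hη : 0 < η) :
    ∃ η' : ℝ, 0 < η' ∧ (1 + η') ^ n - 1 ≤ η := by
  have h1 : Tendsto (fun x : ℝ => (1 + x) ^ n - 1) (𝓝[>] 0) (𝓝 0) := by
    have : Continuous fun x : ℝ => (1 + x) ^ n - 1 := by fun_prop
    simpa using (this.tendsto 0).mono_left nhdsWithin_le_nhds
  obtain ⟨x, hx, hx0⟩ := ((h1.eventually (ge_mem_nhds hη)).and self_mem_nhdsWithin).exists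
  exact ⟨x, hx0, hx⟩

theorem SlowlyVarying.nat_mul {ι : Type*} {l : Filter ι} {a b : ℝ} {d : ι → ℝ} {u : ι → ℝ → ℝ}
    (h : SlowlyVarying l a b d u) (hd : ∀ i, 0 ≤ d i) (n : ℕ) :
    SlowlyVarying l a b (fun i => n * d i) u := by
  intro η hη
  obtain ⟨η', hη', hle⟩ := exists_pow_sub_one_le n hη
  filter_upwards [h η' hη'] with i hi e he r hr hre
  have h0 := hi e he e he (by simpa using hd i)
  rw [sub_self, abs_zero] at h0
  exact (abs_sub_le_of_steps (hd i) hη' hi n e he r hr hre).trans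
    (mul_le_mul_of_nonneg_right hle (nonneg_of_mul_nonneg_right h0 hη'))

namespace SlowChange

variable {ι : Type*} {l : Filter ι} {a b qmin qmax : ℝ} {k : ι → ℝ → ℝ → ℝ}

theorem exists_regular (hk : SlowChange l a b qmin qmax k) (hab : a < b) :
    ∃ c p B : ℝ, 0 < c ∧ 0 < shapeConst p B ∧ ∀ i, RegularChannel a b qmin qmax c p B (k i) := by
  obtain ⟨c, hc, hslope⟩ := hk.slope_pos
  obtain ⟨p, hp, B, hB⟩ := hk.shape_bound
  refine ⟨c, p, max B 0, hc, ?_, fun i => ⟨hab, hk.isChannel i, hk.differentiable_mean i,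
    hk.differentiable_sd i, hc, hslope i, hp, fun e he =>
      ⟨(hB i e he).1, (hB i e he).2.trans (le_max_left _ _)⟩⟩⟩
  have : 0 < p - 1 := by linarith
  have := Real.pi_pos
  unfold shapeConst
  positivity

variable {c p B : ℝ}

theorem shape_slow_nat_mul (hk : SlowChange l a b qmin qmax k)
    (hr : ∀ i, RegularChannel a b qmin qmax c p B (k i)) (n : ℕ) {K η : ℝ} (hK : 0 < K)
    (hη : 0 < η) :
    ∀ᶠ i in l, ∀ e ∈ Icc a b, ∀ r ∈ Icc a b, |r - e| ≤ n * sdMax a b (k i) → ∀ x, |x| ≤ K →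
      |shape (k i) r x - shape (k i) e x| ≤ η * shape (k i) e x := by
  obtain ⟨η', hη', hle⟩ := exists_pow_sub_one_le n hη
  filter_upwards [hk.shape_slow K hK η' hη'] with i hi e he r hr' hre x hx
  exact (abs_sub_le_of_steps (u := fun e => shape (k i) e x) (hr i).sdMax_pos.le hη'
    (fun e he r hr hre => hi e he r hr hre x hx) n e he r hr' hre).trans
    (mul_le_mul_of_nonneg_right hle ((hr i).shape_nonneg he x))

/-- The conditional entropy changes little over `n` times `σ_max`. The parameters are chosen in the
order `δ`, `K`, `η`: the tail term contains `-log δ / K`. -/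
theorem natEntropy_slow (hk : SlowChange l a b qmin qmax k)
    (hr : ∀ i, RegularChannel a b qmin qmax c p B (k i)) (hC : 0 < shapeConst p B) (n : ℕ) {ε : ℝ}
    (hε : 0 < ε) :
    ∀ᶠ i in l, ∀ e ∈ Icc a b, ∀ r ∈ Icc a b, |r - e| ≤ n * sdMax a b (k i) →
      |natEntropy (k i r) - natEntropy (k i e)| ≤ ε := by
  have hpi := Real.pi_pos
  set C := shapeConst p B
  set δ := min 1 (ε / (4 * Real.pi)) with hδ
  have hδ0 : 0 < δ := by positivity
  have hδ1 : δ ≤ 1 := min_le_left _ _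
  have hδ2 : δ * Real.pi ≤ ε / 4 := by
    calc δ * Real.pi ≤ ε / (4 * Real.pi) * Real.pi := by gcongr; exact min_le_right _ _
      _ = ε / 4 := by field_simp
  have hlδ : Real.log δ ≤ 0 := Real.log_nonpos hδ0.le hδ1
  set K := 1 + (3 - Real.log δ) * C * 4 / ε with hK
  have hnn : 0 ≤ (3 - Real.log δ) * C * 4 / ε := by
    have : 0 ≤ 3 - Real.log δ := by linarith
    positivity
  have hK1 : 1 ≤ K := by linarith
  have hK2 : (3 - Real.log δ) * (C / K) ≤ ε / 4 := by
    rw [← mul_div_assoc, div_le_iff₀ (by linarith)]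
    have : ε / 4 * ((3 - Real.log δ) * C * 4 / ε) = (3 - Real.log δ) * C := by field_simp
    nlinarith
  set η := min (ε / (4 * C)) (ε / (4 * (n + 1))) with hη
  have hη0 : 0 < η := by positivity
  have hη1 : η * C ≤ ε / 4 := by
    calc η * C ≤ ε / (4 * C) * C := by gcongr; exact min_le_left _ _
      _ = ε / 4 := by field_simp
  have hη2 : η * n ≤ ε / 4 := by
    calc η * n ≤ ε / (4 * (n + 1)) * (n + 1) := by
          gcongr
          · exact min_le_right _ _
          · linarith
      _ = ε / 4 := by field_simp
  filter_upwards [hk.sd_slow η hη0, hk.shape_slow_nat_mul hr n (by linarith : 0 < K) hη0]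
    with i hsd hsh
  have h := hr i
  have key : ∀ e ∈ Icc a b, ∀ r ∈ Icc a b, |r - e| ≤ n * sdMax a b (k i) →
      natEntropy (k i r) - natEntropy (k i e) ≤ ε := by
    intro e he r hr' hre
    have h1 := (h.stdShape he).entropy_le_add (h.stdShape hr') h.one_lt hη0.le hδ0 hδ1 hK1
      (hsh e he r hr' hre)
    have h2 := (le_abs_self _).trans (h.abs_log_sd_sub_le hsd he hr')
    have h3 : η / sdMax a b (k i) * |r - e| ≤ η * n := by
      have := h.sdMax_pos
      calc η / sdMax a b (k i) * |r - e| ≤ η / sdMax a b (k i) * (n * sdMax a b (k i)) := by gcongr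
        _ = η * n := by field_simp
    rw [h.natEntropy_eq he, h.natEntropy_eq hr']
    unfold natEntropy
    linarith
  intro e he r hr' hre
  rw [abs_le]
  have h1 := key e he r hr' hre
  have h2 := key r hr' e he (by rwa [abs_sub_comm])
  exact ⟨by linarith, h1⟩

/-- The normalising factor is much larger than `σ_max / 2 ^ h(Q|e)` at the end points, because
the conditional entropy is almost constant over many standard deviations. -/
theorem refTail_le (hk : SlowChange l a b qmin qmax k) (hc : 0 < c)
    (hr : ∀ i, RegularChannel a b qmin qmax c p B (k i)) (hC : 0 < shapeConst p B) {τ ε : ℝ}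
    (hτ : 0 < τ) (hε : 0 < ε) : ∀ᶠ i in l, refTail a b τ (k i) ≤ ε := by
  obtain ⟨n, hn⟩ := exists_nat_gt (4 / τ * (Real.exp 1 / c) / ε)
  have hn0 : (0 : ℝ) < n := lt_of_le_of_lt (by positivity) hn
  by_cases hab : a < b
  swap
  · exact Eventually.of_forall fun i => (hab (hr i).lt).elim
  have hsm : ∀ᶠ i in l, n * sdMax a b (k i) ≤ b - a := by
    have h1 := hk.sdMax_tendsto.const_mul (n : ℝ)
    rw [mul_zero] at h1
    exact h1.eventually (ge_mem_nhds (sub_pos.2 hab))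
  filter_upwards [hk.natEntropy_slow hr hC n one_pos, hsm] with i hent hs
  have h := hr i
  have hm := h.sdMax_pos
  have hN := h.normFactor_pos
  have hd : 0 < n * sdMax a b (k i) := by positivity
  have aux : ∀ e₀, c * Real.exp (-natEntropy (k i e₀) - 1) * (n * sdMax a b (k i)) ≤
      normFactor a b (k i) → Real.exp (-natEntropy (k i e₀)) / normFactor a b (k i) *
        (2 * sdMax a b (k i) / τ) ≤ 2 / τ * (Real.exp 1 / c) / n := by
    intro e₀ h1
    rw [Real.exp_sub] at h1
    rw [div_mul_eq_mul_div, div_le_iff₀ hN]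
    calc Real.exp (-natEntropy (k i e₀)) * (2 * sdMax a b (k i) / τ)
        = 2 / τ * (Real.exp 1 / c) / n * (c * (Real.exp (-natEntropy (k i e₀)) / Real.exp 1) *
          (n * sdMax a b (k i))) := by
          have := Real.exp_ne_zero 1
          field_simp
      _ ≤ _ := by gcongr
  have ha := aux a (by
    have := h.le_normFactor (e₀ := a) (u := a) (v := a + n * sdMax a b (k i)) (Λ := 1)
      (by linarith) le_rfl (by linarith) fun e he => by
        have := hent a h.left_mem e ⟨he.1, by linarith [he.2]⟩ (by
          rw [abs_of_nonneg (by linarith [he.1])]; linarith [he.2])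
        linarith [(abs_le.1 this).2]
    simpa using this)
  have hb := aux b (by
    have := h.le_normFactor (e₀ := b) (u := b - n * sdMax a b (k i)) (v := b) (Λ := 1)
      (by linarith) (by linarith) le_rfl fun e he => by
        have := hent b h.right_mem e ⟨by linarith [he.1], he.2⟩ (by
          rw [abs_sub_comm, abs_of_nonneg (by linarith [he.2])]; linarith [he.1])
        linarith [(abs_le.1 this).2]
    simpa using this)
  refine (h.integrableOn_refDensity_compl hτ).2.trans ?_
  rw [add_div, add_mul]
  refine (add_le_add ha hb).trans ?_
  rw [← add_div, div_le_iff₀ hn0]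
  rw [div_lt_iff₀ hε] at hn
  have e1 : 2 / τ * (Real.exp 1 / c) + 2 / τ * (Real.exp 1 / c) = 4 / τ * (Real.exp 1 / c) := by
    ring
  linarith

/-! ### The capacity -/

/-- The decay rate `τ` of the tails of the reference density has to be small, since it enters the
cross entropy; the mass of the tails is small for every fixed `τ`. -/
theorem cross_entropy_le (hk : SlowChange l a b qmin qmax k) (hc : 0 < c)
    (hr : ∀ i, RegularChannel a b qmin qmax c p B (k i)) (hC : 0 < shapeConst p B) {ε : ℝ}
    (hε : 0 < ε) :
    ∃ τ > 0, ∀ᶠ i in l, refTail a b τ (k i) ≤ ε ∧ ∀ e ∈ Icc a b,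
      -∫ q, Real.log (refDensity a b τ (k i) q) * k i e q ≤
        Real.log (normFactor a b (k i)) + natEntropy (k i e) + ε := by
  have hτ : 0 < ε / 4 := by positivity
  set C := shapeConst p B
  set K := 1 + 8 * C / ε with hK
  have hnn : 0 < 8 * C / ε := by positivity
  have hK1 : 1 ≤ K := by linarith
  have hK2 : 2 * C / K ^ 2 ≤ ε / 4 := by
    rw [div_le_iff₀ (by positivity)]
    have e1 : ε / 4 * (8 * C / ε) = 2 * C := by field_simp; norm_num
    have e2 : K ≤ K ^ 2 := by nlinarith
    calc 2 * C = ε / 4 * (8 * C / ε) := e1.symm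
      _ ≤ ε / 4 * K ^ 2 := by gcongr; linarith
  obtain ⟨n, hn⟩ := exists_nat_ge (K / c)
  have hη : 0 < ε / 4 * c := by positivity
  refine ⟨ε / 4, hτ, ?_⟩
  filter_upwards [hk.refTail_le hc hr hC hτ hε, hk.sd_slow _ hη,
    hk.natEntropy_slow hr hC n hτ] with i h1 h2 h3
  refine ⟨h1, fun e he => ?_⟩
  have h4 := (hr i).neg_integral_log_refDensity_le hτ hη.le (by linarith : 0 < K) hτ.le hn h2 h3 he
  have e1 : ε / 4 * c / c = ε / 4 := by field_simp
  rw [e1] at h4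
  linarith

theorem natInfo_le (hk : SlowChange l a b qmin qmax k) (hc : 0 < c)
    (hr : ∀ i, RegularChannel a b qmin qmax c p B (k i)) (hC : 0 < shapeConst p B) {ε : ℝ}
    (hε : 0 < ε) :
    ∀ᶠ i in l, ∀ P ∈ inputLaws a b, natInfo (k i) P ≤ Real.log (normFactor a b (k i)) + ε := by
  obtain ⟨τ, hτ, h⟩ := hk.cross_entropy_le hc hr hC (half_pos hε)
  filter_upwards [h] with i hi P hP
  have := (hr i).natInfo_le hτ hP hi.2
  linarith

/-- As for the conditional entropy, the parameters are chosen in the order `δ`, `K`, `η`; the bound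
on `K * η` keeps the change of variables monotone. -/
theorem natInfo_slowDensity_ge (hk : SlowChange l a b qmin qmax k) (hc : 0 < c)
    (hr : ∀ i, RegularChannel a b qmin qmax c p B (k i)) (hC : 0 < shapeConst p B) {ε : ℝ}
    (hε : 0 < ε) :
    ∀ᶠ i in l, Real.log (normFactor a b (k i)) - ε ≤
      natInfo (k i) (lawOfDensity a b (slowDensity a b (k i))) := by
  have hpi := Real.pi_pos
  set C := shapeConst p B
  set δ := min 1 (ε / (4 * Real.pi)) with hδ
  have hδ0 : 0 < δ := by positivity
  have hδ1 : δ ≤ 1 := min_le_left _ _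
  have hδ2 : δ * Real.pi ≤ ε / 4 := by
    calc δ * Real.pi ≤ ε / (4 * Real.pi) * Real.pi := by gcongr; exact min_le_right _ _
      _ = ε / 4 := by field_simp
  have hlδ : Real.log δ ≤ 0 := Real.log_nonpos hδ0.le hδ1
  set K := 1 + (3 - Real.log δ) * C * 4 / ε with hK
  have hnn : 0 ≤ (3 - Real.log δ) * C * 4 / ε := by
    have : 0 ≤ 3 - Real.log δ := by linarith
    positivity
  have hK1 : 1 ≤ K := by linarith
  have hK0 : 0 < K := by linarith
  have hK2 : (3 - Real.log δ) * (C / K) ≤ ε / 4 := by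
    rw [← mul_div_assoc, div_le_iff₀ hK0]
    have : ε / 4 * ((3 - Real.log δ) * C * 4 / ε) = (3 - Real.log δ) * C := by field_simp
    nlinarith
  obtain ⟨n, hn⟩ := exists_nat_ge (K / c)
  set η := min (ε / 4) (min (c / (2 * K)) (ε * c / (8 * K))) with hη
  have hη0 : 0 < η := by positivity
  have hη1 : η ≤ ε / 4 := min_le_left _ _
  have hη2 : K * η ≤ c / 2 := by
    calc K * η ≤ K * (c / (2 * K)) := by
          gcongr; exact (min_le_right _ _).trans (min_le_left _ _)
      _ = c / 2 := by field_simp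
  have hη3 : K * η / c ≤ ε / 8 := by
    rw [div_le_iff₀ hc]
    calc K * η ≤ K * (ε * c / (8 * K)) := by
          gcongr; exact (min_le_right _ _).trans (min_le_right _ _)
      _ = ε / 8 * c := by field_simp
  have hη4 : η ≤ c := by nlinarith
  filter_upwards [hk.sd_slow η hη0, hk.shape_slow_nat_mul hr n hK0 hη0] with i hsd hsh
  have h1 := (hr i).natInfo_slowDensity_ge hη0.le hη4 hδ0 hδ1 hK1 (by linarith) hn hsd hsh
  have ht0 : 0 ≤ K * η / c := by positivity
  have ht1 : K * η / c ≤ 1 / 2 := by rw [div_le_iff₀ hc]; linarith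
  have hinv : 1 / (1 - K * η / c) ≤ 1 + 2 * (K * η / c) := by
    rw [div_le_iff₀ (by linarith)]; nlinarith
  have hZ : 0 < 1 / (1 - K * η / c) + δ * Real.pi := by
    have : 0 < 1 - K * η / c := by linarith
    positivity
  have hlog := Real.log_le_sub_one_of_pos hZ
  linarith

/-- Near-optimal input laws produce output densities that are close to the reference density, so
they average slowly varying functions like the candidate density does. -/
theorem abs_integral_sub_le (hk : SlowChange l a b qmin qmax k) (hc : 0 < c)
    (hr : ∀ i, RegularChannel a b qmin qmax c p B (k i)) (hC : 0 < shapeConst p B)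
    {P : ι → Measure ℝ} (hP : ∀ i, P i ∈ inputLaws a b)
    (hmax : AsympMaximises l k (densityLaws a b) P) {ε : ℝ} (hε : 0 < ε) :
    ∀ᶠ i in l, ∀ (F : ℝ → ℝ) (M α β : ℝ), Measurable F → 0 ≤ M → 0 ≤ β →
      (∀ e ∈ Icc a b, |F e| ≤ M) →
      (∀ e ∈ Icc a b, ∀ r ∈ Icc a b, |F r - F e| ≤ α + β * |r - e|) →
      |∫ e, F e ∂(P i) - ∫ e in Icc a b, F e * slowDensity a b (k i) e| ≤
        α + β * (sdMax a b (k i) / c) + M * ε := by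
  set ε' := min ε 1 with hε'
  have hε'0 : 0 < ε' := by positivity
  have hε'1 : ε' ≤ 1 := min_le_right _ _
  set θ := ε' / 12 with hθ
  have hθ0 : 0 < θ := by positivity
  set δ := θ * ε' / 6 with hδ
  have hδ0 : 0 < δ := by positivity
  have hδ1 : δ ≤ ε' / 4 := by
    rw [hδ, hθ]; nlinarith
  have hl2 : 0 < Real.log 2 := Real.log_pos one_lt_two
  obtain ⟨τ, hτ, hce⟩ := hk.cross_entropy_le hc hr hC hδ0
  filter_upwards [hce, hk.natInfo_slowDensity_ge hc hr hC hδ0,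
    hmax (δ / Real.log 2) (by positivity)] with i ⟨htail, hcross⟩ hlow hm F M α β hF hM hβ hb hL
  have h := hr i
  have h1 := hm _ h.slowDensity_law_mem
  rw [h.mutualInfo_eq h.slowDensity_law_mem.1, h.mutualInfo_eq (hP i), ← add_div,
    div_le_div_iff_of_pos_right hl2] at h1
  have h2 := h.integral_abs_output_sub_le hτ (hP i) hθ0 hcross
  refine (h.abs_integral_sub_le hτ (hP i) hF hβ hb hL).trans ?_
  gcongr
  have h0 : 0 ≤ refTail a b τ (k i) := h.refTail_nonneg
  have h3 : (Real.log (normFactor a b (k i)) + δ + refTail a b τ (k i) -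
      natInfo (k i) (P i)) / (2 * θ) ≤ (4 * δ) / (2 * θ) := by
    gcongr; linarith
  have h4 : (4 * δ) / (2 * θ) = ε' / 3 := by rw [hδ]; field_simp; norm_num
  have h5 : θ * (2 + refTail a b τ (k i)) ≤ θ * 3 := by gcongr; linarith
  have h6 : ε' ≤ ε := min_le_left _ _
  have h7 : θ * 3 = ε' / 4 := by rw [hθ]; ring
  linarith

end SlowChange

/-! ### Smoothing -/

/-- Averages of `S` over the images of `[a, b]` under the maps `e ↦ (1 - t) * e + t * z` that
contract `[a, b]` towards one of its points `z`. -/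
noncomputable def contractionAverage (a b t : ℝ) (S : ℝ → ℝ) (e : ℝ) : ℝ :=
  (b - a)⁻¹ * ∫ z in a..b, S ((1 - t) * e + t * z)

section Smoothing

variable {a b t η : ℝ} {S u : ℝ → ℝ}

theorem contraction_mem (ht0 : 0 ≤ t) (ht1 : t ≤ 1) {e z : ℝ} (he : e ∈ Icc a b)
    (hz : z ∈ Icc a b) : (1 - t) * e + t * z ∈ Icc a b :=
  convex_Icc a b he hz (by linarith) ht0 (by ring)

theorem intervalIntegrable_of_abs_le (hS : Measurable S) {C : ℝ} (hC : ∀ x, |S x| ≤ C) (x y : ℝ) :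
    IntervalIntegrable S volume x y := by
  rw [intervalIntegrable_iff]
  exact Measure.integrableOn_of_bounded (M := C) (by simp) hS.aestronglyMeasurable
    (Eventually.of_forall hC)

theorem abs_contractionAverage_le (hab : a < b) (hC : ∀ x, |S x| ≤ 1) (e : ℝ) :
    |contractionAverage a b t S e| ≤ 1 := by
  have h1 : ‖∫ z in a..b, S ((1 - t) * e + t * z)‖ ≤ 1 * |b - a| :=
    intervalIntegral.norm_integral_le_of_norm_le_const fun z _ => hC _
  have h2 : 0 < b - a := sub_pos.2 hab
  rw [contractionAverage, abs_mul, abs_of_pos (inv_pos.2 h2), inv_mul_le_iff₀ h2]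
  rw [Real.norm_eq_abs, abs_of_pos h2] at h1
  linarith

/-- The average is over a window of length `t * (b - a)` that moves with `e`. -/
theorem abs_contractionAverage_sub_le (hab : a < b) (ht0 : 0 < t) (ht1 : t ≤ 1)
    (hS : Measurable S) (hC : ∀ x, |S x| ≤ 1) (e r : ℝ) :
    |contractionAverage a b t S r - contractionAverage a b t S e| ≤
      2 / (t * (b - a)) * |r - e| := by
  have h2 : 0 < b - a := sub_pos.2 hab
  have key : ∀ e, contractionAverage a b t S e =
      (t * (b - a))⁻¹ * ∫ v in (t * a + (1 - t) * e)..(t * b + (1 - t) * e), S v := by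
    intro e
    have := intervalIntegral.integral_comp_mul_add (a := a) (b := b) S ht0.ne' ((1 - t) * e)
    rw [contractionAverage]
    simp_rw [add_comm ((1 - t) * e)]
    rw [this, smul_eq_mul, mul_inv]
    ring
  have hi := intervalIntegrable_of_abs_le hS hC
  rw [key, key, ← mul_sub, intervalIntegral.integral_interval_sub_interval_comm (hi _ _) (hi _ _)
    (hi _ _), abs_mul, abs_of_pos (by positivity)]
  have b1 : ∀ x y : ℝ, |∫ v in x..y, S v| ≤ |y - x| := fun x y => by
    simpa using intervalIntegral.norm_integral_le_of_norm_le_const (a := x) (b := y) (f := S)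
      (C := 1) fun z _ => hC z
  have b2 : ∀ x, |t * x + (1 - t) * e - (t * x + (1 - t) * r)| ≤ |r - e| := by
    intro x
    rw [show t * x + (1 - t) * e - (t * x + (1 - t) * r) = (1 - t) * (e - r) by ring, abs_mul,
      abs_of_nonneg (by linarith), abs_sub_comm e r]
    nlinarith [abs_nonneg (r - e)]
  rw [inv_mul_le_iff₀ (by positivity)]
  have e1 : t * (b - a) * (2 / (t * (b - a)) * |r - e|) = 2 * |r - e| := by field_simp
  rw [e1]
  refine (abs_sub _ _).trans ?_
  linarith [(b1 _ _).trans (b2 a), (b1 _ _).trans (b2 b)]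

theorem measurable_contractionAverage (hS : Measurable S) (hab : a < b) :
    Measurable (contractionAverage a b t S) := by
  have : Measurable (Function.uncurry fun e z : ℝ => S ((1 - t) * e + t * z)) :=
    hS.comp (by fun_prop)
  unfold contractionAverage
  simp_rw [intervalIntegral.integral_of_le hab.le]
  exact (this.stronglyMeasurable.integral_prod_right
    (ν := volume.restrict (Ioc a b))).measurable.const_mul _

/-- For a slowly varying density `u` a contraction of `[a, b]` with small displacements almost
preserves the averages with respect to `u`. -/
theorem abs_integral_contraction_sub_le (hui : IntegrableOn u (Icc a b))
    (hu0 : ∀ e ∈ Icc a b, 0 ≤ u e) (hu1 : ∫ e in Icc a b, u e = 1) (ht0 : 0 ≤ t) (ht1 : t < 1)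
    (hη : 0 ≤ η) (hη1 : η ≤ 1)
    (hslow : ∀ e ∈ Icc a b, ∀ r ∈ Icc a b, |r - e| ≤ t * (b - a) → |u r - u e| ≤ η * u e)
    (hS : Measurable S) (hC : ∀ x, |S x| ≤ 1) {z : ℝ} (hz : z ∈ Icc a b) :
    |(∫ e in Icc a b, S ((1 - t) * e + t * z) * u e) - ∫ e in Icc a b, S e * u e| ≤
      2 * η + 3 * t := by
  set y : ℝ → ℝ := fun e => (1 - t) * e + t * z with hy
  have ht : 0 < 1 - t := by linarith
  have hyd : ∀ e ∈ Icc a b, HasDerivWithinAt y (1 - t) (Icc a b) e := fun e _ => by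
    have h1 := ((hasDerivWithinAt_id e (Icc a b)).const_mul (1 - t)).add_const (t * z)
    rw [mul_one] at h1
    exact h1
  have hyi : InjOn y (Icc a b) := fun e _ r _ h => by
    simp only [hy, add_left_inj] at h
    exact mul_left_cancel₀ ht.ne' h
  have hym : ∀ e ∈ Icc a b, y e ∈ Icc a b := fun e he => contraction_mem ht0 ht1.le he hz
  have hyc : Continuous y := by fun_prop
  have hJ : MeasurableSet (y '' Icc a b) := (isCompact_Icc.image hyc).isClosed.measurableSet
  have hJs : y '' Icc a b ⊆ Icc a b := by rintro _ ⟨e, he, rfl⟩; exact hym e he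
  have hsl : ∀ e ∈ Icc a b, |u (y e) - u e| ≤ η * u e := fun e he => by
    refine hslow e he _ (hym e he) ?_
    rw [show y e - e = t * (z - e) by simp only [hy]; ring, abs_mul, abs_of_nonneg ht0]
    gcongr
    exact abs_le.2 ⟨by linarith [hz.1, he.2], by linarith [hz.2, he.1]⟩
  have bdd : ∀ (T : ℝ → ℝ), Measurable T → (∀ x, |T x| ≤ 1) → ∀ {v : ℝ → ℝ} {A : Set ℝ},
      IntegrableOn v A → IntegrableOn (fun e => T e * v e) A := fun T hT hT1 v A hv =>
    hv.bdd_mul hT.aestronglyMeasurable (Eventually.of_forall hT1)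
  have hSy : Measurable fun e => S (y e) := hS.comp hyc.measurable
  have iu_y : IntegrableOn (fun e => u (y e)) (Icc a b) := by
    have := (integrableOn_image_iff_integrableOn_abs_deriv_smul measurableSet_Icc hyd hyi u).1
      (hui.mono_set hJs)
    simp only [smul_eq_mul, abs_of_pos ht] at this
    have h2 := this.const_mul (1 - t)⁻¹
    refine h2.congr (Eventually.of_forall fun e => ?_)
    simp only
    field_simp
  have eJ : ∀ v : ℝ → ℝ, ∫ x in y '' Icc a b, v x = (1 - t) * ∫ e in Icc a b, v (y e) := by
    intro v
    rw [integral_image_eq_integral_abs_deriv_smul measurableSet_Icc hyd hyi, ← integral_const_mul]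
    simp only [smul_eq_mul, abs_of_pos ht]
  have iSu := bdd S hS hC hui
  -- comparison with the integral over the image of the contraction
  have s1 : |(∫ e in Icc a b, S (y e) * u e) - ∫ x in y '' Icc a b, S x * u x| ≤ η + 2 * t := by
    rw [eJ, ← integral_const_mul]
    have i1 := bdd _ hSy (fun x => hC _) hui
    have i2 := (bdd _ hSy (fun x => hC _) iu_y).const_mul (1 - t)
    rw [← integral_sub i1 i2]
    calc |∫ e in Icc a b, (S (y e) * u e - (1 - t) * (S (y e) * u (y e)))|
        ≤ ∫ e in Icc a b, |S (y e) * u e - (1 - t) * (S (y e) * u (y e))| :=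
          abs_integral_le_integral_abs
      _ ≤ ∫ e in Icc a b, (η + 2 * t) * u e := by
          refine setIntegral_mono_on (i1.sub i2).abs (hui.const_mul _) measurableSet_Icc
            fun e he => ?_
          have h1 := hsl e he
          have h2 := hu0 e he
          have h3 : |u e - (1 - t) * u (y e)| ≤ (η + 2 * t) * u e := by
            have h4 := abs_le.1 h1
            have h5 : η * u e ≤ u e := by nlinarith
            rw [abs_le]
            constructor <;> nlinarith
          rw [show S (y e) * u e - (1 - t) * (S (y e) * u (y e)) =
            S (y e) * (u e - (1 - t) * u (y e)) by ring, abs_mul]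
          calc |S (y e)| * |u e - (1 - t) * u (y e)| ≤ 1 * |u e - (1 - t) * u (y e)| := by
                gcongr; exact hC _
            _ ≤ _ := by rw [one_mul]; exact h3
      _ = η + 2 * t := by rw [integral_const_mul, hu1, mul_one]
  -- the image carries almost all of the mass
  have s2 : |(∫ x in y '' Icc a b, S x * u x) - ∫ e in Icc a b, S e * u e| ≤ η + t := by
    have d1 := setIntegral_sdiff hJ iSu hJs
    have d2 := setIntegral_sdiff hJ hui hJs
    have m1 : (1 - t) * (1 - η) ≤ ∫ x in y '' Icc a b, u x := by
      rw [eJ]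
      gcongr
      calc 1 - η = ∫ e in Icc a b, (1 - η) * u e := by rw [integral_const_mul, hu1, mul_one]
        _ ≤ _ := setIntegral_mono_on (hui.const_mul _) iu_y measurableSet_Icc fun e he => by
            have h1 := (abs_le.1 (hsl e he)).1
            linarith
    have m2 : |∫ x in Icc a b \ y '' Icc a b, S x * u x| ≤
        ∫ x in Icc a b \ y '' Icc a b, u x := by
      refine abs_integral_le_integral_abs.trans (setIntegral_mono_on
        (iSu.mono_set sdiff_subset).abs (hui.mono_set sdiff_subset)
        (measurableSet_Icc.diff hJ) fun e he => ?_)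
      have h2 := hu0 e he.1
      rw [abs_mul, abs_of_nonneg h2]
      nlinarith [hC e]
    rw [d1, d2, hu1] at m2
    rw [abs_sub_comm]
    refine m2.trans ?_
    nlinarith [mul_nonneg ht0 hη]
  have := abs_sub_le (∫ e in Icc a b, S (y e) * u e) (∫ x in y '' Icc a b, S x * u x)
    (∫ e in Icc a b, S e * u e)
  linarith

theorem abs_integral_contractionAverage_sub_le (hab : a < b) (hui : IntegrableOn u (Icc a b))
    (hu0 : ∀ e ∈ Icc a b, 0 ≤ u e) (hu1 : ∫ e in Icc a b, u e = 1) (ht0 : 0 ≤ t) (ht1 : t < 1)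
    (hη : 0 ≤ η) (hη1 : η ≤ 1)
    (hslow : ∀ e ∈ Icc a b, ∀ r ∈ Icc a b, |r - e| ≤ t * (b - a) → |u r - u e| ≤ η * u e)
    (hS : Measurable S) (hC : ∀ x, |S x| ≤ 1) :
    |(∫ e in Icc a b, contractionAverage a b t S e * u e) - ∫ e in Icc a b, S e * u e| ≤
      2 * η + 3 * t := by
  have h2 : 0 < b - a := sub_pos.2 hab
  have hm : Measurable (Function.uncurry fun e z : ℝ => S ((1 - t) * e + t * z)) :=
    hS.comp (by fun_prop)
  have hi : Integrable (Function.uncurry fun e z : ℝ => S ((1 - t) * e + t * z) * u e)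
      ((volume.restrict (Icc a b)).prod (volume.restrict (Icc a b))) := by
    have h3 : Integrable (fun w : ℝ × ℝ => u w.1)
        ((volume.restrict (Icc a b)).prod (volume.restrict (Icc a b))) := hui.comp_fst _
    exact h3.bdd_mul hm.aestronglyMeasurable (Eventually.of_forall fun w => hC _)
  have e1 : ∫ e in Icc a b, contractionAverage a b t S e * u e =
      (b - a)⁻¹ * ∫ z in Icc a b, ∫ e in Icc a b, S ((1 - t) * e + t * z) * u e := by
    rw [← integral_integral_swap hi, ← integral_const_mul]
    congr 1; ext e
    rw [contractionAverage, intervalIntegral.integral_of_le hab.le,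
      ← integral_Icc_eq_integral_Ioc, integral_mul_const, mul_assoc]
  have e2 : ∫ e in Icc a b, S e * u e =
      (b - a)⁻¹ * ∫ z in Icc a b, (∫ e in Icc a b, S e * u e) := by
    rw [setIntegral_const]
    simp [h2.le]
    field_simp
  have hi' := hi.integral_prod_right
  simp only [Function.uncurry] at hi'
  rw [e1, e2, ← mul_sub, ← integral_sub hi' (integrable_const _), abs_mul,
    abs_of_pos (inv_pos.2 h2), inv_mul_le_iff₀ h2]
  have h4 := norm_setIntegral_le_of_norm_le_const (μ := volume) (s := Icc a b) (C := 2 * η + 3 * t)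
    (f := fun z => (∫ e in Icc a b, S ((1 - t) * e + t * z) * u e) - ∫ e in Icc a b, S e * u e)
    (by simp) fun z hz =>
      abs_integral_contraction_sub_le hui hu0 hu1 ht0 ht1 hη hη1 hslow hS hC hz
  simp only [Real.norm_eq_abs, Real.volume_real_Icc_of_le hab.le] at h4
  linarith

end Smoothing

/-! ### Convergence of near-optimal input laws -/

theorem integrable_of_lawOfDensity_mem {a b : ℝ} {p : ℝ → ℝ} (hm : Measurable p)
    (h0 : ∀ e ∈ Icc a b, 0 ≤ p e) (h : lawOfDensity a b p ∈ densityLaws a b) :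
    IntegrableOn p (Icc a b) ∧ ∫ e in Icc a b, p e = 1 := by
  have h1 := h.1.1.measure_univ
  have hnn : 0 ≤ᵐ[volume.restrict (Icc a b)] p := by
    filter_upwards [ae_restrict_mem measurableSet_Icc] with e he using h0 e he
  rw [lawOfDensity, withDensity_apply _ MeasurableSet.univ, Measure.restrict_univ] at h1
  refine ⟨⟨hm.aestronglyMeasurable, (hasFiniteIntegral_iff_ofReal hnn).2 ?_⟩, ?_⟩
  · rw [h1]; exact ENNReal.one_lt_top
  · rw [integral_eq_lintegral_of_nonneg_ae hnn hm.aestronglyMeasurable, h1, ENNReal.toReal_one]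

/-- A uniformly continuous function is Lipschitz up to any given error. -/
theorem exists_linear_modulus {a b : ℝ} {ψ : ℝ → ℝ} (hψ : ContinuousOn ψ (Icc a b)) {M ε : ℝ}
    (hM : ∀ e ∈ Icc a b, |ψ e| ≤ M) (hM0 : 0 ≤ M) (hε : 0 < ε) :
    ∃ β, 0 ≤ β ∧ ∀ e ∈ Icc a b, ∀ r ∈ Icc a b, |ψ r - ψ e| ≤ ε + β * |r - e| := by
  have hu := isCompact_Icc.uniformContinuousOn_of_continuous hψ
  obtain ⟨ρ, hρ, h⟩ := Metric.uniformContinuousOn_iff.1 hu ε hε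
  refine ⟨2 * M / ρ, by positivity, fun e he r hr => ?_⟩
  by_cases hd : |r - e| < ρ
  · have h1 := h r hr e he hd
    rw [Real.dist_eq] at h1
    have : 0 ≤ 2 * M / ρ * |r - e| := by positivity
    linarith
  · have h1 : 2 * M ≤ 2 * M / ρ * |r - e| := by
      calc 2 * M = 2 * M / ρ * ρ := by field_simp
        _ ≤ _ := by gcongr; exact not_lt.1 hd
    have h2 := abs_sub (ψ r) (ψ e)
    linarith [hM e he, hM r hr]

namespace SlowChange

variable {ι : Type*} {l : Filter ι} {a b qmin qmax c p B : ℝ} {k : ι → ℝ → ℝ → ℝ}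

theorem slowDensity_slow (hk : SlowChange l a b qmin qmax k)
    (hr : ∀ i, RegularChannel a b qmin qmax c p B (k i)) (hC : 0 < shapeConst p B) (n : ℕ) :
    SlowlyVarying l a b (fun i => n * sdMax a b (k i)) (fun i => slowDensity a b (k i)) := by
  intro η hη
  have hε : 0 < min (η / 4) 1 := by positivity
  filter_upwards [hk.slope_slow.nat_mul (fun i => (hr i).sdMax_pos.le) n (η / 6) (by positivity),
    hk.natEntropy_slow hr hC n hε] with i h1 h2 e he r hr' hre
  have h := hr i
  have hN := h.normFactor_pos
  have hm := h.slope_pos he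
  have h3 := h1 e he r hr' hre
  have h4 := h2 e he r hr' hre
  have hE := Real.exp_pos (-natEntropy (k i e))
  have h5 : |Real.exp (-natEntropy (k i r)) - Real.exp (-natEntropy (k i e))| ≤
      2 * min (η / 4) 1 * Real.exp (-natEntropy (k i e)) := by
    have e1 : Real.exp (-natEntropy (k i r)) - Real.exp (-natEntropy (k i e)) =
        Real.exp (-natEntropy (k i e)) *
          (Real.exp (-(natEntropy (k i r) - natEntropy (k i e))) - 1) := by
      rw [mul_sub, ← Real.exp_add, mul_one]; congr 2; ring
    have h6 : |-(natEntropy (k i r) - natEntropy (k i e))| ≤ 1 := by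
      rw [abs_neg]; exact h4.trans (min_le_right _ _)
    have h7 := Real.abs_exp_sub_one_le h6
    rw [abs_neg] at h7
    rw [e1, abs_mul, abs_of_pos hE, mul_comm]
    gcongr
    linarith
  have h8 : Real.exp (-natEntropy (k i r)) ≤ 3 * Real.exp (-natEntropy (k i e)) := by
    have := (abs_le.1 h5).2
    nlinarith [min_le_right (η / 4) 1]
  have h9 : |slopeOverEntropy a b (k i) r - slopeOverEntropy a b (k i) e| ≤
      η * slopeOverEntropy a b (k i) e := by
    rw [RegularChannel.slopeOverEntropy_eq, RegularChannel.slopeOverEntropy_eq]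
    set Mr := meanSlope a b (k i) r
    set Me := meanSlope a b (k i) e
    set Er := Real.exp (-natEntropy (k i r))
    set Ee := Real.exp (-natEntropy (k i e))
    have hEr : 0 < Er := Real.exp_pos _
    calc |Mr * Er - Me * Ee| = |(Mr - Me) * Er + Me * (Er - Ee)| := by congr 1; ring
      _ ≤ |(Mr - Me) * Er| + |Me * (Er - Ee)| := abs_add_le _ _
      _ = |Mr - Me| * Er + Me * |Er - Ee| := by
          rw [abs_mul, abs_mul, abs_of_pos hEr, abs_of_pos hm]
      _ ≤ (η / 6 * Me) * (3 * Ee) + Me * (2 * (η / 4) * Ee) := by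
          gcongr
          refine h5.trans ?_
          gcongr
          exact min_le_left _ _
      _ = η * (Me * Ee) := by ring
  rw [RegularChannel.slowDensity_eq, RegularChannel.slowDensity_eq, ← sub_div, abs_div,
    abs_of_pos hN, ← mul_div_assoc]
  gcongr

theorem tendsto_integral_sub (hk : SlowChange l a b qmin qmax k) (hc : 0 < c)
    (hr : ∀ i, RegularChannel a b qmin qmax c p B (k i)) (hC : 0 < shapeConst p B)
    {P : ι → Measure ℝ} (hP : ∀ i, P i ∈ inputLaws a b)
    (hmax : AsympMaximises l k (densityLaws a b) P) {ψ : ℝ → ℝ} (hψ : Continuous ψ) :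
    Tendsto (fun i => ∫ e, ψ e ∂(P i) - ∫ e in Icc a b, ψ e * slowDensity a b (k i) e)
      l (𝓝 0) := by
  obtain ⟨M, hM⟩ := isCompact_Icc.exists_bound_of_continuousOn (s := Icc a b) hψ.continuousOn
  have hM' : ∀ e ∈ Icc a b, |ψ e| ≤ max M 0 := fun e he => (hM e he).trans (le_max_left _ _)
  have hM0 : 0 ≤ max M 0 := le_max_right _ _
  set M' := max M 0
  rw [Metric.tendsto_nhds]
  intro ε hε
  obtain ⟨β, hβ, hL⟩ := exists_linear_modulus hψ.continuousOn hM' hM0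
    (by positivity : 0 < ε / 4)
  have hs : Tendsto (fun i => β * (sdMax a b (k i) / c)) l (𝓝 0) := by
    simpa using (hk.sdMax_tendsto.div_const c).const_mul β
  filter_upwards [hk.abs_integral_sub_le hc hr hC hP hmax
    (by positivity : 0 < ε / (4 * (M' + 1))), hs.eventually (ge_mem_nhds (by positivity : 0 < ε / 4))]
    with i h1 h2
  have h3 := h1 ψ M' (ε / 4) β hψ.measurable hM0 hβ hM' hL
  have h4 : M' * (ε / (4 * (M' + 1))) ≤ ε / 4 := by
    rw [mul_div_assoc', div_le_iff₀ (by positivity)]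
    nlinarith
  rw [Real.dist_eq, sub_zero]
  linarith

/-- The `L¹` distance is the integral of `f - g` against the sign `S` of `f - g`. As `f` and `g`
vary slowly, `S` may be replaced by averages of `S` over windows of many standard deviations, and
these are slowly varying test functions. -/
theorem tendsto_integral_abs_sub (hk : SlowChange l a b qmin qmax k) (hc : 0 < c)
    (hab : a < b) (hr : ∀ i, RegularChannel a b qmin qmax c p B (k i)) (hC : 0 < shapeConst p B)
    {f : ι → ℝ → ℝ} (hfm : ∀ i, Measurable (f i)) (hf0 : ∀ i, ∀ e ∈ Icc a b, 0 ≤ f i e)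
    (hf : ∀ i, lawOfDensity a b (f i) ∈ densityLaws a b)
    (hmax : AsympMaximises l k (densityLaws a b) fun i => lawOfDensity a b (f i))
    (hslow : SlowlyVarying l a b (fun i => sdMax a b (k i)) f) :
    Tendsto (fun i => ∫ e in Icc a b, |f i e - slowDensity a b (k i) e|) l (𝓝 0) := by
  have hba : 0 < b - a := sub_pos.2 hab
  rw [Metric.tendsto_nhds]
  intro ε hε
  set η := min (ε / 32) 1 with hη
  have hη0 : 0 < η := by positivity
  have hη1 : η ≤ 1 := min_le_right _ _
  have hη2 : η ≤ ε / 32 := min_le_left _ _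
  obtain ⟨n, hn⟩ := exists_nat_gt (16 / (c * ε))
  have hn0 : (0 : ℝ) < n := lt_of_le_of_lt (by positivity) hn
  have hs : Tendsto (fun i => n * sdMax a b (k i) / (b - a)) l (𝓝 0) := by
    simpa using (hk.sdMax_tendsto.const_mul (n : ℝ)).div_const (b - a)
  filter_upwards [hslow.nat_mul (fun i => (hr i).sdMax_pos.le) n η hη0,
    hk.slowDensity_slow hr hC n η hη0,
    hk.abs_integral_sub_le hc hr hC (fun i => (hf i).1) hmax (by positivity : 0 < ε / 8),
    hs.eventually (ge_mem_nhds (by positivity : 0 < min (ε / 48) (1 / 2)))] with i h1 h2 h3 h4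
  have h := hr i
  have hm := h.sdMax_pos
  -- averaging windows of `n` times `σ_max`
  set t := n * sdMax a b (k i) / (b - a) with ht
  have ht0 : 0 < t := by positivity
  have ht1 : t < 1 := lt_of_le_of_lt (h4.trans (min_le_right _ _)) (by norm_num)
  have ht2 : t ≤ ε / 48 := h4.trans (min_le_left _ _)
  have htb : t * (b - a) = n * sdMax a b (k i) := by rw [ht]; field_simp
  obtain ⟨hfi, hf1⟩ := integrable_of_lawOfDensity_mem (hfm i) (hf0 i) (hf i)
  have hgi := h.integrableOn_slowDensity
  have hg0 : ∀ e ∈ Icc a b, 0 ≤ slowDensity a b (k i) e := fun e he => (h.slowDensity_pos he).le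
  set g := slowDensity a b (k i) with hg
  -- the one-sided derivative in `g` is only known to be almost everywhere measurable
  obtain ⟨g', hg'm, hgg'⟩ := hgi.aestronglyMeasurable.aemeasurable
  set S : ℝ → ℝ := fun e => if g' e ≤ f i e then 1 else -1 with hSdef
  have hS : Measurable S :=
    Measurable.ite (measurableSet_le hg'm (hfm i)) measurable_const measurable_const
  have hS1 : ∀ x, |S x| ≤ 1 := fun x => by simp only [hSdef]; split_ifs <;> simp
  have bdd : ∀ {v : ℝ → ℝ}, IntegrableOn v (Icc a b) →
      IntegrableOn (fun e => S e * v e) (Icc a b) := fun hv =>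
    hv.bdd_mul hS.aestronglyMeasurable (Eventually.of_forall hS1)
  have e1 : ∫ e in Icc a b, |f i e - g e| =
      (∫ e in Icc a b, S e * f i e) - ∫ e in Icc a b, S e * g e := by
    rw [← integral_sub (bdd hfi) (bdd hgi)]
    refine integral_congr_ae ?_
    filter_upwards [hgg'] with e he
    rw [← mul_sub, he]
    simp only [hSdef]
    split_ifs with hc'
    · rw [abs_of_nonneg (by linarith)]; ring
    · rw [abs_of_neg (by linarith [not_le.1 hc'])]; ring
  have a1 := abs_integral_contractionAverage_sub_le hab hfi (hf0 i) hf1 ht0.le ht1 hη0.le hη1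
    (by rw [htb]; exact h1) hS hS1
  have a2 := abs_integral_contractionAverage_sub_le hab hgi hg0 h.integral_slowDensity ht0.le ht1
    hη0.le hη1 (by rw [htb]; exact h2) hS hS1
  have a3 := h3 (contractionAverage a b t S) 1 0 (2 / (t * (b - a)))
    (measurable_contractionAverage hS hab) zero_le_one (by positivity)
    (fun e _ => abs_contractionAverage_le hab hS1 e)
    (fun e _ r _ => by
      rw [zero_add]; exact abs_contractionAverage_sub_le hab ht0 ht1.le hS hS1 e r)
  rw [integral_lawOfDensity (hfm i).aemeasurable (hf0 i), htb] at a3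
  have a4 : 2 / (n * sdMax a b (k i)) * (sdMax a b (k i) / c) ≤ ε / 8 := by
    have : 2 / (n * sdMax a b (k i)) * (sdMax a b (k i) / c) = 2 / (n * c) := by field_simp
    rw [this, div_le_iff₀ (by positivity)]
    rw [div_lt_iff₀ (by positivity)] at hn
    linarith
  have hnn : 0 ≤ ∫ e in Icc a b, |f i e - g e| := integral_nonneg fun e => abs_nonneg _
  rw [Real.dist_eq, sub_zero, abs_of_nonneg hnn, e1]
  have c1 := abs_le.1 a1
  have c2 := abs_le.1 a2
  have c3 := abs_le.1 a3
  linarith [c1.1, c2.2, c3.2]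

/-- An equicontinuous difference that is not small at `e` keeps its sign near `e`, so a bump function
at `e` detects it, against weak convergence. Compactness makes the convergence uniform. -/
theorem tendstoUniformlyOn_sub (hk : SlowChange l a b qmin qmax k) (hc : 0 < c)
    (hab : a < b) (hr : ∀ i, RegularChannel a b qmin qmax c p B (k i)) (hC : 0 < shapeConst p B)
    {f : ι → ℝ → ℝ} (hfm : ∀ i, Measurable (f i)) (hf0 : ∀ i, ∀ e ∈ Icc a b, 0 ≤ f i e)
    (hf : ∀ i, lawOfDensity a b (f i) ∈ densityLaws a b)
    (hmax : AsympMaximises l k (densityLaws a b) fun i => lawOfDensity a b (f i))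
    (heq : EquicontinuousOn (fun i e => f i e - slowDensity a b (k i) e) (Icc a b)) :
    TendstoUniformlyOn (fun i e => f i e - slowDensity a b (k i) e) (fun _ => 0) l (Icc a b) := by
  rw [← tendstoLocallyUniformlyOn_iff_tendstoUniformlyOn_of_compact isCompact_Icc,
    Metric.tendstoLocallyUniformlyOn_iff]
  intro ε hε e he
  have h1 := heq e he _ (Metric.dist_mem_uniformity (by positivity : 0 < ε / 4))
  obtain ⟨ρ, hρ, hball⟩ := Metric.mem_nhdsWithin_iff.1 h1
  refine ⟨Metric.ball e ρ ∩ Icc a b, Metric.mem_nhdsWithin_iff.2 ⟨ρ, hρ, subset_rfl⟩, ?_⟩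
  set ψ : ℝ → ℝ := fun r => max 0 (ρ - |r - e|) with hψ
  have hψc : Continuous ψ := by fun_prop
  have hψ0 : ∀ r, 0 ≤ ψ r := fun r => le_max_left _ _
  have hψi : IntegrableOn ψ (Icc a b) := hψc.continuousOn.integrableOn_Icc
  have hI : 0 < ∫ r in Icc a b, ψ r := by
    rw [integral_Icc_eq_integral_Ioc, ← intervalIntegral.integral_of_le hab.le]
    refine intervalIntegral.integral_pos hab hψc.continuousOn (fun r _ => hψ0 r) ⟨e, he, ?_⟩
    simp [hψ, hρ]
  have hten := hk.tendsto_integral_sub hc hr hC (fun i => (hf i).1) hmax hψc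
  rw [Metric.tendsto_nhds] at hten
  filter_upwards [hten (ε / 4 * ∫ r in Icc a b, ψ r) (by positivity)] with i hi r hri
  have h := hr i
  obtain ⟨hfi, hf1⟩ := integrable_of_lawOfDensity_mem (hfm i) (hf0 i) (hf i)
  have hgi := h.integrableOn_slowDensity
  have near : ∀ r ∈ Metric.ball e ρ ∩ Icc a b, |(f i e - slowDensity a b (k i) e) -
      (f i r - slowDensity a b (k i) r)| < ε / 4 := fun r hr => by
    have := hball hr i
    rw [mem_ofPred_eq, Real.dist_eq] at this
    exact this
  set v : ℝ → ℝ := fun r => f i r - slowDensity a b (k i) r with hv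
  have bdd : ∀ {w : ℝ → ℝ}, IntegrableOn w (Icc a b) →
      IntegrableOn (fun r => ψ r * w r) (Icc a b) := fun hw =>
    hw.bdd_mul (c := ρ) hψc.aestronglyMeasurable (Eventually.of_forall fun r => by
      rw [Real.norm_eq_abs, abs_of_nonneg (hψ0 r)]
      exact max_le hρ.le (by linarith [abs_nonneg (r - e)]))
  rw [integral_lawOfDensity (hfm i).aemeasurable (hf0 i), ← integral_sub (bdd hfi) (bdd hgi),
    Real.dist_eq, sub_zero] at hi
  have e1 : ∫ r in Icc a b, (ψ r * f i r - ψ r * slowDensity a b (k i) r) =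
      ∫ r in Icc a b, ψ r * v r := by
    congr 1; ext r; simp only [hv]; ring
  rw [e1] at hi
  have iv : IntegrableOn v (Icc a b) := hfi.sub hgi
  have i1 := hψi.const_mul (v e)
  have h2 : |(∫ r in Icc a b, v e * ψ r) - ∫ r in Icc a b, ψ r * v r| ≤
      ε / 4 * ∫ r in Icc a b, ψ r := by
    rw [← integral_sub i1 (bdd iv), ← integral_const_mul]
    refine abs_integral_le_integral_abs.trans (setIntegral_mono_on (i1.sub (bdd iv)).abs
      (hψi.const_mul _) measurableSet_Icc fun r hr' => ?_)
    rw [show v e * ψ r - ψ r * v r = (v e - v r) * ψ r by ring, abs_mul, abs_of_nonneg (hψ0 r)]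
    by_cases hd : |r - e| < ρ
    · exact mul_le_mul_of_nonneg_right (near r ⟨hd, hr'⟩).le (hψ0 r)
    · have : ψ r = 0 := max_eq_left (by linarith [not_lt.1 hd])
      simp [this]
  rw [integral_const_mul] at h2
  have h3 : |v e| ≤ ε / 2 := by
    have h4 : |v e * ∫ r in Icc a b, ψ r| ≤ ε / 2 * ∫ r in Icc a b, ψ r := by
      have := abs_sub_abs_le_abs_sub (v e * ∫ r in Icc a b, ψ r) (∫ r in Icc a b, ψ r * v r)
      linarith
    rw [abs_mul, abs_of_pos hI] at h4
    exact le_of_mul_le_mul_right h4 hI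
  have h5 := near r hri
  have h6 : |v r| ≤ |v e| + |v e - v r| := by
    have := abs_sub_abs_le_abs_sub (v r) (v e)
    rw [abs_sub_comm (v r)] at this
    linarith
  rw [dist_comm, Real.dist_eq, sub_zero]
  change |v r| < ε
  change |v e - v r| < ε / 4 at h5
  linarith

end SlowChange

theorem theorem2 {ι : Type*} (l : Filter ι) (a b qmin qmax : ℝ) (hab : a < b)
    (k : ι → ℝ → ℝ → ℝ) (hk : SlowChange l a b qmin qmax k) :
    -- the candidate is a genuine probability density on `[a, b]`
    (∀ i, 0 < normFactor a b (k i) ∧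
      lawOfDensity a b (slowDensity a b (k i)) ∈ densityLaws a b) ∧
    -- it achieves the capacity asymptotically, among all input laws
    AsympMaximises l k (inputLaws a b) (fun i => lawOfDensity a b (slowDensity a b (k i))) ∧
    -- every capacity-achieving family of input laws is asymptotic to it: weakly, in general
    (∀ P : ι → Measure ℝ, (∀ i, P i ∈ inputLaws a b) → AsympMaximises l k (densityLaws a b) P →
      ∀ ψ : ℝ → ℝ, Continuous ψ →
        Tendsto (fun i => ∫ e, ψ e ∂(P i) - ∫ e in a..b, ψ e * slowDensity a b (k i) e)
          l (𝓝 0)) ∧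
    -- and in the sense of densities when the maximising densities vary slowly
    (∀ p : ι → ℝ → ℝ, (∀ i, Measurable (p i)) → (∀ i, ∀ e ∈ Icc a b, 0 ≤ p i e) →
      (∀ i, lawOfDensity a b (p i) ∈ densityLaws a b) →
      AsympMaximises l k (densityLaws a b) (fun i => lawOfDensity a b (p i)) →
      (SlowlyVarying l a b (fun i => sdMax a b (k i)) p →
        Tendsto (fun i => ∫ e in a..b, |p i e - slowDensity a b (k i) e|) l (𝓝 0)) ∧
      (EquicontinuousOn (fun i e => p i e - slowDensity a b (k i) e) (Icc a b) →
        TendstoUniformlyOn (fun i e => p i e - slowDensity a b (k i) e) (fun _ => 0) l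
          (Icc a b))) := by
  obtain ⟨c, s, B, hc, hC, hr⟩ := hk.exists_regular hab
  have hint : ∀ F : ℝ → ℝ, ∫ e in a..b, F e = ∫ e in Icc a b, F e := fun F => by
    rw [intervalIntegral.integral_of_le hab.le, integral_Icc_eq_integral_Ioc]
  refine ⟨fun i => ⟨(hr i).normFactor_pos, (hr i).slowDensity_law_mem⟩, ?_, ?_, ?_⟩
  · intro ε hε
    have hl2 : 0 < Real.log 2 := Real.log_pos one_lt_two
    have hε' : 0 < ε * Real.log 2 / 2 := by positivity
    filter_upwards [hk.natInfo_le hc hr hC hε', hk.natInfo_slowDensity_ge hc hr hC hε']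
      with i h1 h2 R hR
    rw [(hr i).mutualInfo_eq hR, (hr i).mutualInfo_eq (hr i).slowDensity_law_mem.1,
      div_add' _ _ _ hl2.ne', div_le_div_iff_of_pos_right hl2]
    linarith [h1 R hR]
  · intro P hP hmax ψ hψ
    simp_rw [hint]
    exact hk.tendsto_integral_sub hc hr hC hP hmax hψ
  · intro f hfm hf0 hf hmax
    simp_rw [hint]
    exact ⟨hk.tendsto_integral_abs_sub hc hab hr hC hfm hf0 hf hmax,
      hk.tendstoUniformlyOn_sub hc hab hr hC hfm hf0 hf hmax⟩
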